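/- Let $a_n$ ($n\ge 0$) be the Taylor coefficients at $z=0$ of the entire function $1/\Gamma(z)=\sum_{n\ge 1}a_nz^n$, and let $b_n=a_{n+1}$, so that $\frac{1}{\Gamma(1+z)}=\sum_{n\ge0}b_nz^n$. If $z\in\mathbb{C}$ with $|z|\le 20$ and $N\in\mathbb{N}$ with $N\le 1000$, then $$\left|\frac{1}{\Gamma(1+z)}-\sum_{n=0}^{N-1}b_nz^n\right|\le 8\max\left(\tfrac12,|z|\right)|b_N||z|^N,$$ provided that the right-hand side is smaller than $2^{-8}$. For $|z|\le 20$, the same statement also holds for every $N\le 10000$ with $N\notin\{1443,2005,9891\}$. (Here $1/\Gamma$ is read as $0$ at the poles of $\Gamma$, and $0^0=1$.) -/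

import Mathlib

/-- The Taylor coefficients `a_n` at `z = 0` of the entire function `1 / Γ(z)`. At the poles
`z = 0, -1, -2, …` of `Γ`, Mathlib's `Complex.Gamma` is `0`, so that `1 / Complex.Gamma z` is `0`
there, which is the value of the entire function. -/
noncomputable def rgammaCoeff (n : ℕ) : ℂ :=
  iteratedDeriv n (fun z : ℂ => 1 / Complex.Gamma z) 0 / (n.factorial : ℂ)

/-- The shifted coefficients `b_n = a_{n+1}`, so that `1 / Γ(1 + z) = ∑ b_n z ^ n`. -/
noncomputable def rgammaShiftCoeff (n : ℕ) : ℂ :=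
  rgammaCoeff (n + 1)

/-- The right-hand side `8 max(1/2, |z|) |b_N| |z|^N` of the error estimate. -/
noncomputable def rgammaErrorBound (N : ℕ) (z : ℂ) : ℝ :=
  8 * max (1 / 2) ‖z‖ * ‖rgammaShiftCoeff N‖ * ‖z‖ ^ N

open MeasureTheory Filter Topology

section LaplaceGamma

/-- The Laplace transform of `x ^ (p - 1)` at a point of the right half plane. -/
noncomputable def laplacePow (p : ℝ) (z : ℂ) : ℂ :=
  ∫ x in Set.Ioi (0 : ℝ), ((x ^ (p - 1) : ℝ) : ℂ) * Complex.exp (-(z * x))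

theorem integrableOn_rpow_mul_exp {p : ℝ} (hp : 0 < p) {r : ℝ} (hr : 0 < r) :
    IntegrableOn (fun x : ℝ => x ^ (p - 1) * Real.exp (-(r * x))) (Set.Ioi 0) := by
  have := integrableOn_rpow_mul_exp_neg_mul_rpow (p := 1) (s := p - 1) (b := r)
    (by linarith) (by norm_num) hr
  simpa using this

theorem aestronglyMeasurable_laplace (p : ℝ) (z : ℂ) :
    AEStronglyMeasurable (fun x : ℝ => ((x ^ (p - 1) : ℝ) : ℂ) * Complex.exp (-(z * x)))
      (volume.restrict (Set.Ioi 0)) := by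
  refine AEStronglyMeasurable.mul ?_ (by fun_prop)
  exact (Measurable.aestronglyMeasurable (by fun_prop))

theorem norm_laplace_integrand (p : ℝ) (z : ℂ) {x : ℝ} (hx : 0 < x) :
    ‖((x ^ (p - 1) : ℝ) : ℂ) * Complex.exp (-(z * x))‖ = x ^ (p - 1) * Real.exp (-(z.re * x)) := by
  rw [norm_mul, Complex.norm_exp, Complex.norm_real, Real.norm_of_nonneg (by positivity)]
  simp

theorem differentiableAt_laplacePow {p : ℝ} (hp : 0 < p) {z : ℂ} (hz : 0 < z.re) :
    DifferentiableAt ℂ (laplacePow p) z := by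
  have key := hasDerivAt_integral_of_dominated_loc_of_deriv_le
    (μ := volume.restrict (Set.Ioi (0 : ℝ)))
    (F := fun (w : ℂ) (x : ℝ) => ((x ^ (p - 1) : ℝ) : ℂ) * Complex.exp (-(w * x)))
    (F' := fun (w : ℂ) (x : ℝ) => ((x ^ (p - 1) : ℝ) : ℂ) * (Complex.exp (-(w * x)) * (-x)))
    (x₀ := z) (s := Metric.ball z (z.re / 2))
    (bound := fun x => x ^ (p + 1 - 1) * Real.exp (-(z.re / 2 * x)))
    (Metric.ball_mem_nhds z (by positivity))
    (Eventually.of_forall fun w => aestronglyMeasurable_laplace p w)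
    ?_ ?_ ?_ (integrableOn_rpow_mul_exp (by linarith) (by positivity)) ?_
  · exact key.2.differentiableAt
  · refine (integrable_norm_iff (aestronglyMeasurable_laplace p z)).1 ?_
    refine (integrableOn_rpow_mul_exp hp hz).congr_fun (fun x hx => ?_) measurableSet_Ioi
    exact (norm_laplace_integrand p z hx).symm
  · refine AEStronglyMeasurable.mul ?_ (by fun_prop)
    exact (Measurable.aestronglyMeasurable (by fun_prop))
  · refine (ae_restrict_iff' measurableSet_Ioi).2 (Eventually.of_forall fun x hx w hw => ?_)
    have hx : (0 : ℝ) < x := hx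
    have hre : z.re / 2 ≤ w.re := by
      have h1 := Complex.abs_re_le_norm (w - z)
      have h2 : ‖w - z‖ < z.re / 2 := by simpa [dist_eq_norm] using hw
      have := (abs_lt.1 (h1.trans_lt h2)).1
      simp at this
      linarith
    rw [← mul_assoc, norm_mul, norm_laplace_integrand p w hx, norm_neg, Complex.norm_real,
      Real.norm_of_nonneg hx.le, mul_right_comm, ← Real.rpow_add_one hx.ne']
    have e : p - 1 + 1 = p + 1 - 1 := by ring
    rw [e]
    gcongr
  · refine Eventually.of_forall fun x w _ => ?_
    have h : HasDerivAt (fun w : ℂ => -(w * x)) (-(1 * (x : ℂ))) w :=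
      ((hasDerivAt_id w).mul_const (x : ℂ)).neg
    rw [one_mul] at h
    exact (h.cexp).const_mul _

theorem laplacePow_eq {p : ℝ} (hp : 0 < p) {z : ℂ} (hz : 0 < z.re) :
    laplacePow p z = z ^ (-(p : ℂ)) * Complex.Gamma p := by
  let U : Set ℂ := {z | 0 < z.re}
  have hU : IsOpen U := isOpen_lt continuous_const Complex.continuous_re
  have hf : AnalyticOnNhd ℂ (laplacePow p) U :=
    DifferentiableOn.analyticOnNhd
      (fun w hw => (differentiableAt_laplacePow hp hw).differentiableWithinAt) hU
  have hg : AnalyticOnNhd ℂ (fun z : ℂ => z ^ (-(p : ℂ)) * Complex.Gamma p) U := by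
    refine DifferentiableOn.analyticOnNhd (fun w hw => ?_) hU
    have : DifferentiableAt ℂ (fun z : ℂ => z ^ (-(p : ℂ))) w :=
      DifferentiableAt.cpow_const (differentiableAt_id) (Or.inl hw)
    exact (this.mul_const _).differentiableWithinAt
  have hconv : Convex ℝ U := convex_halfSpace_re_gt 0
  refine hf.eqOn_of_preconnected_of_frequently_eq hg hconv.isPreconnected
    (z₀ := 1) (by simp [U]) ?_ hz
  have hreal : ∀ r : ℝ, 0 < r → laplacePow p r = (r : ℂ) ^ (-(p : ℂ)) * Complex.Gamma p := by
    intro r hr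
    have h := Complex.integral_cpow_mul_exp_neg_mul_Ioi (a := p) (r := r) (by simpa) hr
    rw [one_div, Complex.inv_cpow _ _ (by
      rw [Complex.arg_ofReal_of_nonneg hr.le]; exact Real.pi_pos.ne), ← Complex.cpow_neg] at h
    rw [← h, laplacePow]
    refine setIntegral_congr_fun measurableSet_Ioi fun x hx => ?_
    have hx : (0 : ℝ) < x := hx
    rw [Complex.ofReal_cpow hx.le]
    push_cast
    rfl
  have ht : Tendsto (fun r : ℝ => (r : ℂ)) (𝓝[≠] 1) (𝓝[≠] 1) := by
    refine tendsto_nhdsWithin_iff.2 ⟨?_, ?_⟩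
    · have : ContinuousAt (fun r : ℝ => (r : ℂ)) 1 := Complex.continuous_ofReal.continuousAt
      simpa [ContinuousAt] using this.mono_left nhdsWithin_le_nhds
    · filter_upwards [self_mem_nhdsWithin] with r hr
      simpa using hr
  refine ht.frequently (Eventually.frequently ?_)
  have : ∀ᶠ r : ℝ in 𝓝[≠] 1, 0 < r := nhdsWithin_le_nhds (lt_mem_nhds one_pos)
  filter_upwards [this] with r hr using hreal r hr

end LaplaceGamma

section HankelLine

/-- The point `σ + i τ` of a vertical line. -/
noncomputable def vline (σ τ : ℝ) : ℂ := σ + τ * Complex.I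

@[simp] theorem vline_re (σ τ : ℝ) : (vline σ τ).re = σ := by simp [vline]

@[simp] theorem vline_im (σ τ : ℝ) : (vline σ τ).im = τ := by simp [vline]

theorem vline_ne_zero {σ : ℝ} (hσ : 0 < σ) (τ : ℝ) : vline σ τ ≠ 0 := by
  intro h
  have := congrArg Complex.re h
  simp at this
  linarith

@[fun_prop] theorem continuous_vline (σ : ℝ) : Continuous (vline σ) := by
  unfold vline; fun_prop

theorem continuous_log_vline {σ : ℝ} (hσ : 0 < σ) :
    Continuous fun τ => Complex.log (vline σ τ) :=
  continuous_iff_continuousAt.2 fun τ =>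
    (continuous_vline σ).continuousAt.clog (Or.inl (by simpa using hσ))

theorem norm_exp_sq_vline (σ τ ω : ℝ) :
    ‖Complex.exp (vline σ τ ^ 2 - ω * vline σ τ)‖ = Real.exp (σ ^ 2 - ω * σ) * Real.exp (-τ ^ 2) := by
  rw [Complex.norm_exp, ← Real.exp_add]
  congr 1
  simp [pow_two]
  ring

theorem norm_vline_le {σ : ℝ} (hσ : 0 < σ) (τ : ℝ) : ‖vline σ τ‖ ≤ σ + |τ| := by
  refine (Complex.norm_le_abs_re_add_abs_im _).trans ?_
  simp [abs_of_pos hσ]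

theorem le_norm_vline (σ τ : ℝ) : σ ≤ ‖vline σ τ‖ := by
  simpa using Complex.re_le_norm (vline σ τ)

theorem norm_two_log_vline_le {σ : ℝ} (hσ : 0 < σ) (τ : ℝ) :
    ‖2 * Complex.log (vline σ τ)‖ ≤ 2 * |τ| + 2 * (σ + σ⁻¹ + Real.pi) := by
  have h0 : 0 < ‖vline σ τ‖ := norm_pos_iff.2 (vline_ne_zero hσ τ)
  have h1 : ‖Complex.log (vline σ τ)‖ ≤ |Real.log ‖vline σ τ‖| + Real.pi := by
    refine (Complex.norm_le_abs_re_add_abs_im _).trans ?_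
    rw [Complex.log_re, Complex.log_im]
    gcongr
    exact Complex.abs_arg_le_pi _
  have h2 : |Real.log ‖vline σ τ‖| ≤ |τ| + σ + σ⁻¹ := by
    have hi : 0 < σ⁻¹ := inv_pos.2 hσ
    rw [abs_le]
    constructor
    · have := Real.log_le_sub_one_of_pos (inv_pos.2 h0)
      rw [Real.log_inv] at this
      have h3 : ‖vline σ τ‖⁻¹ ≤ σ⁻¹ := inv_anti₀ hσ (le_norm_vline σ τ)
      have := abs_nonneg τ
      linarith
    · have := Real.log_le_sub_one_of_pos h0
      have := norm_vline_le hσ τ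
      linarith
  rw [norm_mul, Complex.norm_ofNat]
  linarith

theorem integrable_exp_neg_sq_add (C : ℝ) :
    Integrable fun τ : ℝ => Real.exp (-τ ^ 2 + C * |τ|) := by
  have h := (integrable_exp_neg_mul_sq (b := 1 / 2) (by norm_num)).const_mul (Real.exp (C ^ 2 / 2))
  refine h.mono' (by fun_prop) (Eventually.of_forall fun τ => ?_)
  rw [Real.norm_of_nonneg (Real.exp_pos _).le, ← Real.exp_add, Real.exp_le_exp]
  nlinarith [sq_nonneg (|τ| - C), sq_abs τ]

/-- The integrand of the Hankel-type integral after the substitution `t = z ^ 2`. -/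
noncomputable def hankelIntegrand (ω : ℝ) (n : ℕ) (z : ℂ) : ℂ :=
  Complex.exp (z ^ 2 - ω * z) * z * (2 * Complex.log z) ^ n

/-- The line integrals whose values are the Taylor coefficients of `1 / Γ` for `ω = 0`. -/
noncomputable def hankelMoment (ω σ : ℝ) (n : ℕ) : ℂ :=
  ∫ τ : ℝ, hankelIntegrand ω n (vline σ τ)

theorem continuous_hankelIntegrand (ω : ℝ) (n : ℕ) {σ : ℝ} (hσ : 0 < σ) :
    Continuous fun τ => hankelIntegrand ω n (vline σ τ) := by
  have := continuous_log_vline hσ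
  unfold hankelIntegrand
  fun_prop

/-- The integral of `exp (z ^ 2 - ω z) z ^ (1 - 2 s)` along a vertical line. -/
noncomputable def hankelFun (ω σ : ℝ) (s : ℂ) : ℂ :=
  ∫ τ : ℝ, Complex.exp (vline σ τ ^ 2 - ω * vline σ τ) * vline σ τ *
    Complex.exp (-s * (2 * Complex.log (vline σ τ)))

theorem integrable_hankel_bound (ω : ℝ) {σ : ℝ} (hσ : 0 < σ) {r : ℝ} (hr : 0 ≤ r) :
    Integrable fun τ : ℝ => ‖Complex.exp (vline σ τ ^ 2 - ω * vline σ τ) * vline σ τ‖ *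
      Real.exp (r * ‖2 * Complex.log (vline σ τ)‖) := by
  have hl := continuous_log_vline hσ
  have h := (integrable_exp_neg_sq_add (1 + r * 2)).const_mul
    (Real.exp (σ ^ 2 - ω * σ) * Real.exp (σ + r * (2 * (σ + σ⁻¹ + Real.pi))))
  refine h.mono' (Continuous.aestronglyMeasurable (by fun_prop)) (Eventually.of_forall fun τ => ?_)
  rw [norm_mul, norm_norm, norm_mul, norm_exp_sq_vline, Real.norm_of_nonneg (Real.exp_pos _).le]
  have h1 : ‖vline σ τ‖ ≤ Real.exp (σ + |τ|) :=
    (norm_vline_le hσ τ).trans (by linarith [Real.add_one_le_exp (σ + |τ|)])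
  have h2 : Real.exp (r * ‖2 * Complex.log (vline σ τ)‖) ≤
      Real.exp (r * (2 * |τ| + 2 * (σ + σ⁻¹ + Real.pi))) := by
    gcongr
    exact norm_two_log_vline_le hσ τ
  calc _ ≤ Real.exp (σ ^ 2 - ω * σ) * Real.exp (-τ ^ 2) * Real.exp (σ + |τ|) *
        Real.exp (r * (2 * |τ| + 2 * (σ + σ⁻¹ + Real.pi))) := by gcongr
    _ = _ := by
      simp only [← Real.exp_add]
      congr 1
      ring

theorem hasSum_hankelFun (ω : ℝ) {σ : ℝ} (hσ : 0 < σ) (s : ℂ) :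
    HasSum (fun n : ℕ => s ^ n * ((-1) ^ n / n.factorial * hankelMoment ω σ n))
      (hankelFun ω σ s) := by
  have hl := continuous_log_vline hσ
  have key := hasSum_integral_of_dominated_convergence (μ := (volume : Measure ℝ))
    (F := fun (n : ℕ) (τ : ℝ) => (-s) ^ n / n.factorial * hankelIntegrand ω n (vline σ τ))
    (f := fun τ : ℝ => Complex.exp (vline σ τ ^ 2 - ω * vline σ τ) * vline σ τ *
      Complex.exp (-s * (2 * Complex.log (vline σ τ))))
    (bound := fun n τ => ‖Complex.exp (vline σ τ ^ 2 - ω * vline σ τ) * vline σ τ‖ *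
      ((‖s‖ * ‖2 * Complex.log (vline σ τ)‖) ^ n / n.factorial))
    ?_ ?_ ?_ ?_ ?_
  · convert! key using 1
    ext n
    rw [integral_const_mul, hankelMoment, neg_pow]
    ring
  · intro n
    have := continuous_hankelIntegrand ω n hσ
    exact Continuous.aestronglyMeasurable (by fun_prop)
  · intro n
    refine Eventually.of_forall fun τ => le_of_eq ?_
    simp only [hankelIntegrand, norm_mul, norm_div, norm_pow, norm_neg, Complex.norm_natCast]
    ring
  · refine Eventually.of_forall fun τ => ?_
    exact (Real.summable_pow_div_factorial _).mul_left _
  · have := integrable_hankel_bound ω hσ (norm_nonneg s)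
    convert this using 2 with τ
    rw [tsum_mul_left]
    congr 1
    have := (NormedSpace.expSeries_div_hasSum_exp (‖s‖ * ‖2 * Complex.log (vline σ τ)‖)).tsum_eq
    rw [this, ← Real.exp_eq_exp_ℝ]
  · refine Eventually.of_forall fun τ => ?_
    have := NormedSpace.expSeries_div_hasSum_exp (-s * (2 * Complex.log (vline σ τ)))
    rw [← Complex.exp_eq_exp_ℂ] at this
    convert! this.mul_left _ using 2 with n
    rw [hankelIntegrand, mul_pow (-s)]
    ring

theorem integral_exp_sq_vline (σ y : ℝ) :
    ∫ τ : ℝ, Complex.exp (vline σ τ ^ 2 - y * vline σ τ) =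
      ((√Real.pi * Real.exp (-y ^ 2 / 4) : ℝ) : ℂ) := by
  have h := integral_cexp_quadratic (b := -1) (by simp) (2 * σ * Complex.I - y * Complex.I)
    (σ ^ 2 - y * σ)
  have e1 : ∀ τ : ℝ, vline σ τ ^ 2 - y * vline σ τ =
      -1 * (τ : ℂ) ^ 2 + (2 * σ * Complex.I - y * Complex.I) * τ + (σ ^ 2 - y * σ) := by
    intro τ
    have := Complex.I_sq
    rw [vline]
    linear_combination (τ : ℂ) ^ 2 * this
  simp_rw [e1]
  rw [h]
  have e2 : ((σ : ℂ) ^ 2 - y * σ - (2 * σ * Complex.I - y * Complex.I) ^ 2 / (4 * -1)) =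
      ((-y ^ 2 / 4 : ℝ) : ℂ) := by
    have := Complex.I_sq
    push_cast
    linear_combination ((2 * σ - y) ^ 2 / 4 : ℂ) * this
  rw [e2, ← Complex.ofReal_exp, Complex.ofReal_mul, neg_neg, div_one, Real.sqrt_eq_rpow,
    Complex.ofReal_cpow Real.pi_pos.le]
  norm_num

theorem hankelFun_eq {ω σ : ℝ} (hσ : 0 < σ) {p : ℝ} (hp : 0 < p) :
    hankelFun ω σ ((p + 1) / 2) * Complex.Gamma p =
      ((∫ x in Set.Ioi (0 : ℝ), x ^ (p - 1) * (√Real.pi * Real.exp (-(x + ω) ^ 2 / 4)) : ℝ) : ℂ) := by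
  have hl := continuous_log_vline hσ
  have h1 : hankelFun ω σ ((p + 1) / 2) * Complex.Gamma p = ∫ τ : ℝ, ∫ x in Set.Ioi (0 : ℝ),
      ((x ^ (p - 1) : ℝ) : ℂ) * Complex.exp (vline σ τ ^ 2 - (x + ω : ℝ) * vline σ τ) := by
    rw [hankelFun, ← integral_mul_const]
    refine integral_congr_ae (Eventually.of_forall fun τ => ?_)
    have hz := vline_ne_zero hσ τ
    have h2 := laplacePow_eq hp (z := vline σ τ) (by simpa using hσ)
    simp only
    have e1 : vline σ τ * Complex.exp (-((p + 1) / 2) * (2 * Complex.log (vline σ τ))) =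
        vline σ τ ^ (-(p : ℂ)) := by
      rw [Complex.cpow_def_of_ne_zero hz]
      nth_rewrite 1 [← Complex.exp_log hz]
      rw [← Complex.exp_add]
      congr 1
      ring
    rw [mul_assoc (Complex.exp _), e1, mul_assoc, ← h2, laplacePow, ← integral_const_mul]
    refine integral_congr_ae (Eventually.of_forall fun x => ?_)
    simp only
    rw [mul_left_comm, ← Complex.exp_add]
    congr 2
    push_cast
    ring
  rw [h1, integral_integral_swap]
  · rw [← integral_complex_ofReal]
    refine integral_congr_ae (Eventually.of_forall fun x => ?_)
    simp only
    rw [integral_const_mul, integral_exp_sq_vline]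
    push_cast
    rfl
  · have hA : Integrable (fun τ : ℝ => Real.exp (σ ^ 2 - ω * σ) * Real.exp (-τ ^ 2 + 0 * |τ|)) :=
      (integrable_exp_neg_sq_add 0).const_mul _
    have hB := integrableOn_rpow_mul_exp hp hσ
    have := hA.mul_prod hB
    refine this.mono' ?_ ?_
    · refine Measurable.aestronglyMeasurable ?_
      have : Measurable fun p : ℝ × ℝ => vline σ p.1 := by
        exact (continuous_vline σ).measurable.comp measurable_fst
      unfold Function.uncurry
      fun_prop
    · have hm : ∀ᵐ q : ℝ × ℝ ∂(volume.prod (volume.restrict (Set.Ioi (0 : ℝ)))), 0 < q.2 := by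
        have : ∀ᵐ x : ℝ ∂(volume.restrict (Set.Ioi (0 : ℝ))), 0 < x :=
          ae_restrict_mem measurableSet_Ioi
        exact Measure.quasiMeasurePreserving_snd.ae this
      filter_upwards [hm] with q hq
      simp only [Function.uncurry]
      rw [norm_mul, norm_exp_sq_vline, Complex.norm_real, Real.norm_of_nonneg (by positivity)]
      rw [show σ ^ 2 - (q.2 + ω) * σ = (σ ^ 2 - ω * σ) + -(σ * q.2) by ring, Real.exp_add]
      rw [zero_mul, add_zero]
      apply le_of_eq
      ring

theorem powerSeries_of_forall_hasSum {c : ℕ → ℂ} {f : ℂ → ℂ}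
    (h : ∀ s, HasSum (fun n => s ^ n * c n) (f s)) :
    AnalyticOnNhd ℂ f Set.univ ∧
      HasFPowerSeriesAt f (FormalMultilinearSeries.ofScalars ℂ c) 0 := by
  have hr : (FormalMultilinearSeries.ofScalars ℂ c).radius = ⊤ := by
    refine FormalMultilinearSeries.radius_eq_top_of_summable_norm _ fun r => ?_
    have := (h (r : ℝ)).summable.norm
    convert this using 2 with n
    rw [FormalMultilinearSeries.ofScalars_norm, norm_mul, norm_pow, Complex.norm_real]
    simp [mul_comm]
  have hb : HasFPowerSeriesOnBall f (FormalMultilinearSeries.ofScalars ℂ c) 0 ⊤ := by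
    refine ⟨hr.ge, by simp, fun {y} _ => ?_⟩
    rw [zero_add]
    convert! h y using 2 with n
    rw [FormalMultilinearSeries.ofScalars_apply_eq]
    simp [mul_comm]
  refine ⟨fun x _ => ?_, hb.hasFPowerSeriesAt⟩
  exact hb.analyticAt_of_mem (by simp)

theorem coeff_eq_of_hasFPowerSeriesAt_ofScalars {c d : ℕ → ℂ} {f : ℂ → ℂ} {x : ℂ}
    (hc : HasFPowerSeriesAt f (FormalMultilinearSeries.ofScalars ℂ c) x)
    (hd : HasFPowerSeriesAt f (FormalMultilinearSeries.ofScalars ℂ d) x) (n : ℕ) : c n = d n := by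
  have h := congrArg (fun p => FormalMultilinearSeries.coeff p n) (hc.eq_formalMultilinearSeries hd)
  simpa using h

theorem frequently_of_forall_gt_half {P : ℂ → Prop} (h : ∀ p : ℝ, 0 < p → P ((p + 1) / 2)) :
    ∃ᶠ z in 𝓝[≠] (1 : ℂ), P z := by
  have ht : Tendsto (fun r : ℝ => ((r : ℂ) + 1) / 2) (𝓝[≠] 1) (𝓝[≠] 1) := by
    refine tendsto_nhdsWithin_iff.2 ⟨?_, ?_⟩
    · have : ContinuousAt (fun r : ℝ => ((r : ℂ) + 1) / 2) 1 := by fun_prop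
      convert this.tendsto.mono_left nhdsWithin_le_nhds using 2
      norm_num
    · filter_upwards [self_mem_nhdsWithin] with r hr hr'
      refine hr ?_
      have hr' : ((r : ℂ) + 1) / 2 = 1 := hr'
      have : (r : ℂ) = 1 := by linear_combination 2 * hr'
      exact_mod_cast this
  refine ht.frequently (Eventually.frequently ?_)
  have : ∀ᶠ r : ℝ in 𝓝[≠] 1, 0 < r := nhdsWithin_le_nhds (lt_mem_nhds one_pos)
  filter_upwards [this] with r hr using h r hr

theorem hankelMoment_congr (ω : ℝ) {σ σ' : ℝ} (hσ : 0 < σ) (hσ' : 0 < σ') (n : ℕ) :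
    hankelMoment ω σ n = hankelMoment ω σ' n := by
  obtain ⟨h1, h2⟩ := powerSeries_of_forall_hasSum (hasSum_hankelFun ω hσ)
  obtain ⟨h3, h4⟩ := powerSeries_of_forall_hasSum (hasSum_hankelFun ω hσ')
  have h : hankelFun ω σ = hankelFun ω σ' := by
    refine h1.eq_of_frequently_eq h3 (z₀ := 1) (frequently_of_forall_gt_half fun p hp => ?_)
    have hG : Complex.Gamma p ≠ 0 := Complex.Gamma_ne_zero_of_re_pos (by simpa)
    exact mul_right_cancel₀ hG ((hankelFun_eq hσ hp).trans (hankelFun_eq hσ' hp).symm)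
  rw [← h] at h4
  have := coeff_eq_of_hasFPowerSeriesAt_ofScalars h2 h4 n
  refine mul_left_cancel₀ (div_ne_zero (pow_ne_zero _ (by norm_num)) ?_) this
  exact_mod_cast n.factorial_ne_zero

theorem hankelFun_zero {σ : ℝ} (hσ : 0 < σ) {p : ℝ} (hp : 0 < p) :
    hankelFun 0 σ ((p + 1) / 2) = Real.pi * (Complex.Gamma ((p + 1) / 2))⁻¹ := by
  have hG : Complex.Gamma p ≠ 0 := Complex.Gamma_ne_zero_of_re_pos (by simpa)
  have hG' : Complex.Gamma ((p + 1) / 2) ≠ 0 :=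
    Complex.Gamma_ne_zero_of_re_pos (by
      have : ((p : ℂ) + 1) / 2 = (((p + 1) / 2 : ℝ) : ℂ) := by push_cast; ring
      rw [this, Complex.ofReal_re]
      positivity)
  have hq := integral_rpow_mul_exp_neg_mul_rpow (p := 2) (q := p - 1) (b := 1 / 4)
    (by norm_num) (by linarith) (by norm_num)
  have h1 : (∫ x in Set.Ioi (0 : ℝ), x ^ (p - 1) * (√Real.pi * Real.exp (-(x + 0) ^ 2 / 4))) =
      √Real.pi * (4 ^ (p / 2) * (1 / 2) * Real.Gamma (p / 2)) := by
    have e : (4 : ℝ) ^ (p / 2) = (1 / 4) ^ (-(p - 1 + 1) / 2) := by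
      rw [one_div, Real.inv_rpow (by norm_num), ← Real.rpow_neg (by norm_num)]
      congr 1
      ring
    rw [e, show p / 2 = (p - 1 + 1) / 2 by ring, ← hq, ← integral_const_mul]
    refine integral_congr_ae (Eventually.of_forall fun x => ?_)
    simp only [add_zero, Real.rpow_ofNat]
    rw [show -x ^ 2 / 4 = -(1 / 4) * x ^ 2 by ring]
    ring
  have h2 := hankelFun_eq (ω := 0) hσ hp
  rw [h1] at h2
  have h3 := Real.Gamma_mul_Gamma_add_half (p / 2)
  have h5 : (4 : ℝ) ^ (p / 2) * 2 ^ (1 - p) = 2 := by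
    rw [show (4 : ℝ) = 2 ^ (2 : ℝ) by norm_num, ← Real.rpow_mul (by norm_num),
      ← Real.rpow_add (by norm_num), show 2 * (p / 2) + (1 - p) = 1 by ring, Real.rpow_one]
  have h6 : √Real.pi * √Real.pi = Real.pi := Real.mul_self_sqrt Real.pi_pos.le
  rw [mul_div_cancel₀ _ (two_ne_zero)] at h3
  have h7 : √Real.pi * (4 ^ (p / 2) * (1 / 2) * Real.Gamma (p / 2)) * Real.Gamma ((p + 1) / 2) =
      Real.pi * Real.Gamma p := by
    rw [show (p + 1) / 2 = p / 2 + 1 / 2 by ring]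
    linear_combination (√Real.pi * 4 ^ (p / 2) / 2) * h3 + (Real.Gamma p * √Real.pi * √Real.pi / 2) * h5
      + Real.Gamma p * h6
  rw [← div_eq_mul_inv, eq_div_iff hG']
  refine mul_right_cancel₀ hG ?_
  rw [mul_right_comm, h2, Complex.Gamma_ofReal,
    show ((p : ℂ) + 1) / 2 = (((p + 1) / 2 : ℝ) : ℂ) by push_cast; ring, Complex.Gamma_ofReal]
  exact_mod_cast h7

/-- The Taylor coefficients of `1 / Γ` at `0` as integrals along a vertical line. -/
theorem rgammaCoeff_eq_hankelMoment {σ : ℝ} (hσ : 0 < σ) (n : ℕ) :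
    rgammaCoeff n = (-1) ^ n / n.factorial * hankelMoment 0 σ n / Real.pi := by
  obtain ⟨h1, h2⟩ := powerSeries_of_forall_hasSum (hasSum_hankelFun 0 hσ)
  have hd : Differentiable ℂ fun s : ℂ => Real.pi * (Complex.Gamma s)⁻¹ :=
    Complex.differentiable_one_div_Gamma.const_mul _
  have h : hankelFun 0 σ = fun s : ℂ => Real.pi * (Complex.Gamma s)⁻¹ :=
    h1.eq_of_frequently_eq (Complex.analyticOnNhd_univ_iff_differentiable.2 hd) (z₀ := 1)
      (frequently_of_forall_gt_half fun p hp => hankelFun_zero hσ hp)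
  have h3 : AnalyticAt ℂ (fun z : ℂ => 1 / Complex.Gamma z) 0 := by
    simp_rw [one_div]
    exact Complex.analyticOnNhd_univ_iff_differentiable.2 Complex.differentiable_one_div_Gamma 0
      trivial
  have hpi : (Real.pi : ℂ) ≠ 0 := by exact_mod_cast Real.pi_ne_zero
  have h4 : HasFPowerSeriesAt (fun z : ℂ => 1 / Complex.Gamma z)
      (FormalMultilinearSeries.ofScalars ℂ fun n : ℕ =>
        (-1) ^ n / n.factorial * hankelMoment 0 σ n / Real.pi) 0 := by
    rw [hasFPowerSeriesAt_iff]
    refine Eventually.of_forall fun z => ?_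
    have := (hasSum_hankelFun 0 hσ z).div_const (Real.pi : ℂ)
    rw [h] at this
    simp only [mul_div_cancel_left₀ _ hpi] at this
    convert! this using 2 with n
    · rw [FormalMultilinearSeries.coeff_ofScalars, smul_eq_mul]
      ring
    · exact funext fun x => one_div x
    · rw [zero_add]
  exact coeff_eq_of_hasFPowerSeriesAt_ofScalars h3.hasFPowerSeriesAt h4 n

theorem hasSum_rgammaCoeff (z : ℂ) :
    HasSum (fun n => z ^ n * rgammaCoeff n) (Complex.Gamma z)⁻¹ := by
  have hd : Differentiable ℂ fun s : ℂ => Real.pi * (Complex.Gamma s)⁻¹ :=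
    Complex.differentiable_one_div_Gamma.const_mul _
  have h : hankelFun 0 1 = fun s : ℂ => Real.pi * (Complex.Gamma s)⁻¹ :=
    (powerSeries_of_forall_hasSum (hasSum_hankelFun 0 one_pos)).1.eq_of_frequently_eq
      (Complex.analyticOnNhd_univ_iff_differentiable.2 hd) (z₀ := 1)
      (frequently_of_forall_gt_half fun p hp => hankelFun_zero one_pos hp)
  have hpi : (Real.pi : ℂ) ≠ 0 := by exact_mod_cast Real.pi_ne_zero
  have := (hasSum_hankelFun 0 one_pos z).div_const (Real.pi : ℂ)
  rw [h] at this
  simp only [mul_div_cancel_left₀ _ hpi] at this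
  convert! this using 2 with n
  rw [rgammaCoeff_eq_hankelMoment one_pos]
  ring

theorem rgammaCoeff_zero : rgammaCoeff 0 = 0 := by
  simp [rgammaCoeff, Complex.Gamma_zero]

/-- The power series of `1 / Γ(1 + z)` converges everywhere. -/
theorem hasSum_rgammaShiftCoeff (z : ℂ) :
    HasSum (fun n => z ^ n * rgammaShiftCoeff n) (1 / Complex.Gamma (1 + z)) := by
  have h1 : ∀ z : ℂ, z ≠ 0 →
      HasSum (fun n => z ^ n * rgammaShiftCoeff n) (1 / Complex.Gamma (1 + z)) := by
    intro z hz
    have h := (hasSum_nat_add_iff' 1).2 (hasSum_rgammaCoeff z)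
    have h := h.mul_left z⁻¹
    rw [add_comm, Complex.Gamma_add_one _ hz]
    convert! h using 1
    · ext n
      rw [rgammaShiftCoeff, pow_succ]
      field_simp
    · simp [rgammaCoeff_zero]
      ring
  have h2 : ∀ s : ℂ, HasSum (fun n => s ^ n * rgammaShiftCoeff n)
      (∑' n, s ^ n * rgammaShiftCoeff n) := by
    intro s
    rcases eq_or_ne s 0 with rfl | hs
    · refine Summable.hasSum (summable_of_ne_finset_zero (s := {0}) fun n hn => ?_)
      rw [zero_pow (by simpa using hn), zero_mul]
    · exact (h1 s hs).summable.hasSum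
  have h3 := (powerSeries_of_forall_hasSum h2).1
  have hd : Differentiable ℂ fun s : ℂ => (Complex.Gamma (1 + s))⁻¹ :=
    Complex.differentiable_one_div_Gamma.comp (differentiable_id.const_add 1)
  have h4 := h3.eq_of_frequently_eq (Complex.analyticOnNhd_univ_iff_differentiable.2 hd) (z₀ := 1)
      (frequently_of_forall_gt_half fun p hp => by
        rw [← one_div]
        refine (h1 _ ?_).tsum_eq
        refine div_ne_zero ?_ two_ne_zero
        exact_mod_cast (by positivity : p + 1 ≠ 0))
  have := h2 z
  rw [congrFun h4 z] at this
  rwa [one_div]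

end HankelLine

section Trapezoid

open FourierTransform

/-- The integral of the modulus of the integrand along a vertical line. -/
noncomputable def hankelAbs (σ : ℝ) (n : ℕ) : ℝ :=
  ∫ τ : ℝ, ‖hankelIntegrand 0 n (vline σ τ)‖

theorem hankelAbs_nonneg (σ : ℝ) (n : ℕ) : 0 ≤ hankelAbs σ n :=
  integral_nonneg fun _ => norm_nonneg _

theorem hankelIntegrand_eq_mul (ω : ℝ) (n : ℕ) (z : ℂ) :
    hankelIntegrand ω n z = Complex.exp (-(ω * z)) * hankelIntegrand 0 n z := by
  rw [hankelIntegrand, hankelIntegrand, sub_eq_add_neg, Complex.exp_add]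
  simp
  ring

theorem norm_hankelMoment_le (ω : ℝ) {σ σ' : ℝ} (hσ : 0 < σ) (hσ' : 0 < σ') (n : ℕ) :
    ‖hankelMoment ω σ n‖ ≤ Real.exp (-(ω * σ')) * hankelAbs σ' n := by
  rw [hankelMoment_congr ω hσ hσ', hankelMoment, hankelAbs, ← integral_const_mul]
  refine (norm_integral_le_integral_norm _).trans (le_of_eq ?_)
  congr 1
  ext τ
  rw [hankelIntegrand_eq_mul, norm_mul, Complex.norm_exp]
  simp

theorem norm_hankelIntegrand_le (ω σ : ℝ) (n : ℕ) (τ : ℝ) :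
    ‖hankelIntegrand ω n (vline σ τ)‖ ≤ n.factorial *
      (‖Complex.exp (vline σ τ ^ 2 - ω * vline σ τ) * vline σ τ‖ *
      Real.exp (1 * ‖2 * Complex.log (vline σ τ)‖)) := by
  rw [hankelIntegrand, norm_mul, norm_pow, mul_left_comm, one_mul]
  gcongr
  have := Real.pow_div_factorial_le_exp (‖2 * Complex.log (vline σ τ)‖) (norm_nonneg _) n
  rwa [div_le_iff₀' (by positivity)] at this

theorem exists_norm_hankelIntegrand_le {σ : ℝ} (hσ : 0 < σ) (n : ℕ) :
    ∃ C D : ℝ, 0 ≤ C ∧ ∀ τ, ‖hankelIntegrand 0 n (vline σ τ)‖ ≤ C * Real.exp (-τ ^ 2 + D * |τ|) := by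
  refine ⟨n.factorial * (Real.exp (σ ^ 2) * Real.exp σ * Real.exp (2 * (σ + σ⁻¹ + Real.pi))), 3,
    by positivity, fun τ => (norm_hankelIntegrand_le 0 σ n τ).trans ?_⟩
  rw [norm_mul, norm_exp_sq_vline, mul_assoc (n.factorial : ℝ)]
  refine mul_le_mul_of_nonneg_left ?_ (by positivity)
  have h1 : ‖vline σ τ‖ ≤ Real.exp (σ + |τ|) :=
    (norm_vline_le hσ τ).trans (by linarith [Real.add_one_le_exp (σ + |τ|)])
  have h2 : Real.exp (1 * ‖2 * Complex.log (vline σ τ)‖) ≤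
      Real.exp (2 * |τ| + 2 * (σ + σ⁻¹ + Real.pi)) := by
    rw [one_mul]
    gcongr
    exact norm_two_log_vline_le hσ τ
  calc _ ≤ Real.exp (σ ^ 2 - 0 * σ) * Real.exp (-τ ^ 2) * Real.exp (σ + |τ|) *
        Real.exp (2 * |τ| + 2 * (σ + σ⁻¹ + Real.pi)) := by gcongr
    _ = _ := by
      simp only [← Real.exp_add]
      congr 1
      ring

theorem exp_neg_sq_le_div (D : ℝ) {τ : ℝ} (hτ : τ ≠ 0) :
    Real.exp (-τ ^ 2 + D * |τ|) ≤ 2 * Real.exp (D ^ 2 / 2) / τ ^ 2 := by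
  have h1 : -τ ^ 2 + D * |τ| ≤ D ^ 2 / 2 - τ ^ 2 / 2 := by
    nlinarith [sq_nonneg (|τ| - D), sq_abs τ]
  have h0 : 0 < τ ^ 2 := by positivity
  rw [le_div_iff₀ h0]
  calc _ ≤ Real.exp (D ^ 2 / 2 - τ ^ 2 / 2) * τ ^ 2 := by gcongr
    _ = Real.exp (D ^ 2 / 2) * (Real.exp (-(τ ^ 2 / 2)) * τ ^ 2) := by
      rw [sub_eq_add_neg, Real.exp_add]; ring
    _ ≤ Real.exp (D ^ 2 / 2) * 2 := by
      gcongr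
      rw [Real.exp_neg, inv_mul_le_iff₀ (Real.exp_pos _)]
      nlinarith [Real.add_one_le_exp (τ ^ 2 / 2)]
    _ = _ := by ring

theorem fourier_hankel {σ h : ℝ} (hh : 0 < h) (n : ℕ) (w : ℝ) :
    𝓕 (fun x : ℝ => hankelIntegrand 0 n (vline σ (h * x))) w =
      h⁻¹ * (Complex.exp ((2 * Real.pi * w / h : ℝ) * σ) * hankelMoment (2 * Real.pi * w / h) σ n) := by
  rw [Real.fourier_real_eq_integral_exp_smul, hankelMoment, ← integral_const_mul]
  have h1 : ∀ v : ℝ, Complex.exp (↑(-2 * Real.pi * v * w) * Complex.I) •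
      hankelIntegrand 0 n (vline σ (h * v)) = (fun τ : ℝ =>
        Complex.exp ((2 * Real.pi * w / h : ℝ) * σ) *
          hankelIntegrand (2 * Real.pi * w / h) n (vline σ τ)) (h * v) := by
    intro v
    simp only
    rw [hankelIntegrand_eq_mul (2 * Real.pi * w / h), ← mul_assoc, ← Complex.exp_add, smul_eq_mul]
    congr 2
    have : (h : ℂ) ≠ 0 := by exact_mod_cast hh.ne'
    rw [vline]
    push_cast
    field_simp
    ring
  simp_rw [h1]
  rw [Measure.integral_comp_mul_left (fun τ : ℝ => Complex.exp ((2 * Real.pi * w / h : ℝ) * σ) *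
          hankelIntegrand (2 * Real.pi * w / h) n (vline σ τ)), abs_of_pos (inv_pos.2 hh)]
  simp

theorem norm_fourier_hankel_le {σ σ' h : ℝ} (hσ : 0 < σ) (hσ' : 0 < σ') (hh : 0 < h) (n : ℕ)
    (w : ℝ) :
    ‖𝓕 (fun x : ℝ => hankelIntegrand 0 n (vline σ (h * x))) w‖ ≤
      h⁻¹ * (Real.exp (2 * Real.pi * w / h * (σ - σ')) * hankelAbs σ' n) := by
  rw [fourier_hankel hh, norm_mul, norm_mul, ← Complex.ofReal_mul, Complex.norm_exp_ofReal,
    Complex.norm_real, Real.norm_of_nonneg (by positivity)]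
  refine mul_le_mul_of_nonneg_left ?_ (by positivity)
  calc _ ≤ Real.exp (2 * Real.pi * w / h * σ) *
        (Real.exp (-(2 * Real.pi * w / h * σ')) * hankelAbs σ' n) := by
        gcongr
        exact norm_hankelMoment_le _ hσ hσ' n
    _ = _ := by
      rw [← mul_assoc, ← Real.exp_add]
      congr 2
      ring

/-- The trapezoidal rule for the integral along a vertical line has an exponentially small error,
controlled by the absolute integrals along two neighbouring lines. -/
theorem norm_trapezoid_sub_hankelMoment_le {σ a h : ℝ} (ha : 0 < a) (haσ : a < σ) (hh : 0 < h)
    (n : ℕ) {q : ℝ} (hq : Real.exp (-(2 * Real.pi * a / h)) ≤ q) (hq1 : q < 1) :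
    ‖h * ∑' j : ℤ, hankelIntegrand 0 n (vline σ (h * j)) - hankelMoment 0 σ n‖ ≤
      (hankelAbs (σ + a) n + hankelAbs (σ - a) n) * (q / (1 - q)) := by
  have hσ : 0 < σ := ha.trans haσ
  have hq0 : 0 < q := (Real.exp_pos _).trans_le hq
  set f : ℝ → ℂ := fun x => hankelIntegrand 0 n (vline σ (h * x)) with hf
  have hpos : ∀ k : ℕ, ‖𝓕 f (k : ℝ)‖ ≤ h⁻¹ * hankelAbs (σ + a) n * q ^ k := by
    intro k
    refine (norm_fourier_hankel_le hσ (by linarith : 0 < σ + a) hh n k).trans ?_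
    rw [mul_assoc h⁻¹ (hankelAbs (σ + a) n), mul_comm (Real.exp _)]
    refine mul_le_mul_of_nonneg_left (mul_le_mul_of_nonneg_left ?_ (hankelAbs_nonneg _ _))
      (by positivity)
    calc _ = Real.exp (-(2 * Real.pi * a / h)) ^ k := by
            rw [← Real.exp_nat_mul]; congr 1; ring
      _ ≤ _ := by gcongr
  have hneg : ∀ k : ℕ, ‖𝓕 f (-(k : ℝ))‖ ≤ h⁻¹ * hankelAbs (σ - a) n * q ^ k := by
    intro k
    refine (norm_fourier_hankel_le hσ (by linarith : 0 < σ - a) hh n _).trans ?_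
    rw [mul_assoc h⁻¹ (hankelAbs (σ - a) n), mul_comm (Real.exp _)]
    refine mul_le_mul_of_nonneg_left (mul_le_mul_of_nonneg_left ?_ (hankelAbs_nonneg _ _))
      (by positivity)
    calc _ = Real.exp (-(2 * Real.pi * a / h)) ^ k := by
            rw [← Real.exp_nat_mul]; congr 1; ring
      _ ≤ _ := by gcongr
  have hgeo : Summable fun k : ℕ => q ^ k := summable_geometric_of_lt_one hq0.le hq1
  have hsp : Summable fun k : ℕ => 𝓕 f (k : ℝ) :=
    Summable.of_norm_bounded (hgeo.mul_left _) hpos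
  have hsn : Summable fun k : ℕ => 𝓕 f (-(k : ℝ)) :=
    Summable.of_norm_bounded (hgeo.mul_left _) hneg
  have hsn' : Summable fun k : ℕ => 𝓕 f (-((k : ℝ) + 1)) := by
    have := (summable_nat_add_iff 1).2 hsn
    simpa using this
  have hsum : Summable fun k : ℤ => 𝓕 f (k : ℝ) := by
    refine Summable.of_nat_of_neg_add_one (by simpa using hsp) ?_
    simpa using hsn'
  have hdecay : f =O[cocompact ℝ] fun x : ℝ => |x| ^ (-2 : ℝ) := by
    obtain ⟨C, D, hC, hCD⟩ := exists_norm_hankelIntegrand_le hσ n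
    refine Asymptotics.IsBigO.of_bound (C * (2 * Real.exp (D ^ 2 / 2)) / h ^ 2) ?_
    filter_upwards [(isCompact_singleton (x := (0 : ℝ))).compl_mem_cocompact] with x hx
    have hx : x ≠ 0 := by simpa using hx
    rw [Real.norm_of_nonneg (by positivity), Real.rpow_neg (abs_nonneg _),
      Real.rpow_two, sq_abs]
    refine (hCD (h * x)).trans ?_
    calc _ ≤ C * (2 * Real.exp (D ^ 2 / 2) / (h * x) ^ 2) := by
            gcongr
            exact exp_neg_sq_le_div D (mul_ne_zero hh.ne' hx)
      _ = _ := by field_simp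
  have hcont : Continuous f :=
    (continuous_hankelIntegrand 0 n hσ).comp (continuous_const.mul continuous_id)
  have hP := Real.tsum_eq_tsum_fourier_of_rpow_decay_of_summable hcont one_lt_two hdecay hsum 0
  simp only [zero_add, fourier_eval_zero, mul_one, QuotientAddGroup.mk_zero] at hP
  have hsplit : ∑' k : ℤ, 𝓕 f (k : ℝ) = 𝓕 f 0 + ∑' k : ℕ, 𝓕 f ((k : ℝ) + 1) +
      ∑' k : ℕ, 𝓕 f (-((k : ℝ) + 1)) := by
    rw [tsum_of_nat_of_neg_add_one (by simpa using hsp) (by simpa using hsn')]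
    congr 1
    · simp only [Int.cast_natCast]
      rw [hsp.tsum_eq_zero_add]
      simp
    · simp
  have h0 : 𝓕 f 0 = h⁻¹ * hankelMoment 0 σ n := by
    rw [hf, fourier_hankel hh]
    simp
  have hgeo1 : HasSum (fun k : ℕ => q ^ (k + 1)) (q / (1 - q)) := by
    have := (hasSum_geometric_of_lt_one hq0.le hq1).mul_left q
    simpa [pow_succ', div_eq_mul_inv] using this
  have b1 : ‖∑' k : ℕ, 𝓕 f ((k : ℝ) + 1)‖ ≤ h⁻¹ * hankelAbs (σ + a) n * (q / (1 - q)) :=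
    tsum_of_norm_bounded (hgeo1.mul_left _) fun k => by simpa using hpos (k + 1)
  have b2 : ‖∑' k : ℕ, 𝓕 f (-((k : ℝ) + 1))‖ ≤ h⁻¹ * hankelAbs (σ - a) n * (q / (1 - q)) :=
    tsum_of_norm_bounded (hgeo1.mul_left _) fun k => by simpa using hneg (k + 1)
  have hh' : (h : ℂ) ≠ 0 := by exact_mod_cast hh.ne'
  have e : (h : ℂ) * ∑' j : ℤ, hankelIntegrand 0 n (vline σ (h * j)) - hankelMoment 0 σ n =
      h * (∑' k : ℕ, 𝓕 f ((k : ℝ) + 1) + ∑' k : ℕ, 𝓕 f (-((k : ℝ) + 1))) := by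
    have : ∑' j : ℤ, hankelIntegrand 0 n (vline σ (h * j)) = ∑' j : ℤ, f j := rfl
    rw [this, hP, hsplit, h0, Complex.ofReal_inv, mul_add, mul_add, mul_inv_cancel_left₀ hh']
    ring
  rw [e, norm_mul, Complex.norm_real, Real.norm_of_nonneg hh.le]
  calc _ ≤ h * (h⁻¹ * hankelAbs (σ + a) n * (q / (1 - q)) +
        h⁻¹ * hankelAbs (σ - a) n * (q / (1 - q))) := by
        gcongr
        exact (norm_add_le _ _).trans (add_le_add b1 b2)
    _ = _ := by field_simp

theorem hankelIntegrand_neg {σ : ℝ} (hσ : 0 < σ) (n : ℕ) (τ : ℝ) :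
    hankelIntegrand 0 n (vline σ (-τ)) = (starRingEnd ℂ) (hankelIntegrand 0 n (vline σ τ)) := by
  have hc : vline σ (-τ) = (starRingEnd ℂ) (vline σ τ) := by
    simp [vline]
  have hl : Complex.log (vline σ (-τ)) = (starRingEnd ℂ) (Complex.log (vline σ τ)) := by
    rw [hc, Complex.log_conj]
    intro h
    have := Complex.arg_eq_pi_iff.1 h
    simp at this
    linarith
  rw [hankelIntegrand, hankelIntegrand, hl, hc]
  have h2 : (starRingEnd ℂ) 2 = 2 := Complex.conj_ofNat 2
  simp [← Complex.exp_conj, h2]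

theorem summable_hankelIntegrand {σ h : ℝ} (hσ : 0 < σ) (hh : 0 < h) (n : ℕ) :
    Summable fun j : ℕ => hankelIntegrand 0 n (vline σ (h * j)) := by
  obtain ⟨C, D, hC, hCD⟩ := exists_norm_hankelIntegrand_le hσ n
  rw [← summable_nat_add_iff 1]
  have hs : Summable fun j : ℕ => C * (2 * Real.exp (D ^ 2 / 2)) / h ^ 2 * (1 / ((j + 1 : ℕ) : ℝ) ^ 2) :=
    ((summable_nat_add_iff 1).2 (Real.summable_one_div_nat_pow.2 one_lt_two)).mul_left _
  refine Summable.of_norm_bounded hs fun j => (hCD _).trans ?_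
  calc _ ≤ C * (2 * Real.exp (D ^ 2 / 2) / (h * (j + 1 : ℕ)) ^ 2) := by
          gcongr
          exact exp_neg_sq_le_div D (by positivity)
    _ = _ := by field_simp

theorem tsum_int_hankelIntegrand {σ h : ℝ} (hσ : 0 < σ) (hh : 0 < h) (n : ℕ) :
    ∑' j : ℤ, hankelIntegrand 0 n (vline σ (h * j)) =
      ((2 * (∑' j : ℕ, hankelIntegrand 0 n (vline σ (h * j))).re -
        (hankelIntegrand 0 n (vline σ 0)).re : ℝ) : ℂ) := by
  have hs := summable_hankelIntegrand hσ hh n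
  have hs1 : Summable fun j : ℕ => hankelIntegrand 0 n (vline σ (h * (j + 1 : ℕ))) :=
    (summable_nat_add_iff 1).2 hs
  have e : ∀ j : ℕ, hankelIntegrand 0 n (vline σ (h * ((-((j : ℤ) + 1) : ℤ) : ℝ))) =
      (starRingEnd ℂ) (hankelIntegrand 0 n (vline σ (h * (j + 1 : ℕ)))) := by
    intro j
    rw [← hankelIntegrand_neg hσ]
    push_cast
    ring_nf
  have hs2 : HasSum (fun j : ℕ => hankelIntegrand 0 n (vline σ (h * ((-((j : ℤ) + 1) : ℤ) : ℝ))))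
      ((starRingEnd ℂ) (∑' j : ℕ, hankelIntegrand 0 n (vline σ (h * (j + 1 : ℕ))))) := by
    simp_rw [e]
    exact Complex.hasSum_conj'.2 (by simpa using! hs1.hasSum)
  have h0 : (starRingEnd ℂ) (hankelIntegrand 0 n (vline σ 0)) = hankelIntegrand 0 n (vline σ 0) := by
    rw [← hankelIntegrand_neg hσ, neg_zero]
  have key := tsum_of_nat_of_neg_add_one
    (f := fun j : ℤ => hankelIntegrand 0 n (vline σ (h * (j : ℝ))))
    (by simp only [Int.cast_natCast]; exact hs) hs2.summable
  rw [key, hs2.tsum_eq]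
  have h1 := hs.tsum_eq_zero_add
  simp only [Nat.cast_zero, mul_zero] at h1
  simp only [Int.cast_natCast]
  have h2 : ∑' j : ℕ, hankelIntegrand 0 n (vline σ (h * (j + 1 : ℕ))) =
      ∑' j : ℕ, hankelIntegrand 0 n (vline σ (h * j)) - hankelIntegrand 0 n (vline σ 0) := by
    rw [h1]; ring
  rw [h2, map_sub, h0]
  apply Complex.ext
  · simp; ring
  · have := Complex.conj_eq_iff_im.1 h0
    simp [this]

end Trapezoid

section GridBound

/-- The modulus of `2 log z` at a point of a vertical line. -/
noncomputable def logAbs (σ τ : ℝ) : ℝ := ‖2 * Complex.log (vline σ τ)‖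

theorem logAbs_nonneg (σ τ : ℝ) : 0 ≤ logAbs σ τ := norm_nonneg _

theorem norm_vline_sq (σ τ : ℝ) : ‖vline σ τ‖ ^ 2 = σ ^ 2 + τ ^ 2 := by
  rw [Complex.sq_norm, Complex.normSq_apply]
  simp
  ring

theorem two_mul_log_norm_vline (σ τ : ℝ) :
    2 * Real.log ‖vline σ τ‖ = Real.log (σ ^ 2 + τ ^ 2) := by
  rw [← norm_vline_sq, Real.log_pow]
  norm_num

theorem arg_vline {σ : ℝ} (hσ : 0 < σ) (τ : ℝ) : (vline σ τ).arg = Real.arctan (τ / σ) := by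
  rw [Complex.arg_of_re_nonneg (by simpa using hσ.le), Real.arctan_eq_arcsin, vline_im]
  congr 1
  have h1 : 0 < ‖vline σ τ‖ := norm_pos_iff.2 (vline_ne_zero hσ τ)
  have h2 : √(1 + (τ / σ) ^ 2) = ‖vline σ τ‖ / σ := by
    rw [Real.sqrt_eq_iff_mul_self_eq (by positivity) (by positivity), div_mul_div_comm, ← pow_two,
      norm_vline_sq]
    field_simp
  rw [h2]
  field_simp

theorem two_log_vline {σ : ℝ} (hσ : 0 < σ) (τ : ℝ) : 2 * Complex.log (vline σ τ) =
    (Real.log (σ ^ 2 + τ ^ 2) : ℂ) + (2 * Real.arctan (τ / σ) : ℝ) * Complex.I := by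
  apply Complex.ext
  · rw [show (2 * Complex.log (vline σ τ)).re = 2 * (Complex.log (vline σ τ)).re by simp,
      Complex.log_re, two_mul_log_norm_vline, Complex.add_re, Complex.ofReal_re,
      Complex.re_ofReal_mul, Complex.I_re, mul_zero, add_zero]
  · rw [show (2 * Complex.log (vline σ τ)).im = 2 * (Complex.log (vline σ τ)).im by simp,
      Complex.log_im, arg_vline hσ, Complex.add_im, Complex.ofReal_im, Complex.im_ofReal_mul,
      Complex.I_im, mul_one, zero_add]

theorem logAbs_sq {σ : ℝ} (hσ : 0 < σ) (τ : ℝ) :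
    logAbs σ τ ^ 2 = Real.log (σ ^ 2 + τ ^ 2) ^ 2 + (2 * Real.arctan (τ / σ)) ^ 2 := by
  rw [logAbs, Complex.sq_norm, two_log_vline hσ, Complex.normSq_add_mul_I]

theorem logAbs_abs {σ : ℝ} (hσ : 0 < σ) (τ : ℝ) : logAbs σ |τ| = logAbs σ τ := by
  rw [← sq_eq_sq₀ (logAbs_nonneg _ _) (logAbs_nonneg _ _), logAbs_sq hσ, logAbs_sq hσ, sq_abs]
  congr 1
  rcases abs_cases τ with ⟨h, _⟩ | ⟨h, _⟩ <;> rw [h]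
  rw [neg_div, Real.arctan_neg]
  ring

theorem norm_vline_abs (σ τ : ℝ) : ‖vline σ |τ|‖ = ‖vline σ τ‖ := by
  rw [← sq_eq_sq₀ (norm_nonneg _) (norm_nonneg _), norm_vline_sq, norm_vline_sq, sq_abs]

theorem norm_vline_mono (σ : ℝ) {τ τ' : ℝ} (h0 : 0 ≤ τ) (h : τ ≤ τ') :
    ‖vline σ τ‖ ≤ ‖vline σ τ'‖ := by
  rw [← sq_le_sq₀ (norm_nonneg _) (norm_nonneg _), norm_vline_sq, norm_vline_sq]
  gcongr

theorem logAbs_mono {σ : ℝ} (hσ : 1 ≤ σ) {τ τ' : ℝ} (h0 : 0 ≤ τ) (h : τ ≤ τ') :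
    logAbs σ τ ≤ logAbs σ τ' := by
  have hσ0 : 0 < σ := by linarith
  rw [← sq_le_sq₀ (logAbs_nonneg _ _) (logAbs_nonneg _ _), logAbs_sq hσ0, logAbs_sq hσ0]
  have h1 : (1 : ℝ) ≤ σ ^ 2 + τ ^ 2 := by nlinarith
  have h2 : 0 ≤ Real.log (σ ^ 2 + τ ^ 2) := Real.log_nonneg h1
  have h3 : 0 ≤ Real.arctan (τ / σ) := Real.arctan_nonneg.2 (by positivity)
  have h4 : Real.arctan (τ / σ) ≤ Real.arctan (τ' / σ) :=
    Real.arctan_strictMono.monotone (by gcongr)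
  gcongr

theorem logAbs_le_two_log_add_pi {σ : ℝ} (hσ : 1 ≤ σ) (τ : ℝ) :
    logAbs σ τ ≤ 2 * Real.log ‖vline σ τ‖ + Real.pi := by
  have h1 : 1 ≤ ‖vline σ τ‖ := hσ.trans (le_norm_vline σ τ)
  refine (Complex.norm_le_abs_re_add_abs_im _).trans ?_
  rw [two_log_vline (by linarith), ← two_mul_log_norm_vline]
  have h2 := Real.arctan_lt_pi_div_two (τ / σ)
  have h3 := Real.neg_pi_div_two_lt_arctan (τ / σ)
  have h4 : |2 * Real.arctan (τ / σ)| ≤ Real.pi := abs_le.2 ⟨by linarith, by linarith⟩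
  have h5 := Real.log_nonneg h1
  rw [Complex.add_re, Complex.add_im, Complex.ofReal_re, Complex.re_ofReal_mul, Complex.I_re,
    mul_zero, add_zero, Complex.ofReal_im, Complex.im_ofReal_mul, Complex.I_im, mul_one, zero_add,
    abs_of_nonneg (by linarith)]
  linarith

theorem two_log_le_logAbs (σ τ : ℝ) : 2 * Real.log ‖vline σ τ‖ ≤ logAbs σ τ := by
  refine le_trans (le_of_eq ?_) (Complex.re_le_norm _)
  rw [show (2 * Complex.log (vline σ τ)).re = 2 * (Complex.log (vline σ τ)).re by simp,
    Complex.log_re]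

theorem le_norm_vline_im (σ τ : ℝ) : τ ≤ ‖vline σ τ‖ := by
  simpa using Complex.im_le_norm (vline σ τ)

theorem logAbs_add_le {σ τ δ : ℝ} (hσ : 0 < σ) (hτ : 0 < τ) (hδ : 0 ≤ δ) :
    logAbs σ (τ + δ) ≤ logAbs σ τ + 2 / τ * δ := by
  have hd : ∀ t ∈ Set.Icc τ (τ + δ), HasDerivWithinAt (fun t : ℝ => 2 * Complex.log (vline σ t))
      (2 * (Complex.I / vline σ t)) (Set.Icc τ (τ + δ)) t := by
    intro t _
    have h1 : HasDerivAt (vline σ) Complex.I t := by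
      have h := ((hasDerivAt_id t).ofReal_comp.mul_const Complex.I).const_add (σ : ℂ)
      rw [Complex.ofReal_one, one_mul] at h
      exact h
    exact ((h1.clog_real (Or.inl (by simpa using hσ))).const_mul 2).hasDerivWithinAt
  have hb : ∀ t ∈ Set.Icc τ (τ + δ), ‖2 * (Complex.I / vline σ t)‖ ≤ 2 / τ := by
    intro t ht
    rw [norm_mul, norm_div, Complex.norm_I, Complex.norm_ofNat, mul_one_div]
    gcongr
    exact ht.1.trans (le_norm_vline_im σ t)
  have := (convex_Icc τ (τ + δ)).norm_image_sub_le_of_norm_hasDerivWithin_le hd hb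
    (x := τ) (y := τ + δ) ⟨le_rfl, by linarith⟩ ⟨by linarith, le_rfl⟩
  rw [add_sub_cancel_left, Real.norm_of_nonneg hδ] at this
  have h2 := norm_sub_norm_le (2 * Complex.log (vline σ (τ + δ))) (2 * Complex.log (vline σ τ))
  simp only [logAbs]
  linarith

/-- The weighted modulus of the integrand on a vertical line. -/
noncomputable def lineWeight (σ : ℝ) (p n : ℕ) (τ : ℝ) : ℝ :=
  Real.exp (σ ^ 2 - τ ^ 2) * (4 * ‖vline σ τ‖) ^ p * logAbs σ τ ^ n

/-- A bound for `lineWeight` on an interval of length `1 / 4`, for `s = 1`, and its value at a grid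
point for `s = 0`. -/
noncomputable def gridTerm (σ : ℝ) (p n s i : ℕ) : ℝ :=
  Real.exp (σ ^ 2 - (i / 4 : ℝ) ^ 2) * (4 * ‖vline σ ((i + s : ℕ) / 4)‖) ^ p *
    logAbs σ ((i + s : ℕ) / 4) ^ n

theorem gridTerm_nonneg (σ : ℝ) (p n s i : ℕ) : 0 ≤ gridTerm σ p n s i := by
  have := logAbs_nonneg σ ((i + s : ℕ) / 4)
  unfold gridTerm
  positivity

theorem norm_hankelIntegrand_eq (σ : ℝ) (n : ℕ) (τ : ℝ) :
    4 * ‖hankelIntegrand 0 n (vline σ τ)‖ = lineWeight σ 1 n τ := by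
  have := norm_exp_sq_vline σ τ 0
  rw [hankelIntegrand, norm_mul, norm_mul, norm_pow, this, lineWeight, logAbs, zero_mul, sub_zero,
    ← Real.exp_add]
  ring_nf

theorem gridTerm_succ_le {σ : ℝ} (hσ : 0 < σ) {p n s i : ℕ} (hp : p ≤ 41) (hn : n ≤ 10200)
    (hi : 160 ≤ i) : gridTerm σ p n s (i + 1) ≤ 1 / 2 * gridTerm σ p n s i := by
  have hi' : (160 : ℝ) ≤ i := by exact_mod_cast hi
  set τ : ℝ := ((i + s : ℕ) : ℝ) / 4 with hτ
  have hτ40 : 40 ≤ τ := by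
    have : (160 : ℝ) ≤ ((i + s : ℕ) : ℝ) := by exact_mod_cast hi.trans (Nat.le_add_right _ _)
    rw [hτ]; linarith
  have e1 : ((i + 1 + s : ℕ) : ℝ) / 4 = τ + 1 / 4 := by rw [hτ]; push_cast; ring
  have hz : 40 ≤ ‖vline σ τ‖ := hτ40.trans (le_norm_vline_im σ τ)
  have hA : 7 ≤ logAbs σ τ := by
    refine le_trans ?_ (two_log_le_logAbs σ τ)
    have h1 : (7 / 2 : ℝ) ≤ Real.log ‖vline σ τ‖ := by
      rw [Real.le_log_iff_exp_le (by linarith)]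
      refine le_trans ?_ hz
      have h2 : Real.exp (7 / 2) ^ 2 ≤ 40 ^ 2 := by
        rw [← Real.exp_nat_mul]
        have h3 : Real.exp ((2 : ℕ) * (7 / 2)) = Real.exp 1 ^ 7 := by
          rw [← Real.exp_nat_mul]; norm_num
        rw [h3]
        calc Real.exp 1 ^ 7 ≤ 2.7182818286 ^ 7 := by
              gcongr
              exact Real.exp_one_lt_d9.le
          _ ≤ 40 ^ 2 := by norm_num
      exact (sq_le_sq₀ (Real.exp_pos _).le (by norm_num)).1 h2
    linarith
  have hz' : ‖vline σ (τ + 1 / 4)‖ ≤ ‖vline σ τ‖ * Real.exp (1 / 160) := by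
    have h1 : vline σ (τ + 1 / 4) = vline σ τ + (1 / 4 : ℝ) * Complex.I := by
      simp only [vline]; push_cast; ring
    have h2 : ‖vline σ (τ + 1 / 4)‖ ≤ ‖vline σ τ‖ + 1 / 4 := by
      rw [h1]
      refine (norm_add_le _ _).trans ?_
      simp
    have h3 := Real.add_one_le_exp (1 / 160 : ℝ)
    nlinarith
  have hA' : logAbs σ (τ + 1 / 4) ≤ logAbs σ τ * Real.exp (1 / 560) := by
    have h2 := logAbs_add_le (τ := τ) (δ := 1 / 4) hσ (by linarith) (by norm_num)
    have h4 : 2 / τ ≤ 2 / 40 := by gcongr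
    have h3 := Real.add_one_le_exp (1 / 560 : ℝ)
    nlinarith
  have hexp : Real.exp (σ ^ 2 - ((i + 1 : ℕ) / 4 : ℝ) ^ 2) ≤
      Real.exp (σ ^ 2 - (i / 4 : ℝ) ^ 2) * Real.exp (-(321 / 16)) := by
    rw [← Real.exp_add, Real.exp_le_exp]
    push_cast
    nlinarith
  rw [gridTerm, gridTerm, e1, ← hτ]
  have hA0 := logAbs_nonneg σ (τ + 1 / 4)
  have hfin : Real.exp (-(321 / 16)) * Real.exp (1 / 160) ^ p * Real.exp (1 / 560) ^ n ≤ 1 / 2 := by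
    rw [← Real.exp_nat_mul, ← Real.exp_nat_mul, ← Real.exp_add, ← Real.exp_add]
    have hp' : (p : ℝ) ≤ 41 := by exact_mod_cast hp
    have hn' : (n : ℝ) ≤ 10200 := by exact_mod_cast hn
    calc _ ≤ Real.exp (-1) := by
          rw [Real.exp_le_exp]; linarith
      _ ≤ 1 / 2 := by
          rw [Real.exp_neg, one_div]
          gcongr
          linarith [Real.add_one_le_exp (1 : ℝ)]
  calc _ ≤ Real.exp (σ ^ 2 - (i / 4 : ℝ) ^ 2) * Real.exp (-(321 / 16)) *
        (4 * (‖vline σ τ‖ * Real.exp (1 / 160))) ^ p *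
        (logAbs σ τ * Real.exp (1 / 560)) ^ n := by gcongr
    _ = Real.exp (-(321 / 16)) * Real.exp (1 / 160) ^ p * Real.exp (1 / 560) ^ n *
        (Real.exp (σ ^ 2 - (i / 4 : ℝ) ^ 2) * (4 * ‖vline σ τ‖) ^ p * logAbs σ τ ^ n) := by ring
    _ ≤ _ := by
      have := logAbs_nonneg σ τ
      gcongr

theorem gridTerm_le_geometric {σ : ℝ} (hσ : 0 < σ) {p n s : ℕ} (hp : p ≤ 41) (hn : n ≤ 10200)
    (k : ℕ) : gridTerm σ p n s (k + 160) ≤ (1 / 2) ^ k * gridTerm σ p n s 160 := by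
  induction k with
  | zero => simp
  | succ k ih =>
    have := gridTerm_succ_le hσ (s := s) hp hn (i := k + 160) (by omega)
    rw [add_right_comm, pow_succ']
    nlinarith

theorem summable_gridTerm {σ : ℝ} (hσ : 0 < σ) {p n : ℕ} (s : ℕ) (hp : p ≤ 41) (hn : n ≤ 10200) :
    Summable (gridTerm σ p n s) := by
  rw [← summable_nat_add_iff 160]
  refine Summable.of_nonneg_of_le (fun k => gridTerm_nonneg _ _ _ _ _)
    (gridTerm_le_geometric hσ hp hn) (Summable.mul_right _ ?_)
  exact summable_geometric_of_lt_one (by norm_num) (by norm_num)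

theorem tsum_gridTerm_add_le {σ : ℝ} (hσ : 0 < σ) {p n : ℕ} (s : ℕ) (hp : p ≤ 41)
    (hn : n ≤ 10200) : ∑' k, gridTerm σ p n s (k + 160) ≤ 2 * gridTerm σ p n s 160 := by
  have h := (hasSum_geometric_of_lt_one (r := (1 / 2 : ℝ)) (by norm_num) (by norm_num)).mul_right
    (gridTerm σ p n s 160)
  norm_num at h
  refine (Summable.tsum_le_tsum (fun k => ?_) ((summable_nat_add_iff 160).2
    (summable_gridTerm hσ s hp hn)) h.summable).trans_eq h.tsum_eq
  simpa using gridTerm_le_geometric hσ hp hn k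

/-- The finite sum bounding all the grid terms, the last one being doubled to account for the
tail. -/
noncomputable def gridSum (σ : ℝ) (p n s : ℕ) : ℝ :=
  ∑ i ∈ Finset.range 160, gridTerm σ p n s i + 2 * gridTerm σ p n s 160

theorem tsum_gridTerm_le {σ : ℝ} (hσ : 0 < σ) {p n : ℕ} (s : ℕ) (hp : p ≤ 41) (hn : n ≤ 10200) :
    ∑' i, gridTerm σ p n s i ≤ gridSum σ p n s := by
  rw [← (summable_gridTerm hσ s hp hn).sum_add_tsum_nat_add 160, gridSum]
  gcongr
  exact tsum_gridTerm_add_le hσ s hp hn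

theorem continuous_lineWeight {σ : ℝ} (hσ : 0 < σ) (p n : ℕ) : Continuous (lineWeight σ p n) := by
  have := continuous_log_vline hσ
  unfold lineWeight logAbs
  fun_prop

theorem integrable_lineWeight {σ : ℝ} (hσ : 1 ≤ σ) (p n : ℕ) : Integrable (lineWeight σ p n) := by
  have hσ0 : 0 < σ := by linarith
  have h := integrable_hankel_bound 0 hσ0 (r := p + 1) (by positivity)
  refine (h.const_mul (4 ^ p * n.factorial)).mono'
    (continuous_lineWeight hσ0 p n).aestronglyMeasurable (Eventually.of_forall fun τ => ?_)
  have hz : 1 ≤ ‖vline σ τ‖ := hσ.trans (le_norm_vline σ τ)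
  have hA := logAbs_nonneg σ τ
  have h0 : 0 ≤ lineWeight σ p n τ := by
    unfold lineWeight
    positivity
  rw [Real.norm_of_nonneg h0, lineWeight, norm_mul, norm_exp_sq_vline, ← Real.exp_add]
  have h1 : logAbs σ τ ^ n ≤ n.factorial * Real.exp (logAbs σ τ) := by
    have := Real.pow_div_factorial_le_exp _ (logAbs_nonneg σ τ) n
    rwa [div_le_iff₀' (by positivity)] at this
  have h2 : ‖vline σ τ‖ ≤ Real.exp (logAbs σ τ) := by
    have h3 := two_log_le_logAbs σ τ
    have h4 := Real.log_nonneg hz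
    rw [← Real.log_le_iff_le_exp (by linarith)]
    linarith
  have e : Real.exp ((p + 1) * ‖2 * Complex.log (vline σ τ)‖) =
      Real.exp (logAbs σ τ) ^ p * Real.exp (logAbs σ τ) := by
    rw [← Real.exp_nat_mul, ← Real.exp_add, logAbs]
    ring_nf
  rw [e, mul_pow]
  calc _ ≤ Real.exp (σ ^ 2 - τ ^ 2) * (4 ^ p * Real.exp (logAbs σ τ) ^ p) *
        (n.factorial * Real.exp (logAbs σ τ)) := by gcongr
    _ ≤ Real.exp (σ ^ 2 - τ ^ 2) * (4 ^ p * Real.exp (logAbs σ τ) ^ p) *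
        (n.factorial * Real.exp (logAbs σ τ)) * ‖vline σ τ‖ := le_mul_of_one_le_right
          (by positivity) hz
    _ = _ := by ring_nf

theorem lineWeight_le_gridTerm {σ : ℝ} (hσ : 1 ≤ σ) (p n i : ℕ) {τ : ℝ} (h1 : (i : ℝ) / 4 ≤ τ)
    (h2 : τ ≤ ((i + 1 : ℕ) : ℝ) / 4) : lineWeight σ p n τ ≤ gridTerm σ p n 1 i := by
  have h0 : 0 ≤ τ := le_trans (by positivity) h1
  have h3 := logAbs_nonneg σ τ
  have h4 := norm_vline_mono σ h0 h2
  have h5 := logAbs_mono hσ h0 h2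
  unfold lineWeight gridTerm
  gcongr

theorem integral_lineWeight_le {σ : ℝ} (hσ : 1 ≤ σ) {p n : ℕ} (hp : p ≤ 41) (hn : n ≤ 10200) :
    2 * ∫ τ, lineWeight σ p n τ ≤ gridSum σ p n 1 := by
  have hσ0 : 0 < σ := by linarith
  have e : (∫ τ, lineWeight σ p n τ) = 2 * ∫ τ in Set.Ioi 0, lineWeight σ p n τ := by
    rw [← integral_comp_abs]
    congr 1
    ext τ
    simp only [lineWeight]
    rw [logAbs_abs hσ0, norm_vline_abs, sq_abs]
  have hint := integrable_lineWeight hσ p n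
  have hle : ∫ τ in Set.Ioi 0, lineWeight σ p n τ ≤ 1 / 4 * gridSum σ p n 1 := by
    have ht : Tendsto (fun k : ℕ => (k : ℝ) / 4) atTop atTop :=
      tendsto_natCast_atTop_atTop.atTop_div_const (by norm_num)
    refine le_of_tendsto (intervalIntegral_tendsto_integral_Ioi 0 hint.integrableOn ht)
      (Eventually.of_forall fun k => ?_)
    have h := intervalIntegral.sum_integral_adjacent_intervals (f := lineWeight σ p n)
      (μ := volume) (a := fun i : ℕ => (i : ℝ) / 4) (n := k)
      (fun i _ => hint.intervalIntegrable)
    simp only [Nat.cast_zero, zero_div] at h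
    rw [← h]
    calc _ ≤ ∑ i ∈ Finset.range k, 1 / 4 * gridTerm σ p n 1 i := by
          refine Finset.sum_le_sum fun i _ => ?_
          have hab : (i : ℝ) / 4 ≤ ((i + 1 : ℕ) : ℝ) / 4 := by gcongr; simp
          have := intervalIntegral.integral_mono_on hab (hint.intervalIntegrable)
            (intervalIntegrable_const (c := gridTerm σ p n 1 i))
            (fun τ hτ => lineWeight_le_gridTerm hσ p n i hτ.1 hτ.2)
          refine this.trans_eq ?_
          rw [intervalIntegral.integral_const, smul_eq_mul]
          push_cast
          ring
      _ = 1 / 4 * ∑ i ∈ Finset.range k, gridTerm σ p n 1 i := by rw [Finset.mul_sum]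
      _ ≤ 1 / 4 * ∑' i, gridTerm σ p n 1 i := by
          gcongr
          exact (summable_gridTerm hσ0 1 hp hn).sum_le_tsum _ fun i _ => gridTerm_nonneg _ _ _ _ _
      _ ≤ _ := by
          gcongr
          exact tsum_gridTerm_le hσ0 1 hp hn
  rw [e]
  linarith

theorem eight_mul_hankelAbs_le {σ : ℝ} (hσ : 1 ≤ σ) {n : ℕ} (hn : n ≤ 10200) :
    8 * hankelAbs σ n ≤ gridSum σ 1 n 1 := by
  have h := integral_lineWeight_le hσ (p := 1) (by norm_num) hn
  have e : ∫ τ, lineWeight σ 1 n τ = 4 * hankelAbs σ n := by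
    rw [hankelAbs, ← integral_const_mul]
    congr 1
    ext τ
    rw [norm_hankelIntegrand_eq]
  rw [e] at h
  linarith

theorem norm_rgammaCoeff_le {σ : ℝ} (hσ : 0 < σ) (n : ℕ) :
    Real.pi * n.factorial * ‖rgammaCoeff n‖ ≤ hankelAbs σ n := by
  rw [rgammaCoeff_eq_hankelMoment hσ, norm_div, norm_mul, norm_div, norm_pow, norm_neg, norm_one,
    one_pow, Complex.norm_real, Real.norm_of_nonneg Real.pi_pos.le, Complex.norm_natCast]
  have h1 : (n.factorial : ℝ) ≠ 0 := by exact_mod_cast n.factorial_ne_zero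
  have h2 := norm_hankelMoment_le 0 hσ hσ n
  have h3 := Real.pi_ne_zero
  simp only [zero_mul, neg_zero, Real.exp_zero, one_mul] at h2
  field_simp
  exact h2

/-- A bound for the tails of the power series of `1 / Γ` at the radius `c`. -/
theorem tsum_norm_rgammaCoeff_le {σ : ℝ} (hσ : 1 ≤ σ) {c n : ℕ} (hc : c ≤ 20) (hn : n ≤ 10200) :
    Summable (fun k => ‖rgammaCoeff (n + k)‖ * (c : ℝ) ^ k) ∧
    8 * Real.pi * n.factorial * ∑' k, ‖rgammaCoeff (n + k)‖ * (c : ℝ) ^ k ≤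
      2 ^ c * gridSum σ (2 * c + 1) n 1 := by
  have hσ0 : 0 < σ := by linarith
  have hfac : (0 : ℝ) < n.factorial := by exact_mod_cast n.factorial_pos
  have hpi := Real.pi_pos
  have hint := integral_lineWeight_le hσ (p := 2 * c + 1) (n := n) (by omega) hn
  have hexp : ∀ τ, Real.exp (c * logAbs σ τ) ≤ 2 ^ (5 * c) * ‖vline σ τ‖ ^ (2 * c) := by
    intro τ
    have hz : 0 < ‖vline σ τ‖ := norm_pos_iff.2 (vline_ne_zero hσ0 τ)
    have h1 := logAbs_le_two_log_add_pi hσ τ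
    have h2 : Real.exp (logAbs σ τ) ≤ 2 ^ 5 * ‖vline σ τ‖ ^ 2 := by
      have h3 : Real.pi ≤ 5 * Real.log 2 := by
        linarith [Real.pi_lt_d2, Real.log_two_gt_d9]
      calc Real.exp (logAbs σ τ) ≤ Real.exp (5 * Real.log 2 + 2 * Real.log ‖vline σ τ‖) := by
            rw [Real.exp_le_exp]; linarith
        _ = _ := by
            rw [Real.exp_add]
            have e1 : Real.exp (5 * Real.log 2) = 2 ^ 5 := by
              rw [mul_comm, ← Real.rpow_def_of_pos (by norm_num)]; norm_num
            have e2 : Real.exp (2 * Real.log ‖vline σ τ‖) = ‖vline σ τ‖ ^ 2 := by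
              rw [mul_comm, ← Real.rpow_def_of_pos hz]; norm_num
            rw [e1, e2]
    rw [Real.exp_nat_mul]
    calc _ ≤ (2 ^ 5 * ‖vline σ τ‖ ^ 2) ^ c := by gcongr
      _ = _ := by rw [mul_pow, ← pow_mul, ← pow_mul]
  have hpart : ∀ K : ℕ, ∑ k ∈ Finset.range K, ‖rgammaCoeff (n + k)‖ * (c : ℝ) ^ k ≤
      2 ^ c * gridSum σ (2 * c + 1) n 1 / (8 * Real.pi * n.factorial) := by
    intro K
    rw [le_div_iff₀' (by positivity), Finset.mul_sum]
    have hterm : ∀ k, 8 * Real.pi * n.factorial * (‖rgammaCoeff (n + k)‖ * (c : ℝ) ^ k) ≤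
        ∫ τ, 2 * ((c * logAbs σ τ) ^ k / k.factorial * lineWeight σ 1 n τ) := by
      intro k
      have h1 := norm_rgammaCoeff_le hσ0 (n + k)
      have h2 : (n.factorial : ℝ) * k.factorial ≤ (n + k).factorial := by
        exact_mod_cast Nat.le_of_dvd (Nat.factorial_pos _)
          (Nat.factorial_mul_factorial_dvd_factorial_add n k)
      have e1 : ∫ τ, 2 * ((c * logAbs σ τ) ^ k / k.factorial * lineWeight σ 1 n τ) =
          8 * (c : ℝ) ^ k / k.factorial * hankelAbs σ (n + k) := by
        rw [hankelAbs, ← integral_const_mul]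
        congr 1
        ext τ
        have := norm_hankelIntegrand_eq σ (n + k) τ
        rw [show ‖hankelIntegrand 0 (n + k) (vline σ τ)‖ = lineWeight σ 1 (n + k) τ / 4 by linarith]
        simp only [lineWeight]
        ring
      rw [e1]
      have hk : (0 : ℝ) < k.factorial := by exact_mod_cast k.factorial_pos
      have h3 : 8 * (c : ℝ) ^ k / k.factorial * (Real.pi * (n + k).factorial * ‖rgammaCoeff (n + k)‖) ≤
        8 * (c : ℝ) ^ k / k.factorial * hankelAbs σ (n + k) := by gcongr
      refine le_trans ?_ h3
      have h4 : (n.factorial : ℝ) ≤ (n + k).factorial / k.factorial := by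
        rwa [le_div_iff₀ hk]
      calc _ = 8 * (c : ℝ) ^ k * Real.pi * ‖rgammaCoeff (n + k)‖ * n.factorial := by ring
        _ ≤ 8 * (c : ℝ) ^ k * Real.pi * ‖rgammaCoeff (n + k)‖ * ((n + k).factorial / k.factorial) := by
            gcongr
        _ = _ := by ring
    have hintk : ∀ k, Integrable fun τ => 2 * ((c * logAbs σ τ) ^ k / k.factorial *
        lineWeight σ 1 n τ) := by
      intro k
      have := (integrable_lineWeight hσ 1 (n + k)).const_mul (2 * (c : ℝ) ^ k / k.factorial)
      refine this.congr (Eventually.of_forall fun τ => ?_)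
      simp only [lineWeight]
      ring
    calc _ ≤ ∑ k ∈ Finset.range K, ∫ τ, 2 * ((c * logAbs σ τ) ^ k / k.factorial *
          lineWeight σ 1 n τ) := Finset.sum_le_sum fun k _ => hterm k
      _ = ∫ τ, ∑ k ∈ Finset.range K, 2 * ((c * logAbs σ τ) ^ k / k.factorial *
          lineWeight σ 1 n τ) := (integral_finsetSum _ fun k _ => hintk k).symm
      _ ≤ ∫ τ, 2 ^ c * 2 * lineWeight σ (2 * c + 1) n τ := by
          refine integral_mono (integrable_finsetSum _ fun k _ => hintk k)
            ((integrable_lineWeight hσ _ _).const_mul _) fun τ => ?_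
          simp only
          have h1 := Real.sum_le_exp_of_nonneg (x := c * logAbs σ τ)
            (mul_nonneg (by positivity) (logAbs_nonneg _ _)) K
          have h2 := h1.trans (hexp τ)
          have hw : 0 ≤ lineWeight σ 1 n τ := by
            rw [← norm_hankelIntegrand_eq]; positivity
          rw [← Finset.mul_sum, ← Finset.sum_mul]
          calc _ ≤ 2 * (2 ^ (5 * c) * ‖vline σ τ‖ ^ (2 * c) * lineWeight σ 1 n τ) := by gcongr
            _ = _ := by
              simp only [lineWeight]
              have e : (2 : ℝ) ^ (5 * c) = 2 ^ c * 4 ^ (2 * c) := by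
                rw [pow_mul, pow_mul, ← mul_pow]; norm_num
              rw [e]
              ring
      _ = 2 ^ c * (2 * ∫ τ, lineWeight σ (2 * c + 1) n τ) := by
          rw [integral_const_mul]; ring
      _ ≤ _ := by gcongr
  have hnn : ∀ k, 0 ≤ ‖rgammaCoeff (n + k)‖ * (c : ℝ) ^ k := fun k => by positivity
  refine ⟨summable_of_sum_range_le hnn hpart, ?_⟩
  have := Real.tsum_le_of_sum_range_le hnn hpart
  rwa [le_div_iff₀' (by positivity)] at this

end GridBound

section Reduction

theorem exp_neg_eight_pi_le (a : ℕ) : Real.exp (-(2 * Real.pi * a / (1 / 4))) ≤ (1 / 2 ^ 36) ^ a := by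
  have h1 : Real.exp (-(8 * Real.pi)) ≤ 1 / 2 ^ 36 := by
    rw [Real.exp_neg, one_div]
    gcongr
    have h2 : (2 : ℝ) ^ 36 = Real.exp (36 * Real.log 2) := by
      rw [mul_comm, ← Real.rpow_def_of_pos (by norm_num)]; norm_num
    rw [h2, Real.exp_le_exp]
    linarith [Real.pi_gt_d2, Real.log_two_lt_d9]
  calc _ = Real.exp (-(8 * Real.pi)) ^ a := by
        rw [← Real.exp_nat_mul]; congr 1; ring
    _ ≤ _ := by gcongr

theorem trapezoid_error {σ : ℝ} {a : ℕ} (ha : 1 ≤ a) (haσ : 1 ≤ σ - a) {n : ℕ} (hn : n ≤ 10200)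
    {W : Finset ℕ} (hW : W ⊆ Finset.range 160) :
    |8 * Real.pi * n.factorial * ‖rgammaCoeff n‖ -
      abs (∑ j ∈ W, (if j = 0 then 1 / 2 else 1) *
        (4 * (hankelIntegrand 0 n (vline σ (j / 4))).re))| ≤
      2 / 2 ^ (36 * a) * (gridSum (σ + a) 1 n 1 + gridSum (σ - a) 1 n 1) +
        (∑ j ∈ Finset.range 160 \ W, gridTerm σ 1 n 0 j + 2 * gridTerm σ 1 n 0 160) := by
  have ha' : (1 : ℝ) ≤ a := by exact_mod_cast ha
  have hσ : 0 < σ := by linarith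
  have h4 : (0 : ℝ) < 1 / 4 := by norm_num
  have htrap := norm_trapezoid_sub_hankelMoment_le (h := 1 / 4) (by linarith : (0 : ℝ) < a)
    (by linarith : (a : ℝ) < σ) h4 n (exp_neg_eight_pi_le a)
    (pow_lt_one₀ (by norm_num) (by norm_num) (by omega))
  rw [tsum_int_hankelIntegrand hσ h4] at htrap
  have hq : (1 / 2 ^ 36 : ℝ) ^ a / (1 - (1 / 2 ^ 36) ^ a) ≤ 2 / 2 ^ (36 * a) := by
    have h1 : (1 / 2 ^ 36 : ℝ) ^ a ≤ 1 / 2 := by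
      calc (1 / 2 ^ 36 : ℝ) ^ a ≤ (1 / 2 ^ 36 : ℝ) ^ 1 :=
            pow_le_pow_of_le_one (by norm_num) (by norm_num) ha
        _ ≤ 1 / 2 := by norm_num
    have h2 : (2 : ℝ) / 2 ^ (36 * a) = 2 * (1 / 2 ^ 36) ^ a := by
      rw [pow_mul, div_pow, one_pow]; ring
    rw [h2, div_le_iff₀ (by linarith)]
    have h3 : (0 : ℝ) < (1 / 2 ^ 36) ^ a := by positivity
    nlinarith
  set f : ℕ → ℝ := fun j => (hankelIntegrand 0 n (vline σ (j / 4))).re with hf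
  have ef : ∀ j : ℕ, vline σ (1 / 4 * j) = vline σ (j / 4) := fun j => by
    congr 1; ring
  have hsum : Summable fun j : ℕ => hankelIntegrand 0 n (vline σ (j / 4)) := by
    have := summable_hankelIntegrand hσ h4 n
    simpa only [ef] using this
  have hsf : Summable f := (Complex.hasSum_re hsum.hasSum).summable
  set g : ℕ → ℝ := fun j => (if j = 0 then 1 / 2 else 1) * (4 * f j) with hg
  have hgf : ∀ j, g (j + 1) = 4 * f (j + 1) := fun j => by simp [hg]
  have hg1 : Summable fun j => g (j + 1) := by
    simp_rw [hgf]
    exact ((summable_nat_add_iff 1).2 hsf).mul_left 4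
  have hsg : Summable g := (summable_nat_add_iff 1).1 hg1
  have hgsum : ∑' j, g j = 4 * ∑' j, f j - 2 * f 0 := by
    rw [hsg.tsum_eq_zero_add, hsf.tsum_eq_zero_add]
    simp_rw [hgf]
    rw [tsum_mul_left]
    simp [hg]
    ring
  have hre : (∑' j : ℕ, hankelIntegrand 0 n (vline σ (1 / 4 * j))).re = ∑' j, f j := by
    simp_rw [ef]
    exact (Complex.hasSum_re hsum.hasSum).tsum_eq.symm
  have hf0 : (hankelIntegrand 0 n (vline σ 0)).re = f 0 := by simp [hf]
  rw [hre, hf0] at htrap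
  have hT : ((1 / 4 : ℝ) : ℂ) * ((2 * ∑' j, f j - f 0 : ℝ) : ℂ) = ((1 / 8 * ∑' j, g j : ℝ) : ℂ) := by
    rw [hgsum]
    push_cast
    ring
  rw [hT] at htrap
  have hmom : 8 * Real.pi * n.factorial * ‖rgammaCoeff n‖ = 8 * ‖hankelMoment 0 σ n‖ := by
    rw [rgammaCoeff_eq_hankelMoment hσ, norm_div, norm_mul, norm_div, norm_pow, norm_neg, norm_one,
      one_pow, Complex.norm_real, Real.norm_of_nonneg Real.pi_pos.le, Complex.norm_natCast]
    have h1 : (n.factorial : ℝ) ≠ 0 := by exact_mod_cast n.factorial_ne_zero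
    have h3 := Real.pi_ne_zero
    field_simp
  have hM1 := eight_mul_hankelAbs_le (σ := σ + a) (by linarith) hn
  have hM2 := eight_mul_hankelAbs_le (σ := σ - a) haσ hn
  have hA : |8 * ‖hankelMoment 0 σ n‖ - abs (∑' j, g j)| ≤
      2 / 2 ^ (36 * a) * (gridSum (σ + a) 1 n 1 + gridSum (σ - a) 1 n 1) := by
    have h1 := (abs_norm_sub_norm_le _ _).trans htrap
    rw [Complex.norm_real, Real.norm_eq_abs, abs_mul, abs_of_nonneg (by norm_num : (0 : ℝ) ≤ 1 / 8),
      abs_sub_comm] at h1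
    calc _ = 8 * |‖hankelMoment 0 σ n‖ - 1 / 8 * abs (∑' j, g j)| := by
          rw [← abs_of_nonneg (by norm_num : (0 : ℝ) ≤ 8), ← abs_mul, abs_of_nonneg
            (by norm_num : (0 : ℝ) ≤ 8)]
          congr 1
          ring
      _ ≤ 8 * ((hankelAbs (σ + a) n + hankelAbs (σ - a) n) *
          ((1 / 2 ^ 36 : ℝ) ^ a / (1 - (1 / 2 ^ 36) ^ a))) := by gcongr
      _ ≤ 8 * ((hankelAbs (σ + a) n + hankelAbs (σ - a) n) * (2 / 2 ^ (36 * a))) := by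
          have := hankelAbs_nonneg (σ + a) n
          have := hankelAbs_nonneg (σ - a) n
          gcongr
      _ = 2 / 2 ^ (36 * a) * (8 * hankelAbs (σ + a) n + 8 * hankelAbs (σ - a) n) := by ring
      _ ≤ _ := by gcongr
  have hgb : ∀ j, |g j| ≤ gridTerm σ 1 n 0 j := by
    intro j
    have h1 : |f j| ≤ ‖hankelIntegrand 0 n (vline σ (j / 4))‖ := Complex.abs_re_le_norm _
    have h2 : gridTerm σ 1 n 0 j = lineWeight σ 1 n (j / 4) := by
      simp [gridTerm, lineWeight]
    rw [h2, ← norm_hankelIntegrand_eq, hg]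
    simp only [abs_mul]
    have h3 : |(if j = 0 then 1 / 2 else 1 : ℝ)| ≤ 1 := by
      split_ifs <;> norm_num
    calc _ ≤ 1 * (|4| * |f j|) := by gcongr
      _ ≤ _ := by
        rw [one_mul, abs_of_nonneg (by norm_num : (0 : ℝ) ≤ 4)]
        gcongr
  have hB : |∑' j, g j - ∑ j ∈ W, g j| ≤
      ∑ j ∈ Finset.range 160 \ W, gridTerm σ 1 n 0 j + 2 * gridTerm σ 1 n 0 160 := by
    rw [← hsg.sum_add_tsum_nat_add 160, ← Finset.sum_sdiff hW]
    have e : ∑ j ∈ Finset.range 160 \ W, g j + ∑ j ∈ W, g j + ∑' i, g (i + 160) - ∑ j ∈ W, g j =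
      ∑ j ∈ Finset.range 160 \ W, g j + ∑' i, g (i + 160) := by ring
    rw [e]
    refine (abs_add_le _ _).trans (add_le_add ?_ ?_)
    · exact (Finset.abs_sum_le_sum_abs _ _).trans (Finset.sum_le_sum fun j _ => hgb j)
    · have hs := (summable_nat_add_iff 160).2 (summable_gridTerm hσ (p := 1) 0 (by norm_num) hn)
      refine le_trans ?_ (tsum_gridTerm_add_le hσ 0 (by norm_num) hn)
      rw [← Real.norm_eq_abs]
      exact tsum_of_norm_bounded hs.hasSum fun j => hgb _
  rw [hmom]
  have h5 := abs_abs_sub_abs_le (∑' j, g j) (∑ j ∈ W, g j)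
  calc _ ≤ |8 * ‖hankelMoment 0 σ n‖ - abs (∑' j, g j)| + |abs (∑' j, g j) - abs (∑ j ∈ W, g j)| :=
        abs_sub_le _ _ _
    _ ≤ _ := add_le_add hA (h5.trans hB)

/-- The error estimate at `N` follows from bounds for the absolute power series at the two radii
`1 / 2` and `R`, if larger `z` violate the smallness condition. -/
theorem error_bound_of_tsum_le {N : ℕ} {R : ℝ} (hR : 1 / 2 ≤ R)
    (hthr : 20 ≤ R ∨ (2 : ℝ)⁻¹ ^ 8 ≤ 8 * R * ‖rgammaShiftCoeff N‖ * R ^ N)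
    (hs : Summable fun k => ‖rgammaShiftCoeff (N + k)‖ * R ^ k)
    (h1 : ∑' k, ‖rgammaShiftCoeff (N + k)‖ * R ^ k ≤ 8 * R * ‖rgammaShiftCoeff N‖)
    (h2 : ∑' k, ‖rgammaShiftCoeff (N + k)‖ * (1 / 2) ^ k ≤ 4 * ‖rgammaShiftCoeff N‖)
    {z : ℂ} (hz : ‖z‖ ≤ 20) (hbd : rgammaErrorBound N z < (2 : ℝ)⁻¹ ^ 8) :
    ‖1 / Complex.Gamma (1 + z) - ∑ n ∈ Finset.range N, rgammaShiftCoeff n * z ^ n‖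
        ≤ rgammaErrorBound N z := by
  set r := ‖z‖ with hr
  have hr0 : 0 ≤ r := norm_nonneg z
  have hR0 : 0 ≤ R := by linarith
  have hle : ∀ x, 0 ≤ x → x ≤ R → ∀ k, ‖rgammaShiftCoeff (N + k)‖ * x ^ k ≤
      ‖rgammaShiftCoeff (N + k)‖ * R ^ k := by
    intro x hx hxR k
    gcongr
  have hsx : ∀ x, 0 ≤ x → x ≤ R → Summable fun k => ‖rgammaShiftCoeff (N + k)‖ * x ^ k :=
    fun x hx hxR => Summable.of_nonneg_of_le (fun k => by positivity) (hle x hx hxR) hs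
  have hrR : r ≤ R := by
    by_contra! h
    rcases hthr with h20 | hthr
    · linarith
    · refine absurd hbd (not_lt.2 (hthr.trans ?_))
      rw [rgammaErrorBound]
      have : R ≤ max (1 / 2) r := h.le.trans (le_max_right _ _)
      gcongr
  have hsr := hsx r hr0 hrR
  have hrem : 1 / Complex.Gamma (1 + z) - ∑ n ∈ Finset.range N, rgammaShiftCoeff n * z ^ n =
      ∑' k, z ^ (k + N) * rgammaShiftCoeff (k + N) := by
    have h := hasSum_rgammaShiftCoeff z
    rw [← h.tsum_eq, ← h.summable.sum_add_tsum_nat_add N]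
    simp_rw [mul_comm (rgammaShiftCoeff _)]
    ring
  have hnorm : ‖∑' k, z ^ (k + N) * rgammaShiftCoeff (k + N)‖ ≤
      r ^ N * ∑' k, ‖rgammaShiftCoeff (N + k)‖ * r ^ k := by
    refine tsum_of_norm_bounded (hsr.hasSum.mul_left _) fun k => le_of_eq ?_
    rw [norm_mul, norm_pow, pow_add, add_comm k N]
    ring
  have hp : ∑' k, ‖rgammaShiftCoeff (N + k)‖ * r ^ k ≤
      8 * max (1 / 2) r * ‖rgammaShiftCoeff N‖ := by
    rcases le_total r (1 / 2) with hr2 | hr2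
    · rw [max_eq_left hr2]
      refine (hsr.tsum_le_tsum (fun k => ?_) (hsx _ (by norm_num) hR)).trans (h2.trans_eq (by ring))
      gcongr
    · rw [max_eq_right hr2]
      rcases eq_or_lt_of_le hR with hRe | hRl
      · have : r = 1 / 2 := by linarith
        rw [this]
        refine h2.trans_eq (by ring)
      · set t := (r - 1 / 2) / (R - 1 / 2) with ht
        have hd : 0 < R - 1 / 2 := by linarith
        have ht0 : 0 ≤ t := div_nonneg (by linarith) hd.le
        have ht1 : t ≤ 1 := by rw [ht, div_le_one hd]; linarith
        have hrt : r = (1 - t) * (1 / 2) + t * R := by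
          have : t * (R - 1 / 2) = r - 1 / 2 := div_mul_cancel₀ _ hd.ne'
          linarith
        have hconv : ∀ k : ℕ, r ^ k ≤ (1 - t) * (1 / 2) ^ k + t * R ^ k := by
          intro k
          have hx : (1 / 2 : ℝ) ∈ Set.Ici 0 := by norm_num [Set.mem_Ici]
          have hy : R ∈ Set.Ici 0 := hR0
          have := (convexOn_pow k).2 hx hy (sub_nonneg.2 ht1) ht0 (by ring)
          simp only [smul_eq_mul] at this
          rwa [← hrt] at this
        have hs2 := hsx (1 / 2) (by norm_num) hR
        calc _ ≤ ∑' k, ((1 - t) * (‖rgammaShiftCoeff (N + k)‖ * (1 / 2) ^ k) +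
              t * (‖rgammaShiftCoeff (N + k)‖ * R ^ k)) := by
              refine hsr.tsum_le_tsum (fun k => ?_) ((hs2.mul_left _).add (hs.mul_left _))
              have := mul_le_mul_of_nonneg_left (hconv k) (norm_nonneg (rgammaShiftCoeff (N + k)))
              linarith
          _ = (1 - t) * ∑' k, ‖rgammaShiftCoeff (N + k)‖ * (1 / 2) ^ k +
              t * ∑' k, ‖rgammaShiftCoeff (N + k)‖ * R ^ k := by
              rw [(hs2.mul_left _).tsum_add (hs.mul_left _), tsum_mul_left, tsum_mul_left]
          _ ≤ (1 - t) * (4 * ‖rgammaShiftCoeff N‖) + t * (8 * R * ‖rgammaShiftCoeff N‖) := by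
              have : 0 ≤ 1 - t := by linarith
              gcongr
          _ = _ := by rw [hrt]; ring
  rw [hrem, rgammaErrorBound]
  calc _ ≤ r ^ N * (8 * max (1 / 2) r * ‖rgammaShiftCoeff N‖) :=
        hnorm.trans (by gcongr)
    _ = _ := by ring

end Reduction

section Algorithms

local infixl:65 " +ₙ " => Nat.add
local infixl:65 " -ₙ " => Nat.sub
local infixl:70 " *ₙ " => Nat.mul
local infixl:70 " /ₙ " => Nat.div

variable {R : Type}

/-- Passes `n` to a continuation. Written with a recursor, so that kernel reduction first evaluates
`n` to a literal. -/
noncomputable def force (n : ℕ) (k : ℕ → R) : R := Nat.rec (k 0) (fun m _ => k m) (n +ₙ 1)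

/-- A complex ball in fixed point arithmetic: at the scale `D`, its centre is
`((a - b) + (c - d) i) / D` and its radius is `r / D`. -/
structure Ball where
  a : ℕ
  b : ℕ
  c : ℕ
  d : ℕ
  r : ℕ

namespace Ball

/-- The ball with centre `0` and radius `0`. -/
def zero : Ball := ⟨0, 0, 0, 0, 0⟩

/-- Builds a ball from evaluated components. -/
noncomputable def mkK (a b c d r : ℕ) (k : Ball → R) : R :=
  force a fun a => force b fun b => force c fun c => force d fun d => force r fun r =>
    k ⟨a, b, c, d, r⟩

/-- Builds a ball around `((p - n) + (q - m) i) / D`, up to rounding. -/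
noncomputable def divK (D p n q m r : ℕ) (k : Ball → R) : R :=
  mkK ((p -ₙ n) /ₙ D) ((n -ₙ p) /ₙ D) ((q -ₙ m) /ₙ D) ((m -ₙ q) /ₙ D) r k

/-- A ball around `x y + c / D`, where the real number `c` may be rounded. -/
noncomputable def mulAddK (D c : ℕ) (x y : Ball) (k : Ball → R) : R :=
  x.rec fun a b c' d r => y.rec fun a' b' e d' r' =>
    divK D (a *ₙ a' +ₙ b *ₙ b' +ₙ c' *ₙ d' +ₙ d *ₙ e +ₙ c *ₙ D)
      (a *ₙ b' +ₙ b *ₙ a' +ₙ c' *ₙ e +ₙ d *ₙ d') (a *ₙ e +ₙ b *ₙ d' +ₙ c' *ₙ a' +ₙ d *ₙ b')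
      (a *ₙ d' +ₙ b *ₙ e +ₙ c' *ₙ b' +ₙ d *ₙ a')
      (((a +ₙ b +ₙ c' +ₙ d +ₙ r) *ₙ r' +ₙ (a' +ₙ b' +ₙ e +ₙ d') *ₙ r) /ₙ D +ₙ 4) k

/-- Multiplication. -/
noncomputable def mulK (D : ℕ) (x y : Ball) (k : Ball → R) : R := mulAddK D 0 x y k

/-- Addition, with the radius enlarged by `e`. -/
noncomputable def addK (x y : Ball) (e : ℕ) (k : Ball → R) : R :=
  x.rec fun a b c d r => y.rec fun a' b' c' d' r' =>
    divK 1 (a +ₙ a') (b +ₙ b') (c +ₙ c') (d +ₙ d') (r +ₙ r' +ₙ e) k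

/-- A ball around `((p - n) + q i) / m`. -/
noncomputable def ratK (D p n q m : ℕ) (k : Ball → R) : R :=
  mkK (p *ₙ D /ₙ m) (n *ₙ D /ₙ m) (q *ₙ D /ₙ m) 0 2 k

/-- Horner's scheme `x ↦ c m / D + y m * x` for `m = K - 1, …, 0`. -/
noncomputable def hornerK (D : ℕ) (c : ℕ → ℕ) (y : ℕ → (Ball → R) → R) (K : ℕ) (x : Ball)
    (k : Ball → R) : R :=
  Nat.rec (motive := fun _ => Ball → R) k
    (fun m ih x => y m fun y => mulAddK D (c m) y x ih) K x

/-- The power with exponent `n % 2 ^ f`. -/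
noncomputable def powK (D : ℕ) (x : Ball) (f n : ℕ) (k : Ball → R) : R :=
  Nat.rec (motive := fun _ => ℕ → (Ball → R) → R) (fun _ k => mkK D 0 0 0 0 k)
    (fun _ ih n k => force n fun n => ih (n / 2) fun s => mulK D s s fun s =>
      cond (Nat.beq (n % 2) 0) (k s) (mulK D s x k)) f n k

end Ball

open Ball

/-- Adds `2 log ((1 + w) / (1 - w))` for `w = (s + t i) / (s ^ 2 + t ^ 2)`, using `K` terms of the
power series. -/
noncomputable def artanhK (D K s t : ℕ) (x : Ball) (k : Ball → R) : R :=
  force (s *ₙ s +ₙ t *ₙ t) fun m => ratK D s 0 t m fun w => mulK D w w fun u =>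
    hornerK D (fun i => D /ₙ (2 *ₙ i +ₙ 1)) (fun _ k => k u) K zero fun y =>
      ratK D (4 *ₙ s) 0 (4 *ₙ t) m fun w => mulK D w y fun y =>
        addK x y (2 *ₙ D /ₙ Nat.pow m K +ₙ 1) k

/-- A ball around `2 log (s + 1)`. -/
noncomputable def logNatK (D K s : ℕ) (k : Ball → R) : R :=
  Nat.rec (motive := fun _ => (Ball → R) → R) (fun k => k zero)
    (fun i ih k => ih fun x => artanhK D K (2 * i + 3) 0 x k) s k

/-- Folds `f` over balls around `2 log (σ + i / 4)`, for `N` steps starting with `i`. -/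
noncomputable def walkK (D K σ : ℕ) (f : ℕ → Ball → R → (R → R) → R) (N i : ℕ) (x : Ball) (s : R) :
    R :=
  Nat.rec (motive := fun _ => ℕ → Ball → R → R) (fun _ _ s => s)
    (fun _ ih i x s => force i fun i => f i x s fun s => artanhK D K (2 * i + 1) (8 * σ) x fun x =>
      ih (i + 1) x s) N i x s

/-- The walk over the whole vertical line. -/
noncomputable def lineWalkK (D K₀ K σ : ℕ) (f : ℕ → Ball → R → (R → R) → R) (N : ℕ) (s : R) : R :=
  logNatK D K₀ (σ - 1) fun x => walkK D K σ f N 0 x s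

/-- An upper bound for `D ‖x‖ ^ 2` from a ball around `x`. -/
noncomputable def sqUpperK (D : ℕ) (x : Ball) (k : ℕ → R) : R :=
  x.rec fun a b c d r => force ((a *ₙ a +ₙ b *ₙ b +ₙ c *ₙ c +ₙ d *ₙ d +ₙ
    (2 *ₙ (a +ₙ b +ₙ c +ₙ d) +ₙ r) *ₙ r) /ₙ D +ₙ 1) k

/-- An upper bound, at the scale `D`, for a scaled term of `gridSum`, from an upper bound `v / D'`
for the square of the scaled logarithm. -/
def gridUpper (D D' κ σ c h s i v : ℕ) : ℕ :=
  D * 27183 ^ (κ + σ * σ) * 10000 ^ ((i - s) * (i - s) / 16) *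
    (16 * (σ * σ) + i * i) ^ c * (4 * σ + i) * v ^ h /
    (10000 ^ (κ + σ * σ) * 27182 ^ ((i - s) * (i - s) / 16) * D' ^ h) + 1

/-- Whether `i` is in the window from `j₀` to `j₁`. -/
def inWindow (j₀ j₁ i : ℕ) : Bool := Nat.ble j₀ i && Nat.blt i j₁

/-- Whether `i` contributes to a `gridSum` without the window from `j₀` to `j₁`. -/
def gridActive (s j₀ j₁ i : ℕ) : Bool :=
  Nat.ble s i && (Nat.ble i (160 + s) && !(inWindow j₀ j₁ i))

/-- One step of the walk that bounds a scaled `gridSum`, without the window from `j₀` to `j₁`, for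
all exponents between `2 * h₁` and `2 * h₂`. -/
noncomputable def gridStepK (D D' κ σ c h₁ h₂ s j₀ j₁ : ℕ) (g : Ball) (i : ℕ) (x : Ball) (S : ℕ)
    (k : ℕ → ℕ) : ℕ :=
  cond (gridActive s j₀ j₁ i)
    (mulK D' x g fun y => sqUpperK D' y fun v =>
      force (gridUpper D D' κ σ c h₁ s i v + gridUpper D D' κ σ c h₂ s i v) fun u =>
        force (S + cond (Nat.beq i (160 + s)) (2 * u) u) k)
    (k S)

/-- An upper bound for a scaled `gridSum`, without the window from `j₀` to `j₁`, for all exponents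
between `2 * h₁` and `2 * h₂`. -/
noncomputable def gridSumUpper (D D' κ σ c h₁ h₂ s j₀ j₁ : ℕ) (g : Ball) : ℕ :=
  lineWalkK D' 30 6 σ (gridStepK D D' κ σ c h₁ h₂ s j₀ j₁ g) 162 0

/-- A node of the trapezoidal rule: a ball around the current value, and a ball around the factor
by which it is multiplied in each step, with `g` an upper bound for the modulus of the factor. -/
structure Node where
  a : ℕ
  b : ℕ
  c : ℕ
  d : ℕ
  r : ℕ
  x : ℕ
  y : ℕ
  e : ℕ
  g : ℕ

/-- One step of the walk that collects the nodes in the window from `j₀` to `j₁`, with the exponent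
`n`. -/
noncomputable def nodeStepK (D κ σ n K j₀ j₁ : ℕ) (g : Ball) (i : ℕ) (x : Ball) (S : List Node)
    (k : List Node → List Node) : List Node :=
  cond (inWindow j₀ j₁ i)
    (mulK D x g fun l =>
      hornerK D (fun _ => D) (fun m => ratK D (16 * (σ * σ + κ)) (i * i) (8 * (σ * i))
        (1024 * n * (m + 1))) K zero fun t =>
      addK t zero
        (2 * D * (16 * (σ * σ + κ) + i * i + 8 * (σ * i)) ^ K / ((1024 * n) ^ K * K.factorial) + 1)
        fun t =>
      powK D t 7 64 fun t => mulK D t l fun t => powK D t 14 n fun t =>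
      mulK D t ⟨cond (Nat.beq i 0) (2 * σ) (4 * σ) * D, 0, i * D, 0, 0⟩ fun t =>
      l.rec fun a b c d e => t.rec fun a' b' c' d' r' => force (a - b) fun x => force (c - d) fun y =>
        force (((x * x + y * y) / D + D) / 2 + 2 + e) fun g =>
          k (⟨a', b', c', d', r', x, y, e, g⟩ :: S))
    (k S)

/-- The nodes in the window from `j₀` to `j₁`. -/
noncomputable def nodes (D κ σ n K₀ K₁ K j₀ j₁ : ℕ) (g : Ball) : List Node :=
  lineWalkK D K₀ K₁ σ (nodeStepK D κ σ n K j₀ j₁ g) j₁ []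

/-- Multiplies the value of every node by its factor, and adds the real parts of the old values to
`p - n`, and their radii to `r`. -/
noncomputable def advanceK (D : ℕ) (l : List Node) (p n r : ℕ)
    (k : List Node → ℕ → ℕ → ℕ → R) : R :=
  List.rec (motive := fun _ => ℕ → ℕ → ℕ → (List Node → ℕ → ℕ → ℕ → R) → R)
    (fun p n r k => k [] p n r)
    (fun v _ ih p n r k => v.rec fun a b c d rad x y e g =>
      divK D (a *ₙ x +ₙ d *ₙ y) (b *ₙ x +ₙ c *ₙ y) (a *ₙ y +ₙ c *ₙ x) (b *ₙ y +ₙ d *ₙ x)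
        ((rad *ₙ g +ₙ (a +ₙ b +ₙ c +ₙ d) *ₙ e) /ₙ D +ₙ 4) fun w =>
      w.rec fun a' b' c' d' rad' => ih (p +ₙ a) (n +ₙ b) (r +ₙ rad) fun l p n r =>
        k (⟨a', b', c', d', rad', x, y, e, g⟩ :: l) p n r)
    l p n r k

/-- Upper and lower bounds for the scaled moduli of the coefficients, in descending order. -/
noncomputable def boundsK (D E m : ℕ) (l : List Node) (acc : List (ℕ × ℕ))
    (k : List (ℕ × ℕ) → R) : R :=
  Nat.rec (motive := fun _ => List Node → List (ℕ × ℕ) → R) (fun _ acc => k acc)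
    (fun _ ih l acc => advanceK D l 0 0 0 fun l p n r => force p fun p => force n fun n => force r fun r =>
      force ((p - n) + (n - p)) fun s =>
      force (s + (r + E)) fun u => force (s - (r + E)) fun v => ih l ((u, v) :: acc)) m l acc

/-- The exceptional indices. -/
def exceptional (n : ℕ) : Bool := Nat.beq n 1444 || (Nat.beq n 2006 || Nat.beq n 9892)

/-- Checks the bounds for the indices from `lo` to `hi` and the radius `p / q`. The list starts with
the index `n`, and `t`, `t'` are upper bounds for the series starting with the index `n + 1`. -/
noncomputable def runCheck (D κ g lo hi p q : ℕ) (l : List (ℕ × ℕ)) (n t t' : ℕ) : Bool :=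
  List.rec (motive := fun _ => ℕ → ℕ → ℕ → Bool) (fun n _ _ => Nat.blt n lo)
    (fun v _ ih n t t' => v.rec fun u w =>
      force (u + t * (p * 65536) / (q * g * (n + 1)) + 1) fun t =>
      force (u + t' * 65536 / (2 * g * (n + 1)) + 1) fun t' =>
      cond (Nat.blt n lo) true
        (cond (Nat.ble hi n || (exceptional n || (Nat.ble (t * q) (8 * p * w) &&
          (Nat.ble t' (4 * w) && (Nat.ble (20 * q) p ||
            Nat.ble (22 * n.factorial * 27183 ^ κ * g ^ n * q ^ n * D)
              (7 * 256 * w * p ^ n * 65536 ^ n * 10000 ^ κ))))))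
        (force n fun n => ih (n - 1) t t') false))
    l n t t'

/-- Checks consecutive runs. -/
noncomputable def runsCheck (D κ g c : ℕ) (l : List (ℕ × ℕ)) (n t lo hi : ℕ)
    (runs : List (ℕ × ℕ × ℕ)) : Bool :=
  List.rec (motive := fun _ => ℕ → Bool) (fun lo => Nat.ble hi lo)
    (fun v _ ih lo => v.rec fun hi v => v.rec fun p q =>
      cond (runCheck D κ g lo hi p q l n t t && (Nat.ble lo hi && (Nat.ble 1 q &&
        (Nat.ble q (2 * p) && Nat.ble p (c * q)))))
        (ih hi) false) runs lo

/-- The verification for the indices from `n` to `hi`, with coefficients up to `n + m`. -/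
noncomputable def blockCheck (D D' κ σ a n m hi c g K₀ K₁ K j₀ j₁ : ℕ)
    (runs : List (ℕ × ℕ × ℕ)) : Bool :=
  force D fun D => force D' fun D' => force (n / 2) fun h₁ => force ((n + m) / 2) fun h₂ =>
  ratK D g 0 0 65536 fun G => ratK D' g 0 0 65536 fun G' =>
  force (gridSumUpper D D' κ (σ + a) 0 h₁ h₂ 1 0 0 G' + gridSumUpper D D' κ (σ - a) 0 h₁ h₂ 1 0 0 G')
    fun A =>
  force (gridSumUpper D D' κ σ 0 h₁ h₂ 0 j₀ j₁ G') fun B =>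
  force (2 ^ c * gridSumUpper D D' κ σ c h₂ h₂ 1 0 0 G') fun T =>
  force (2 * A / 2 ^ (36 * a) + 1 + B) fun E =>
  boundsK D E m (nodes D κ σ n K₀ K₁ K j₀ j₁ G) [] fun l => runsCheck D κ g c l (n + m - 1) T n hi runs

end Algorithms

section BallArithmetic

variable {R : Type}

theorem force_eq (n : ℕ) (k : ℕ → R) : force n k = k n := by cases n <;> rfl

namespace Ball

/-- The centre of a ball, at the scale `1`. -/
noncomputable def center (x : Ball) : ℂ := ⟨(x.a : ℝ) - x.b, (x.c : ℝ) - x.d⟩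

/-- The ball `B` at the scale `D` contains `x`. -/
def Near (D : ℕ) (B : Ball) (x : ℂ) : Prop := ‖(D : ℂ) * x - B.center‖ ≤ B.r

theorem norm_center_le (x : Ball) : ‖x.center‖ ≤ (x.a + x.b + x.c + x.d : ℕ) := by
  refine (Complex.norm_le_abs_re_add_abs_im _).trans ?_
  have h1 := abs_sub (x.a : ℝ) x.b
  have h2 := abs_sub (x.c : ℝ) x.d
  rw [Nat.abs_cast, Nat.abs_cast] at h1 h2
  push_cast
  simp only [center]
  linarith

theorem Near.norm_le {D : ℕ} {B : Ball} {x : ℂ} (h : Near D B x) :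
    D * ‖x‖ ≤ (B.a + B.b + B.c + B.d + B.r : ℕ) := by
  have h1 := norm_center_le B
  have h2 := norm_sub_norm_le ((D : ℂ) * x) B.center
  rw [norm_mul, Complex.norm_natCast] at h2
  unfold Near at h
  push_cast at h1 ⊢
  linarith

theorem abs_div_sub_nat_le {D : ℕ} (hD : 0 < D) (p n : ℕ) :
    |((p : ℝ) - n) / D - (((p - n) / D : ℕ) - ((n - p) / D : ℕ))| ≤ 1 := by
  have hD' : (0 : ℝ) < D := by exact_mod_cast hD
  have key : ∀ k : ℕ, |(k : ℝ) / D - (k / D : ℕ)| ≤ 1 := by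
    intro k
    have h1 : ((k / D : ℕ) : ℝ) ≤ k / D := Nat.cast_div_le
    have h2 : (k : ℝ) / D < (k / D : ℕ) + 1 := by
      rw [div_lt_iff₀ hD']
      have := Nat.lt_mul_div_succ k hD
      have : k < (k / D + 1) * D := by rwa [mul_comm]
      exact_mod_cast this
    rw [abs_of_nonneg (by linarith)]
    linarith
  rcases le_total n p with h | h
  · rw [Nat.sub_eq_zero_of_le h, Nat.zero_div, Nat.cast_zero, sub_zero, ← Nat.cast_sub h]
    exact key _
  · rw [Nat.sub_eq_zero_of_le h, Nat.zero_div, Nat.cast_zero, zero_sub, ← neg_sub (n : ℝ),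
      ← Nat.cast_sub h, neg_div, ← abs_neg]
    refine le_trans (le_of_eq ?_) (key (n - p))
    ring_nf

theorem norm_le_of_abs_le {z : ℂ} {a b : ℝ} (h1 : |z.re| ≤ a) (h2 : |z.im| ≤ b) : ‖z‖ ≤ a + b :=
  (Complex.norm_le_abs_re_add_abs_im z).trans (add_le_add h1 h2)

theorem divK_spec {D : ℕ} (hD : 0 < D) {p n q m r : ℕ} {x : ℂ}
    (h : ‖(D : ℂ) * x - (⟨p - n, q - m⟩ : ℂ) / D‖ + 2 ≤ r) :
    ∃ B, Near D B x ∧ ∀ k : Ball → R, divK D p n q m r k = k B := by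
  refine ⟨⟨(p - n) / D, (n - p) / D, (q - m) / D, (m - q) / D, r⟩, ?_, fun k => rfl⟩
  have h1 : ‖(⟨p - n, q - m⟩ : ℂ) / D -
      center ⟨(p - n) / D, (n - p) / D, (q - m) / D, (m - q) / D, r⟩‖ ≤ 1 + 1 := by
    apply norm_le_of_abs_le
    · rw [Complex.sub_re, Complex.div_natCast_re]
      exact abs_div_sub_nat_le hD p n
    · rw [Complex.sub_im, Complex.div_natCast_im]
      exact abs_div_sub_nat_le hD q m
  unfold Near
  have h2 := norm_add_le ((D : ℂ) * x - (⟨p - n, q - m⟩ : ℂ) / D) ((⟨p - n, q - m⟩ : ℂ) / D -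
      center ⟨(p - n) / D, (n - p) / D, (q - m) / D, (m - q) / D, r⟩)
  rw [sub_add_sub_cancel] at h2
  linarith

theorem mulAddK_spec {D : ℕ} (hD : 0 < D) {c : ℕ} {x y : Ball} {C : ℝ} {X Y : ℂ}
    (hC : |D * C - c| ≤ 1) (hx : Near D x X) (hy : Near D y Y) :
    ∃ B, Near D B (C + X * Y) ∧ ∀ k : Ball → R, mulAddK D c x y k = k B := by
  have hD' : (0 : ℝ) < D := by exact_mod_cast hD
  have hDc : (D : ℂ) ≠ 0 := by exact_mod_cast hD.ne'
  obtain ⟨a, b, c', d, r⟩ := x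
  obtain ⟨a', b', e, d', r'⟩ := y
  have hxn := hx.norm_le
  have hyc := norm_center_le ⟨a', b', e, d', r'⟩
  simp only at hxn hyc
  refine divK_spec hD ?_
  set S : ℕ := (a + b + c' + d + r) * r' + (a' + b' + e + d') * r with hS
  change _ ≤ ((S / D + 4 : ℕ) : ℝ)
  have hfl : (S : ℝ) / D ≤ (S / D : ℕ) + 1 := by
    have := abs_div_sub_nat_le hD S 0
    simp only [Nat.cast_zero, sub_zero, Nat.zero_sub, Nat.zero_div, Nat.sub_zero] at this
    linarith [(abs_le.1 this).2]
  have hz : (⟨((a * a' + b * b' + c' * d' + d * e + c * D : ℕ) : ℝ) -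
        (a * b' + b * a' + c' * e + d * d' : ℕ), ((a * e + b * d' + c' * a' + d * b' : ℕ) : ℝ) -
        (a * d' + b * e + c' * b' + d * a' : ℕ)⟩ : ℂ) =
      center ⟨a, b, c', d, r⟩ * center ⟨a', b', e, d', r'⟩ + c * D := by
    apply Complex.ext <;> simp [center] <;> ring
  change ‖_ - (⟨((a * a' + b * b' + c' * d' + d * e + c * D : ℕ) : ℝ) -
        (a * b' + b * a' + c' * e + d * d' : ℕ), ((a * e + b * d' + c' * a' + d * b' : ℕ) : ℝ) -
        (a * d' + b * e + c' * b' + d * a' : ℕ)⟩ : ℂ) / D‖ + 2 ≤ _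
  rw [hz]
  set U := center ⟨a, b, c', d, r⟩
  set V := center ⟨a', b', e, d', r'⟩
  have he : (D : ℂ) * (C + X * Y) - (U * V + c * D) / D =
      ((D * C - c : ℝ) : ℂ) + (X * (D * Y - V) + (D * X - U) * V / D) := by
    push_cast
    field_simp
    ring
  have h1 : ‖X * (D * Y - V)‖ ≤ ((a + b + c' + d + r : ℕ) : ℝ) / D * r' := by
    rw [norm_mul]
    have : ‖X‖ ≤ ((a + b + c' + d + r : ℕ) : ℝ) / D := by rwa [le_div_iff₀' hD']
    exact mul_le_mul this hy (norm_nonneg _) (by positivity)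
  have h2 : ‖(D * X - U) * V / D‖ ≤ r * ((a' + b' + e + d' : ℕ) : ℝ) / D := by
    rw [norm_div, norm_mul, Complex.norm_natCast]
    have : ‖D * X - U‖ ≤ r := hx
    gcongr
  have h3 : ‖((D * C - c : ℝ) : ℂ)‖ ≤ 1 := by rwa [Complex.norm_real, Real.norm_eq_abs]
  have h4 : ((a + b + c' + d + r : ℕ) : ℝ) / D * r' + r * ((a' + b' + e + d' : ℕ) : ℝ) / D =
      (S : ℝ) / D := by
    rw [hS]
    push_cast
    field_simp
  rw [he]
  have h5 := norm_add₃_le (a := ((D * C - c : ℝ) : ℂ)) (b := X * (D * Y - V))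
    (c := (D * X - U) * V / D)
  rw [add_assoc] at h5
  rw [Nat.cast_add, Nat.cast_ofNat]
  linarith

theorem mulK_spec {D : ℕ} (hD : 0 < D) {x y : Ball} {X Y : ℂ} (hx : Near D x X)
    (hy : Near D y Y) : ∃ B, Near D B (X * Y) ∧ ∀ k : Ball → R, mulK D x y k = k B := by
  simpa [mulK] using mulAddK_spec (R := R) hD (c := 0) (C := 0) (by simp) hx hy

theorem addK_spec {D : ℕ} {x y : Ball} {X Y Z : ℂ} {e : ℕ} (hx : Near D x X) (hy : Near D y Y)
    (hZ : D * ‖Z‖ ≤ e) : ∃ B, Near D B (X + Y + Z) ∧ ∀ k : Ball → R, addK x y e k = k B := by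
  obtain ⟨a, b, c, d, r⟩ := x
  obtain ⟨a', b', c', d', r'⟩ := y
  refine ⟨⟨(a + a' - (b + b')) / 1, (b + b' - (a + a')) / 1, (c + c' - (d + d')) / 1,
    (d + d' - (c + c')) / 1, r + r' + e⟩, ?_, fun k => rfl⟩
  have key : ∀ p n : ℕ, (((p - n) / 1 : ℕ) : ℝ) - ((n - p) / 1 : ℕ) = p - n := by
    intro p n
    rcases le_total n p with h | h
    · rw [Nat.sub_eq_zero_of_le h, Nat.div_one, Nat.div_one, Nat.cast_sub h]; simp
    · rw [Nat.sub_eq_zero_of_le h, Nat.div_one, Nat.div_one, Nat.cast_sub h]; simp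
  have hc : center ⟨(a + a' - (b + b')) / 1, (b + b' - (a + a')) / 1, (c + c' - (d + d')) / 1,
      (d + d' - (c + c')) / 1, r + r' + e⟩ =
      center ⟨a, b, c, d, r⟩ + center ⟨a', b', c', d', r'⟩ := by
    apply Complex.ext
    · simp only [center, key, Complex.add_re]; push_cast; ring
    · simp only [center, key, Complex.add_im]; push_cast; ring
  unfold Near at *
  rw [hc]
  have he : (D : ℂ) * (X + Y + Z) - (center ⟨a, b, c, d, r⟩ + center ⟨a', b', c', d', r'⟩) =
    (D * X - center ⟨a, b, c, d, r⟩) + (D * Y - center ⟨a', b', c', d', r'⟩) + D * Z := by ring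
  rw [he]
  refine norm_add₃_le.trans ?_
  rw [norm_mul, Complex.norm_natCast]
  push_cast
  linarith

theorem near_zero (D : ℕ) : Near D zero 0 := by
  have : center zero = 0 := by apply Complex.ext <;> simp [center, zero]
  simp [Near, this]

theorem ratK_spec {D p n q m : ℕ} (hm : 0 < m) :
    ∃ B, Near D B (((p - n : ℝ) + q * Complex.I) / m) ∧ ∀ k : Ball → R, ratK D p n q m k = k B := by
  refine ⟨⟨p * D / m, n * D / m, q * D / m, 0, 2⟩, ?_, fun k => rfl⟩
  have key : ∀ p : ℕ, 0 ≤ (p * D : ℝ) / m - (p * D / m : ℕ) ∧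
      (p * D : ℝ) / m - (p * D / m : ℕ) ≤ 1 := by
    intro p
    have h1 := abs_div_sub_nat_le hm (p * D) 0
    simp only [Nat.cast_zero, sub_zero, Nat.zero_sub, Nat.zero_div, Nat.sub_zero] at h1
    have h2 : (((p * D / m : ℕ)) : ℝ) ≤ ((p * D : ℕ) : ℝ) / m := Nat.cast_div_le
    push_cast at h1 h2
    exact ⟨by linarith, (abs_le.1 h1).2⟩
  have e : (D : ℂ) * (((p - n : ℝ) + q * Complex.I) / m) =
      ⟨(p * D : ℝ) / m - (n * D : ℝ) / m, (q * D : ℝ) / m⟩ := by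
    have hm' : (m : ℂ) ≠ 0 := by exact_mod_cast hm.ne'
    apply Complex.ext
    · rw [← mul_div_assoc, Complex.div_natCast_re]; simp; ring
    · rw [← mul_div_assoc, Complex.div_natCast_im]; simp; ring
  have h1 := key p
  have h2 := key n
  have h3 := key q
  unfold Near
  rw [e]
  refine (norm_le_of_abs_le (a := 1) (b := 1) ?_ ?_).trans (by norm_num)
  · simp only [center, Complex.sub_re]
    rw [abs_le]
    constructor <;> linarith
  · simp only [center, Complex.sub_im, Nat.cast_zero, sub_zero]
    rw [abs_le]
    constructor <;> linarith

/-- The value of Horner's scheme. -/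
noncomputable def hornerVal (C : ℕ → ℝ) (Y : ℕ → ℂ) : ℕ → ℂ → ℂ
  | 0, x => x
  | m + 1, x => hornerVal C Y m (C m + Y m * x)

theorem hornerVal_eq (C : ℕ → ℝ) (Y : ℕ → ℂ) (K : ℕ) (x : ℂ) : hornerVal C Y K x =
    ∑ i ∈ Finset.range K, C i * ∏ j ∈ Finset.range i, Y j + (∏ j ∈ Finset.range K, Y j) * x := by
  induction K generalizing x with
  | zero => simp [hornerVal]
  | succ m ih =>
    rw [hornerVal, ih, Finset.sum_range_succ, Finset.prod_range_succ]
    ring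

theorem hornerK_spec {D : ℕ} (hD : 0 < D) {c : ℕ → ℕ} {y : ℕ → (Ball → R) → R} {C : ℕ → ℝ}
    {Y : ℕ → ℂ} (hC : ∀ m, |D * C m - c m| ≤ 1)
    (hy : ∀ m, ∃ B, Near D B (Y m) ∧ ∀ k, y m k = k B) (K : ℕ) {x : Ball} {X : ℂ}
    (hx : Near D x X) :
    ∃ B, Near D B (hornerVal C Y K X) ∧ ∀ k : Ball → R, hornerK D c y K x k = k B := by
  induction K generalizing x X with
  | zero => exact ⟨x, hx, fun k => rfl⟩
  | succ m ih =>
    obtain ⟨y', hy', hyk⟩ := hy m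
    obtain ⟨s, hs, hsk⟩ := mulAddK_spec (R := R) hD (hC m) hy' hx
    obtain ⟨B, hB, hBk⟩ := ih hs
    refine ⟨B, hB, fun k => ?_⟩
    rw [← hBk k]
    change y m (fun v => mulAddK D (c m) v x fun x => hornerK D c y m x k) = _
    rw [hyk, hsk]

theorem powK_spec {D : ℕ} (hD : 0 < D) {x : Ball} {X : ℂ} (hx : Near D x X) (f n : ℕ) :
    ∃ B, Near D B (X ^ (n % 2 ^ f)) ∧ ∀ k : Ball → R, powK D x f n k = k B := by
  induction f generalizing n with
  | zero =>
    refine ⟨⟨D, 0, 0, 0, 0⟩, ?_, fun k => rfl⟩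
    have : center ⟨D, 0, 0, 0, 0⟩ = D := by apply Complex.ext <;> simp [center]
    simp [Near, this, Nat.mod_one]
  | succ f ih =>
    obtain ⟨s, hs, hsk⟩ := ih (n / 2)
    obtain ⟨t, ht, htk⟩ := mulK_spec (R := R) hD hs hs
    have e : n % 2 ^ (f + 1) = 2 * (n / 2 % 2 ^ f) + n % 2 := by
      rw [pow_succ', Nat.mod_mul, add_comm]
    rw [e]
    have hstep : ∀ k : Ball → R, powK D x (f + 1) n k =
        cond (Nat.beq (n % 2) 0) (k t) (mulK D t x k) := by
      intro k
      change powK D x f (n / 2) (fun s => mulK D s s fun s =>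
        cond (Nat.beq (n % 2) 0) (k s) (mulK D s x k)) = _
      rw [hsk, htk]
    rcases Nat.mod_two_eq_zero_or_one n with h | h
    · refine ⟨t, ?_, fun k => by rw [hstep, h]; rfl⟩
      rw [h, add_zero, two_mul, pow_add]
      exact ht
    · obtain ⟨u, hu, huk⟩ := mulK_spec (R := R) hD ht hx
      refine ⟨u, ?_, fun k => by rw [hstep, h, ← huk k]; rfl⟩
      rw [h, two_mul, pow_add, pow_add, pow_one]
      exact hu

end Ball

end BallArithmetic

section LogTables

open Ball

variable {R : Type}

theorem nat_div_eq {m n : ℕ} : Nat.div m n = m / n := rfl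

theorem hasSum_artanh {w : ℂ} (hw : ‖w‖ < 1) : HasSum (fun k : ℕ => 4 * w * (w * w) ^ k / (2 * k + 1))
    (2 * Complex.log ((1 + w) / (1 - w))) := by
  have h := (Complex.hasSum_arctan (z := -w * Complex.I) (by simpa using hw)).mul_left
    (4 * Complex.I)
  have e1 : 1 + -w * Complex.I * Complex.I = 1 + w := by
    rw [mul_assoc, Complex.I_mul_I]; ring
  have e2 : 1 - -w * Complex.I * Complex.I = 1 - w := by
    rw [mul_assoc, Complex.I_mul_I]; ring
  rw [Complex.arctan, e1, e2] at h
  have e5 : 4 * Complex.I * (-Complex.I / 2 * Complex.log ((1 + w) / (1 - w))) =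
      2 * Complex.log ((1 + w) / (1 - w)) := by
    linear_combination (-2 * Complex.log ((1 + w) / (1 - w))) * Complex.I_sq
  rw [e5] at h
  refine h.congr_fun fun k => ?_
  · have e3 : (-w * Complex.I) ^ (2 * k + 1) = (-1) ^ k * (w * w) ^ k * (-w * Complex.I) := by
      rw [pow_succ, pow_mul, ← mul_pow]
      congr 2
      linear_combination w ^ 2 * Complex.I_sq
    have e4 : ((-1 : ℂ)) ^ k * (-1) ^ k = 1 := by
      rw [← mul_pow]; norm_num
    rw [e3]
    push_cast
    linear_combination (4 * w * (w * w) ^ k / (2 * k + 1)) * Complex.I_sq * ((-1) ^ k * (-1) ^ k) -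
      (4 * w * (w * w) ^ k / (2 * k + 1)) * e4

theorem norm_artanh_remainder_le {w : ℂ} (hw : ‖w‖ ≤ 1 / 3) (K : ℕ) :
    ‖2 * Complex.log ((1 + w) / (1 - w)) -
      4 * w * ∑ i ∈ Finset.range K, ((1 / (2 * i + 1) : ℝ) : ℂ) * (w * w) ^ i‖ ≤
      2 * (‖w‖ ^ 2) ^ K := by
  have h0 := norm_nonneg w
  have h2 : ‖w‖ ^ 2 ≤ 1 / 9 := by nlinarith
  have h := norm_sub_le_of_geometric_bound_of_hasSum (r := ‖w‖ ^ 2) (C := 4 / 3) (by linarith)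
    (f := fun k : ℕ => 4 * w * (w * w) ^ k / (2 * k + 1)) (fun k => ?_)
    (hasSum_artanh (by linarith)) K
  · rw [norm_sub_rev] at h
    have e : ∑ i ∈ Finset.range K, 4 * w * (w * w) ^ i / (2 * i + 1) =
        4 * w * ∑ i ∈ Finset.range K, ((1 / (2 * i + 1) : ℝ) : ℂ) * (w * w) ^ i := by
      rw [Finset.mul_sum]
      refine Finset.sum_congr rfl fun i _ => ?_
      push_cast
      ring
    rw [e] at h
    refine h.trans ?_
    rw [div_le_iff₀ (by linarith)]
    have : 0 ≤ (‖w‖ ^ 2) ^ K := by positivity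
    nlinarith
  · have e1 : ‖(2 * k + 1 : ℂ)‖ = 2 * k + 1 := by
      rw [show (2 * k + 1 : ℂ) = ((2 * k + 1 : ℕ) : ℂ) by push_cast; ring, Complex.norm_natCast]
      push_cast
      ring
    rw [norm_div, norm_mul, norm_mul, norm_pow, norm_mul, e1, ← pow_two, Complex.norm_ofNat]
    refine (div_le_self (by positivity) ?_).trans ?_
    · have : (0 : ℝ) ≤ k := by positivity
      linarith
    · gcongr
      linarith

theorem abs_mul_one_div_sub_le (D m : ℕ) (hm : 0 < m) : |D * (1 / m : ℝ) - (D / m : ℕ)| ≤ 1 := by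
  have h1 := abs_div_sub_nat_le hm D 0
  simp only [Nat.cast_zero, sub_zero, Nat.zero_sub, Nat.zero_div, Nat.sub_zero] at h1
  rwa [mul_one_div]

theorem artanhK_spec {D : ℕ} (hD : 0 < D) (K : ℕ) {s t : ℕ} (hst : 9 ≤ s * s + t * t) {x : Ball}
    {X : ℂ} (hx : Near D x X) {q : ℂ}
    (hq : q * (s - t * Complex.I - 1) = s - t * Complex.I + 1) :
    ∃ B, Near D B (X + 2 * Complex.log q) ∧ ∀ k : Ball → R, artanhK D K s t x k = k B := by
  set m : ℕ := s * s + t * t with hm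
  have hm0 : 0 < m := by omega
  have hmc : (m : ℂ) ≠ 0 := by exact_mod_cast hm0.ne'
  have hmr : (9 : ℝ) ≤ m := by exact_mod_cast hst
  set w : ℂ := (s + t * Complex.I) / m with hw
  have hmm : (m : ℂ) = (s + t * Complex.I) * (s - t * Complex.I) := by
    rw [hm]
    push_cast
    linear_combination (t : ℂ) ^ 2 * Complex.I_sq
  have hst0 : (s - t * Complex.I : ℂ) ≠ 0 := by
    intro h
    rw [hmm, h, mul_zero] at hmc
    exact hmc rfl
  have hst1 : (s + t * Complex.I : ℂ) ≠ 0 := by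
    intro h
    rw [hmm, h, zero_mul] at hmc
    exact hmc rfl
  have hws : w * (s - t * Complex.I) = 1 := by
    rw [hw, hmm]; field_simp
  have hwn : ‖w‖ ^ 2 = 1 / m := by
    rw [hw, norm_div, Complex.norm_natCast, div_pow, Complex.sq_norm, Complex.normSq_apply]
    have : ((s : ℂ) + t * Complex.I).re * ((s : ℂ) + t * Complex.I).re +
        ((s : ℂ) + t * Complex.I).im * ((s : ℂ) + t * Complex.I).im = m := by
      simp [hm]
    rw [this]
    field_simp
  have hw3 : ‖w‖ ≤ 1 / 3 := by
    have : ‖w‖ ^ 2 ≤ (1 / 3) ^ 2 := by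
      rw [hwn, one_div_pow]
      exact one_div_le_one_div_of_le (by norm_num) (by linarith)
    exact (sq_le_sq₀ (norm_nonneg _) (by norm_num)).1 this
  have hq' : (1 + w) / (1 - w) = q := by
    have h1 : 1 - w ≠ 0 := by
      intro h
      have h2 : w = 1 := by linear_combination -h
      rw [h2, norm_one] at hw3
      norm_num at hw3
    rw [div_eq_iff h1]
    have h3 : (q * (1 - w)) * (s - t * Complex.I) = (1 + w) * (s - t * Complex.I) := by
      linear_combination hq - (q + 1) * hws
    exact (mul_right_cancel₀ hst0 h3).symm
  obtain ⟨w1, hw1, hw1k⟩ := ratK_spec (R := R) (D := D) (p := s) (n := 0) (q := t) hm0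
  have ew : ((s - (0 : ℕ) : ℝ) + t * Complex.I : ℂ) / m = w := by simp [hw]
  rw [ew] at hw1
  obtain ⟨u, hu, huk⟩ := mulK_spec (R := R) hD hw1 hw1
  obtain ⟨y, hy, hyk⟩ := hornerK_spec (R := R) hD (c := fun i => D / (2 * i + 1))
    (C := fun i => 1 / (2 * i + 1)) (y := fun _ k => k u) (Y := fun _ => w * w)
    (fun i => by simpa using abs_mul_one_div_sub_le D (2 * i + 1) (by omega))
    (fun _ => ⟨u, hu, fun _ => rfl⟩) K (near_zero D)
  rw [hornerVal_eq, mul_zero, add_zero] at hy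
  simp only [Finset.prod_const, Finset.card_range] at hy
  obtain ⟨w4, hw4, hw4k⟩ := ratK_spec (R := R) (D := D) (p := 4 * s) (n := 0) (q := 4 * t) hm0
  have ew4 : (((4 * s : ℕ) - (0 : ℕ) : ℝ) + (4 * t : ℕ) * Complex.I : ℂ) / m = 4 * w := by
    rw [hw]; push_cast; ring
  rw [ew4] at hw4
  obtain ⟨v, hv, hvk⟩ := mulK_spec (R := R) hD hw4 hy
  set Z := 2 * Complex.log ((1 + w) / (1 - w)) -
      4 * w * ∑ i ∈ Finset.range K, ((1 / (2 * i + 1) : ℝ) : ℂ) * (w * w) ^ i with hZ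
  have hZn : D * ‖Z‖ ≤ (2 * D / m ^ K + 1 : ℕ) := by
    have h1 := norm_artanh_remainder_le hw3 K
    rw [← hZ, hwn, one_div_pow] at h1
    have h2 := abs_mul_one_div_sub_le (2 * D) (m ^ K) (by positivity)
    have h3 := (abs_le.1 h2).2
    push_cast at h3 ⊢
    have hD' : (0 : ℝ) ≤ D := by positivity
    nlinarith
  obtain ⟨B, hB, hBk⟩ := addK_spec (R := R) hx hv hZn
  refine ⟨B, ?_, fun k => ?_⟩
  · have e : X + 2 * Complex.log q = X + 4 * w *
        ∑ i ∈ Finset.range K, ((1 / (2 * i + 1) : ℝ) : ℂ) * (w * w) ^ i + Z := by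
      rw [hZ, hq']; ring
    rw [e]
    exact hB
  · rw [artanhK, force_eq]
    simp only [Nat.add_eq, Nat.mul_eq, nat_div_eq, Nat.pow_eq]
    rw [← hm, hw1k, huk, hyk, hw4k, hvk, hBk]

theorem logNatK_spec {D : ℕ} (hD : 0 < D) (K s : ℕ) :
    ∃ B, Near D B (2 * Complex.log (s + 1)) ∧ ∀ k : Ball → R, logNatK D K s k = k B := by
  induction s with
  | zero => exact ⟨zero, by simpa using near_zero D, fun k => rfl⟩
  | succ i ih =>
    obtain ⟨x, hx, hxk⟩ := ih
    have hi : ((i : ℂ) + 1) ≠ 0 := by exact_mod_cast Nat.succ_ne_zero i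
    obtain ⟨B, hB, hBk⟩ := artanhK_spec (R := R) hD K (s := 2 * i + 3) (t := 0) (by nlinarith) hx
      (q := (((i + 2 : ℝ) / (i + 1) : ℝ) : ℂ)) (by push_cast; field_simp; ring)
    refine ⟨B, ?_, fun k => ?_⟩
    · convert hB using 1
      rw [← Complex.ofReal_log (by positivity)]
      have e1 : (i : ℂ) + 1 = ((i + 1 : ℝ) : ℂ) := by push_cast; ring
      have e2 : ((i + 1 : ℕ) : ℂ) + 1 = ((i + 2 : ℝ) : ℂ) := by push_cast; ring
      rw [e1, e2, ← Complex.ofReal_log (by positivity), ← Complex.ofReal_log (by positivity),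
        Real.log_div (by positivity) (by positivity)]
      push_cast
      ring
    · rw [← hBk k]
      change logNatK D K i (fun x => artanhK D K (2 * i + 3) 0 x k) = _
      rw [hxk]

theorem log_vline_add {σ τ δ : ℝ} (hσ : 0 < σ) (hτ : 0 ≤ τ) (hδ : 0 ≤ δ) :
    Complex.log (vline σ (τ + δ)) =
      Complex.log (vline σ τ) + Complex.log (vline σ (τ + δ) / vline σ τ) := by
  have h0 := vline_ne_zero hσ τ
  have h1 := vline_ne_zero hσ (τ + δ)
  have h2 : vline σ τ * (vline σ (τ + δ) / vline σ τ) = vline σ (τ + δ) := mul_div_cancel₀ _ h0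
  rw [← Complex.log_mul h0 (div_ne_zero h1 h0), h2]
  have a1 : |(vline σ τ).arg| < Real.pi / 2 :=
    Complex.abs_arg_lt_pi_div_two_iff.2 (Or.inl (by simpa using hσ))
  have a2 : |(vline σ (τ + δ) / vline σ τ).arg| < Real.pi / 2 := by
    refine Complex.abs_arg_lt_pi_div_two_iff.2 (Or.inl ?_)
    rw [Complex.div_re, vline_re, vline_re, vline_im, vline_im]
    have : 0 < Complex.normSq (vline σ τ) := Complex.normSq_pos.2 h0
    positivity
  have b1 := abs_lt.1 a1
  have b2 := abs_lt.1 a2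
  exact ⟨by linarith [b1.1, b2.1], by linarith [b1.2, b2.2]⟩

theorem artanhK_vline_spec {D : ℕ} (hD : 0 < D) (K : ℕ) {σ : ℕ} (hσ : 1 ≤ σ) (i : ℕ) {x : Ball}
    (hx : Near D x (2 * Complex.log (vline σ (i / 4)))) :
    ∃ B, Near D B (2 * Complex.log (vline σ ((i + 1 : ℕ) / 4))) ∧
      ∀ k : Ball → R, artanhK D K (2 * i + 1) (8 * σ) x k = k B := by
  have hσ0 : (0 : ℝ) < σ := by exact_mod_cast hσ
  have h0 := vline_ne_zero hσ0 (i / 4 : ℝ)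
  have e : ((i + 1 : ℕ) / 4 : ℝ) = i / 4 + 1 / 4 := by push_cast; ring
  have hlog := log_vline_add hσ0 (τ := i / 4) (δ := 1 / 4) (by positivity) (by norm_num)
  rw [e, hlog, mul_add]
  refine artanhK_spec hD K (by nlinarith) hx ?_
  rw [div_mul_eq_mul_div, div_eq_iff h0]
  simp only [vline]
  push_cast
  linear_combination (-2 * σ : ℂ) * Complex.I_sq

theorem walkK_spec {S : Type} {D : ℕ} (hD : 0 < D) (K : ℕ) {σ : ℕ} (hσ : 1 ≤ σ)
    {f : ℕ → Ball → S → (S → S) → S} {Inv : ℕ → S → Prop}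
    (hf : ∀ (i : ℕ) x s, Near D x (2 * Complex.log (vline σ (i / 4))) → Inv i s →
      ∃ s', Inv (i + 1) s' ∧ ∀ k, f i x s k = k s')
    (N i : ℕ) {x : Ball} (hx : Near D x (2 * Complex.log (vline σ (i / 4)))) {s : S}
    (hs : Inv i s) : Inv (i + N) (walkK D K σ f N i x s) := by
  induction N generalizing i x s with
  | zero => exact hs
  | succ N ih =>
    obtain ⟨s', hs', hk⟩ := hf i x s hx hs
    obtain ⟨B, hB, hBk⟩ := artanhK_vline_spec (R := S) hD K hσ i hx
    have e : walkK D K σ f (N + 1) i x s = walkK D K σ f N (i + 1) B s' := by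
      change f i x s (fun s => artanhK D K (2 * i + 1) (8 * σ) x fun x =>
        walkK D K σ f N (i + 1) x s) = _
      rw [hk, hBk]
    rw [e, ← add_assoc, add_right_comm]
    exact ih (i + 1) hB hs'

theorem lineWalkK_spec {S : Type} {D : ℕ} (hD : 0 < D) (K₀ K : ℕ) {σ : ℕ} (hσ : 1 ≤ σ)
    {f : ℕ → Ball → S → (S → S) → S} {Inv : ℕ → S → Prop}
    (hf : ∀ (i : ℕ) x s, Near D x (2 * Complex.log (vline σ (i / 4))) → Inv i s →
      ∃ s', Inv (i + 1) s' ∧ ∀ k, f i x s k = k s')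
    (N : ℕ) {s : S} (hs : Inv 0 s) : Inv N (lineWalkK D K₀ K σ f N s) := by
  obtain ⟨B, hB, hBk⟩ := logNatK_spec (R := S) hD K₀ (σ - 1)
  have e : ((σ - 1 : ℕ) : ℂ) + 1 = vline σ ((0 : ℕ) / 4) := by
    rw [Nat.cast_sub hσ]; simp [vline]
  rw [e] at hB
  have := walkK_spec hD K hσ hf N 0 hB hs
  rw [zero_add] at this
  rwa [lineWalkK, hBk]

end LogTables

section GridUpper

open Ball

variable {R : Type}

theorem le_nat_div_add_one {x : ℝ} {a b : ℕ} (hb : 0 < b) (h : x ≤ (a : ℝ) / b) :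
    x ≤ (a / b + 1 : ℕ) := by
  have h1 := abs_div_sub_nat_le hb a 0
  simp only [Nat.cast_zero, sub_zero, Nat.zero_sub, Nat.zero_div, Nat.sub_zero] at h1
  push_cast
  linarith [(abs_le.1 h1).2]

theorem sqUpperK_spec {D : ℕ} (hD : 0 < D) {x : Ball} {X : ℂ} (hx : Near D x X) :
    ∃ v : ℕ, D * ‖X‖ ^ 2 ≤ v ∧ ∀ k : ℕ → R, sqUpperK D x k = k v := by
  have hD' : (0 : ℝ) < D := by exact_mod_cast hD
  obtain ⟨a, b, c, d, r⟩ := x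
  refine ⟨_, ?_, fun k => rfl⟩
  refine le_nat_div_add_one hD ?_
  rw [le_div_iff₀ hD']
  have h1 := norm_center_le ⟨a, b, c, d, r⟩
  have h2 : D * ‖X‖ ≤ ‖center ⟨a, b, c, d, r⟩‖ + r := by
    have h3 := norm_sub_norm_le ((D : ℂ) * X) (center ⟨a, b, c, d, r⟩)
    rw [norm_mul, Complex.norm_natCast] at h3
    have h4 : ‖(D : ℂ) * X - center ⟨a, b, c, d, r⟩‖ ≤ r := hx
    linarith
  have h5 : ‖center ⟨a, b, c, d, r⟩‖ ^ 2 ≤ a ^ 2 + b ^ 2 + c ^ 2 + d ^ 2 := by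
    rw [Complex.sq_norm, Complex.normSq_apply]
    simp only [center]
    have : (0 : ℝ) ≤ a * b := by positivity
    have : (0 : ℝ) ≤ c * d := by positivity
    nlinarith
  have h6 : (D * ‖X‖) ^ 2 ≤ (‖center ⟨a, b, c, d, r⟩‖ + r) ^ 2 := by gcongr
  simp only [Nat.add_eq, Nat.mul_eq]
  push_cast at h1 ⊢
  have h7 : ‖center ⟨a, b, c, d, r⟩‖ * r ≤ (a + b + c + d) * r := by gcongr
  nlinarith

theorem gridUpper_spec {D D' : ℕ} (hD' : 0 < D') (κ σ c h s i : ℕ) {v : ℕ} {A : ℝ}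
    (hv : D' * A ^ 2 ≤ v) :
    D * (Real.exp κ * (Real.exp (σ ^ 2 - (i / 4 : ℝ) ^ 2) *
      (4 * ‖vline σ ((i + s : ℕ) / 4)‖) ^ (2 * c + 1) * A ^ (2 * h))) ≤
      gridUpper D D' κ σ c h s (i + s) v := by
  have hD0 : (0 : ℝ) < D' := by exact_mod_cast hD'
  rw [gridUpper, Nat.add_sub_cancel]
  refine le_nat_div_add_one (by positivity) ?_
  have hA : A ^ (2 * h) ≤ (v : ℝ) ^ h / (D' : ℝ) ^ h := by
    rw [pow_mul, ← div_pow]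
    gcongr
    rwa [le_div_iff₀' hD0]
  have he1 : Real.exp κ * Real.exp (σ ^ 2) ≤ (27183 : ℝ) ^ (κ + σ * σ) / 10000 ^ (κ + σ * σ) := by
    have e : Real.exp κ * Real.exp (σ ^ 2) = Real.exp 1 ^ (κ + σ * σ) := by
      rw [← Real.exp_nat_mul, ← Real.exp_add]
      push_cast
      ring_nf
    rw [e, ← div_pow]
    gcongr
    have := Real.exp_one_lt_d9
    linarith
  have he2 : Real.exp (-(i / 4 : ℝ) ^ 2) ≤ (10000 : ℝ) ^ (i * i / 16) / 27182 ^ (i * i / 16) := by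
    have h1 : ((i * i / 16 : ℕ) : ℝ) ≤ (i / 4 : ℝ) ^ 2 := by
      refine Nat.cast_div_le.trans (le_of_eq ?_)
      push_cast
      ring
    calc Real.exp (-(i / 4 : ℝ) ^ 2) ≤ Real.exp (-((i * i / 16 : ℕ) : ℝ)) := by
          rw [Real.exp_le_exp]; linarith
      _ = (1 / Real.exp 1) ^ (i * i / 16) := by
          rw [Real.exp_neg, one_div, inv_pow, ← Real.exp_nat_mul, mul_one]
      _ ≤ (10000 / 27182) ^ (i * i / 16) := by
          have h2 : 1 / Real.exp 1 ≤ 10000 / 27182 := by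
            rw [div_le_div_iff₀ (Real.exp_pos 1) (by norm_num)]
            linarith [Real.exp_one_gt_d9]
          exact pow_le_pow_left₀ (by positivity) h2 _
      _ = _ := div_pow _ _ _
  have hz : 4 * ‖vline σ ((i + s : ℕ) / 4)‖ ≤ 4 * σ + (i + s : ℕ) := by
    have := norm_le_of_abs_le (z := vline σ ((i + s : ℕ) / 4)) (a := σ) (b := (i + s : ℕ) / 4)
      (by simp) (by rw [vline_im, abs_of_nonneg (by positivity)])
    linarith
  have hz2 : (4 * ‖vline σ ((i + s : ℕ) / 4)‖) ^ 2 = 16 * (σ * σ) + (i + s : ℕ) * (i + s : ℕ) := by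
    rw [mul_pow, norm_vline_sq]; ring
  rw [pow_succ (4 * ‖vline σ ((i + s : ℕ) / 4)‖), pow_mul, hz2, sub_eq_add_neg, Real.exp_add]
  push_cast at hz ⊢
  calc _ = D * ((Real.exp κ * Real.exp (σ ^ 2)) * Real.exp (-(i / 4 : ℝ) ^ 2) *
      ((16 * (σ * σ) + (i + s) * (i + s)) ^ c * (4 * ‖vline σ ((i + s) / 4)‖)) * A ^ (2 * h)) := by
        ring
    _ ≤ D * ((27183 : ℝ) ^ (κ + σ * σ) / 10000 ^ (κ + σ * σ) *
        ((10000 : ℝ) ^ (i * i / 16) / 27182 ^ (i * i / 16)) *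
        ((16 * (σ * σ) + (i + s) * (i + s)) ^ c * (4 * σ + (i + s))) *
        ((v : ℝ) ^ h / (D' : ℝ) ^ h)) := by
        have : 0 ≤ A ^ (2 * h) := by rw [pow_mul]; positivity
        gcongr
    _ = _ := by
        field_simp

theorem pow_le_add_pow {A : ℝ} (hA : 0 ≤ A) {a n b : ℕ} (h1 : a ≤ n) (h2 : n ≤ b) :
    A ^ n ≤ A ^ a + A ^ b := by
  rcases le_total A 1 with h | h
  · have := pow_le_pow_of_le_one hA h h1
    have : 0 ≤ A ^ b := by positivity
    linarith
  · have := pow_le_pow_right₀ h h2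
    have : 0 ≤ A ^ a := by positivity
    linarith

theorem inWindow_iff {j₀ j₁ i : ℕ} : inWindow j₀ j₁ i = true ↔ j₀ ≤ i ∧ i < j₁ := by
  rw [inWindow, Bool.and_eq_true, Nat.ble_eq, Nat.blt, Nat.ble_eq]
  exact Iff.rfl

theorem gridActive_iff {s j₀ j₁ i : ℕ} :
    gridActive s j₀ j₁ i = true ↔ s ≤ i ∧ i ≤ 160 + s ∧ ¬ (j₀ ≤ i ∧ i < j₁) := by
  rw [gridActive, Bool.and_eq_true, Bool.and_eq_true, Nat.ble_eq, Nat.ble_eq, ← inWindow_iff,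
    Bool.not_eq_true, Bool.not_eq_true']

/-- The multiplicity of a term in `gridSum`. -/
def gridCoeff (s i : ℕ) : ℕ := if i = 160 + s then 2 else 1

theorem gridSumUpper_spec {D D' : ℕ} (hD' : 0 < D') (κ : ℕ) {σ : ℕ} (hσ : 1 ≤ σ)
    (c s j₀ j₁ : ℕ) {h₁ h₂ n : ℕ} (hn₁ : 2 * h₁ ≤ n) (hn₂ : n ≤ 2 * h₂) {g : Ball} {μ : ℝ}
    (hμ : 0 ≤ μ) (hg : Near D' g μ) :
    D * (Real.exp κ * μ ^ n * ∑ i ∈ (Finset.range 162).filter (gridActive s j₀ j₁ · = true),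
      gridCoeff s i * gridTerm σ (2 * c + 1) n s (i - s)) ≤
      gridSumUpper D D' κ σ c h₁ h₂ s j₀ j₁ g := by
  refine lineWalkK_spec hD' 30 6 hσ (f := gridStepK D D' κ σ c h₁ h₂ s j₀ j₁ g)
    (Inv := fun N S : ℕ => D * (Real.exp κ * μ ^ n *
    ∑ i ∈ (Finset.range N).filter (gridActive s j₀ j₁ · = true),
      gridCoeff s i * gridTerm σ (2 * c + 1) n s (i - s)) ≤ (S : ℝ)) ?_ 162 (s := 0) (by simp)
  intro i x S hx hS
  rw [Finset.range_add_one, Finset.filter_insert]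
  rcases hact : gridActive s j₀ j₁ i with _ | _
  · refine ⟨S, by simpa using hS, fun k => ?_⟩
    rw [gridStepK, hact]
    rfl
  · obtain ⟨y, hy, hyk⟩ := mulK_spec (R := ℕ) hD' hx hg
    obtain ⟨v, hv, hvk⟩ := sqUpperK_spec (R := ℕ) hD' hy
    set u := gridUpper D D' κ σ c h₁ s i v + gridUpper D D' κ σ c h₂ s i v with hu
    refine ⟨S + cond (Nat.beq i (160 + s)) (2 * u) u, ?_, fun k => ?_⟩
    · rw [if_pos rfl, Finset.sum_insert (by simp), mul_add, mul_add, add_comm]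
      have hsi : s ≤ i := by
        rw [gridActive, Bool.and_eq_true] at hact
        exact Nat.le_of_ble_eq_true hact.1
      obtain ⟨i', rfl⟩ := Nat.exists_eq_add_of_le' hsi
      have hA : ‖2 * Complex.log (vline σ ((i' + s : ℕ) / 4)) * μ‖ =
          logAbs σ ((i' + s : ℕ) / 4) * μ := by
        rw [norm_mul, Complex.norm_real, Real.norm_of_nonneg hμ, logAbs]
      rw [hA] at hv
      set A := logAbs σ ((i' + s : ℕ) / 4) * μ with hAdef
      have hA0 : 0 ≤ A := mul_nonneg (logAbs_nonneg _ _) hμ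
      have b1 := gridUpper_spec (D := D) hD' κ σ c h₁ s i' hv
      have b2 := gridUpper_spec (D := D) hD' κ σ c h₂ s i' hv
      have hp := pow_le_add_pow hA0 hn₁ hn₂
      have hterm : D * (Real.exp κ * μ ^ n * gridTerm σ (2 * c + 1) n s i') ≤ u := by
        rw [hu]
        push_cast
        refine le_trans ?_ (add_le_add b1 b2)
        rw [gridTerm]
        have e : A ^ n = logAbs σ ((i' + s : ℕ) / 4) ^ n * μ ^ n := mul_pow _ _ _
        calc _ = D * (Real.exp κ * (Real.exp (σ ^ 2 - (i' / 4 : ℝ) ^ 2) *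
                (4 * ‖vline σ ((i' + s : ℕ) / 4)‖) ^ (2 * c + 1) * A ^ n)) := by
              rw [e]; ring
          _ ≤ D * (Real.exp κ * (Real.exp (σ ^ 2 - (i' / 4 : ℝ) ^ 2) *
                (4 * ‖vline σ ((i' + s : ℕ) / 4)‖) ^ (2 * c + 1) *
                (A ^ (2 * h₁) + A ^ (2 * h₂)))) := by gcongr
          _ = _ := by ring
      push_cast
      refine add_le_add hS ?_
      rw [Nat.add_sub_cancel, gridCoeff]
      by_cases h160 : i' + s = 160 + s
      · rw [if_pos h160, h160, Nat.beq_refl, cond_true]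
        push_cast
        linarith
      · have hb : Nat.beq (i' + s) (160 + s) = false := by
          exact Bool.eq_false_iff.2 fun h => h160 (Nat.eq_of_beq_eq_true h)
        rw [if_neg h160, hb, cond_false]
        push_cast
        linarith
    · rw [gridStepK, hact, cond_true, hyk, hvk, force_eq, force_eq]

theorem gridSum_le {D D' : ℕ} (hD' : 0 < D') (κ : ℕ) {σ : ℕ} (hσ : 1 ≤ σ) (c : ℕ) {h₁ h₂ n : ℕ}
    (hn₁ : 2 * h₁ ≤ n) (hn₂ : n ≤ 2 * h₂) {g : Ball} {μ : ℝ} (hμ : 0 ≤ μ) (hg : Near D' g μ) :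
    D * (Real.exp κ * μ ^ n * gridSum σ (2 * c + 1) n 1) ≤
      gridSumUpper D D' κ σ c h₁ h₂ 1 0 0 g := by
  refine le_of_eq_of_le ?_ (gridSumUpper_spec (D := D) hD' κ hσ c 1 0 0 hn₁ hn₂ hμ hg)
  have e : (Finset.range 162).filter (gridActive 1 0 0 · = true) =
      (Finset.range 161).image (· + 1) := by
    ext i
    rw [Finset.mem_filter, gridActive_iff, Finset.mem_image, Finset.mem_range]
    constructor
    · intro h
      exact ⟨i - 1, Finset.mem_range.2 (by omega), by omega⟩
    · rintro ⟨k, hk, rfl⟩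
      rw [Finset.mem_range] at hk
      omega
  rw [e, Finset.sum_image (by simp), Finset.sum_range_succ, gridSum]
  congr 3
  refine Finset.sum_congr rfl fun i hi => ?_
  have : i ≠ 160 := (Finset.mem_range.1 hi).ne
  simp [gridCoeff, this]

theorem gridSum_omitted_le {D D' : ℕ} (hD' : 0 < D') (κ : ℕ) {σ : ℕ} (hσ : 1 ≤ σ) {j₀ j₁ : ℕ}
    (hj : j₁ ≤ 160) {h₁ h₂ n : ℕ} (hn₁ : 2 * h₁ ≤ n) (hn₂ : n ≤ 2 * h₂) {g : Ball} {μ : ℝ}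
    (hμ : 0 ≤ μ) (hg : Near D' g μ) :
    D * (Real.exp κ * μ ^ n * (∑ i ∈ Finset.range 160 \ Finset.Ico j₀ j₁, gridTerm σ 1 n 0 i +
      2 * gridTerm σ 1 n 0 160)) ≤ gridSumUpper D D' κ σ 0 h₁ h₂ 0 j₀ j₁ g := by
  refine le_of_eq_of_le ?_ (gridSumUpper_spec (D := D) hD' κ hσ 0 0 j₀ j₁ hn₁ hn₂ hμ hg)
  have e : (Finset.range 162).filter (gridActive 0 j₀ j₁ · = true) =
      insert 160 (Finset.range 160 \ Finset.Ico j₀ j₁) := by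
    ext i
    rw [Finset.mem_filter, gridActive_iff, Finset.mem_insert, Finset.mem_sdiff, Finset.mem_range,
      Finset.mem_range, Finset.mem_Ico]
    omega
  rw [e, Finset.sum_insert (by simp), add_comm]
  congr 3
  refine Finset.sum_congr rfl fun i hi => ?_
  rw [Finset.mem_sdiff, Finset.mem_range] at hi
  have : i ≠ 160 := by omega
  simp [gridCoeff, this]

end GridUpper

section Nodes

open Ball

variable {R : Type}

/-- The node `v` contains the value `Y` and the factor `Λ`. -/
def Node.Valid (D : ℕ) (v : Node) (Y Λ : ℂ) : Prop :=
  Near D ⟨v.a, v.b, v.c, v.d, v.r⟩ Y ∧ ‖(D : ℂ) * Λ - (⟨v.x, v.y⟩ : ℂ)‖ ≤ v.e ∧ D * ‖Λ‖ ≤ v.g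

theorem nat_div_le_add_one {D : ℕ} (hD : 0 < D) (S : ℕ) : (S : ℝ) / D ≤ (S / D : ℕ) + 1 := by
  have := abs_div_sub_nat_le hD S 0
  simp only [Nat.cast_zero, sub_zero, Nat.zero_sub, Nat.zero_div, Nat.sub_zero] at this
  linarith [(abs_le.1 this).2]

theorem Node.Valid.step {D : ℕ} (hD : 0 < D) {a b c d r x y e g : ℕ} {Y Λ : ℂ}
    (h : Node.Valid D ⟨a, b, c, d, r, x, y, e, g⟩ Y Λ) :
    ∃ w : Ball, Node.Valid D ⟨w.a, w.b, w.c, w.d, w.r, x, y, e, g⟩ (Y * Λ) Λ ∧ ∀ k : Ball → R,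
      divK D (a * x + d * y) (b * x + c * y) (a * y + c * x) (b * y + d * x)
        ((r * g + (a + b + c + d) * e) / D + 4) k = k w := by
  have hD' : (0 : ℝ) < D := by exact_mod_cast hD
  have hDc : (D : ℂ) ≠ 0 := by exact_mod_cast hD.ne'
  obtain ⟨h1, h2, h3⟩ := h
  dsimp only at h1 h2 h3
  have hyc := norm_center_le ⟨a, b, c, d, r⟩
  dsimp only at hyc
  have hS := nat_div_le_add_one hD (r * g + (a + b + c + d) * e)
  set S := r * g + (a + b + c + d) * e with hSdef
  have key : ‖(D : ℂ) * (Y * Λ) - (⟨(a * x + d * y : ℕ) - (b * x + c * y : ℕ),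
      (a * y + c * x : ℕ) - (b * y + d * x : ℕ)⟩ : ℂ) / D‖ + 2 ≤ (S / D + 4 : ℕ) := by
    have hz : (⟨(a * x + d * y : ℕ) - (b * x + c * y : ℕ),
      (a * y + c * x : ℕ) - (b * y + d * x : ℕ)⟩ : ℂ) = center ⟨a, b, c, d, r⟩ * ⟨x, y⟩ := by
      apply Complex.ext <;> simp [center] <;> ring
    rw [hz]
    set U := center ⟨a, b, c, d, r⟩
    set L : ℂ := ⟨x, y⟩
    have he : (D : ℂ) * (Y * Λ) - U * L / D = (D * Y - U) * Λ + U * (D * Λ - L) / D := by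
      field_simp
      ring
    have b1 : ‖(D * Y - U) * Λ‖ ≤ r * ((g : ℝ) / D) := by
      rw [norm_mul]
      have h4 : ‖Λ‖ ≤ (g : ℝ) / D := by rwa [le_div_iff₀' hD']
      exact mul_le_mul h1 h4 (norm_nonneg _) (by positivity)
    have b2 : ‖U * (D * Λ - L) / D‖ ≤ ((a + b + c + d : ℕ) : ℝ) * e / D := by
      rw [norm_div, norm_mul, Complex.norm_natCast]
      gcongr
    have e4 : r * ((g : ℝ) / D) + ((a + b + c + d : ℕ) : ℝ) * e / D = (S : ℝ) / D := by
      rw [hSdef]; push_cast; field_simp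
    rw [he]
    have := norm_add_le ((D * Y - U) * Λ) (U * (D * Λ - L) / D)
    rw [Nat.cast_add, Nat.cast_ofNat]
    linarith
  obtain ⟨w, hw, hwk⟩ := divK_spec (R := R) hD key
  exact ⟨w, ⟨hw, h2, h3⟩, hwk⟩

theorem Ball.Near.abs_re_sub_le {D a b c d r : ℕ} {Y : ℂ} (h : Near D ⟨a, b, c, d, r⟩ Y) :
    |D * Y.re - (a - b)| ≤ r := by
  have h1 := (Complex.abs_re_le_norm _).trans h
  simpa [center] using h1

theorem advanceK_spec {D : ℕ} (hD : 0 < D) {Y Λ : ℕ → ℂ} {l : List Node} {js : List ℕ}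
    (h : List.Forall₂ (fun v j => Node.Valid D v (Y j) (Λ j)) l js) (p n r : ℕ) :
    ∃ (l' : List Node) (p' n' r' : ℕ), List.Forall₂ (fun v j => Node.Valid D v (Y j * Λ j) (Λ j)) l' js ∧
      |D * (js.map fun j => (Y j).re).sum - (((p' : ℝ) - n') - (p - n))| ≤ (r' : ℝ) - r ∧
      ∀ k : List Node → ℕ → ℕ → ℕ → R, advanceK D l p n r k = k l' p' n' r' := by
  induction h generalizing p n r with
  | nil => exact ⟨[], p, n, r, List.Forall₂.nil, by simp, fun k => rfl⟩
  | @cons v j l js hv _ ih =>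
    obtain ⟨a, b, c, d, rad, x, y, e, g⟩ := v
    obtain ⟨w, hw, hwk⟩ := hv.step (R := R) hD
    obtain ⟨l', p', n', r', hl, hs, hk⟩ := ih (p + a) (n + b) (r + rad)
    refine ⟨⟨w.a, w.b, w.c, w.d, w.r, x, y, e, g⟩ :: l', p', n', r', List.Forall₂.cons hw hl, ?_,
      fun k => ?_⟩
    · have h1 := abs_le.1 hv.1.abs_re_sub_le
      have h2 := abs_le.1 hs
      push_cast at h2
      rw [List.map_cons, List.sum_cons, mul_add, abs_le]
      constructor <;> linarith [h1.1, h1.2, h2.1, h2.2]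
    · have h1 := hk fun l p n r => k (⟨w.a, w.b, w.c, w.d, w.r, x, y, e, g⟩ :: l) p n r
      rw [← h1]
      change divK D (a * x + d * y) (b * x + c * y) (a * y + c * x) (b * y + d * x)
        ((rad * g + (a + b + c + d) * e) / D + 4) (fun w => advanceK D l (p + a) (n + b) (r + rad)
          fun l p n r => k (⟨w.a, w.b, w.c, w.d, w.r, x, y, e, g⟩ :: l) p n r) = _
      rw [hwk]

/-- The list `l`, in descending order and ending with the index `n₁`, contains upper and lower bounds
for `D * s n`. -/
def DescBounds (D n₁ : ℕ) (s : ℕ → ℝ) : List (ℕ × ℕ) → Prop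
  | [] => True
  | v :: l => ((v.2 : ℝ) ≤ D * s (n₁ + l.length) ∧ D * s (n₁ + l.length) ≤ v.1) ∧ DescBounds D n₁ s l

theorem cast_sub_add_cast_sub (p n : ℕ) : ((p - n + (n - p) : ℕ) : ℝ) = |(p : ℝ) - n| := by
  rcases le_total n p with h | h
  · rw [Nat.sub_eq_zero_of_le h, add_zero, Nat.cast_sub h, abs_of_nonneg]
    have : (n : ℝ) ≤ p := by exact_mod_cast h
    linarith
  · rw [Nat.sub_eq_zero_of_le h, zero_add, Nat.cast_sub h, abs_sub_comm, abs_of_nonneg]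
    have : (p : ℝ) ≤ n := by exact_mod_cast h
    linarith

theorem boundsK_spec {D : ℕ} (hD : 0 < D) {Y Λ : ℕ → ℂ} {js : List ℕ} {E n₁ M : ℕ} {s : ℕ → ℝ}
    (hs₀ : ∀ n, 0 ≤ s n) (hs : ∀ k < M, D * |s (n₁ + k) - abs ((js.map fun j => (Y j * Λ j ^ k).re).sum)| ≤ E)
    (m : ℕ) {l : List Node} {acc : List (ℕ × ℕ)} (hM : acc.length + m ≤ M)
    (hl : List.Forall₂ (fun v j => Node.Valid D v (Y j * Λ j ^ acc.length) (Λ j)) l js)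
    (hacc : DescBounds D n₁ s acc) :
    ∃ acc', acc'.length = acc.length + m ∧ DescBounds D n₁ s acc' ∧
      ∀ k : List (ℕ × ℕ) → R, boundsK D E m l acc k = k acc' := by
  induction m generalizing l acc with
  | zero => exact ⟨acc, rfl, hacc, fun k => rfl⟩
  | succ m ih =>
    obtain ⟨l', p', n', r', hl', hsum, hk⟩ := advanceK_spec (R := R) hD hl 0 0 0
    set S := p' - n' + (n' - p') with hS
    have hSr := cast_sub_add_cast_sub p' n'
    rw [← hS] at hSr
    have hD' : (0 : ℝ) ≤ D := by positivity
    have h1 := hs acc.length (by omega)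
    set T := (js.map fun j => (Y j * Λ j ^ acc.length).re).sum
    have h2 : |D * abs T - abs ((p' : ℝ) - n')| ≤ r' := by
      have e : D * |T| = |D * T| := by rw [abs_mul, Nat.abs_cast]
      rw [e]
      refine (abs_abs_sub_abs_le _ _).trans ?_
      simpa using hsum
    have h3 : |D * s (n₁ + acc.length) - D * abs T| ≤ E := by
      rwa [← mul_sub, abs_mul, Nat.abs_cast]
    have h4 := abs_le.1 h2
    have h5 := abs_le.1 h3
    have hs0 : D * s (n₁ + acc.length) ≤ (S + (r' + E) : ℕ) := by
      push_cast
      linarith [h4.1, h4.2, h5.1, h5.2]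
    have hlow : ((S - (r' + E) : ℕ) : ℝ) ≤ D * s (n₁ + acc.length) := by
      have h6 := mul_nonneg hD' (hs₀ (n₁ + acc.length))
      rcases le_total (r' + E) S with h | h
      · rw [Nat.cast_sub h]
        push_cast
        linarith [h4.1, h4.2, h5.1, h5.2]
      · rw [Nat.sub_eq_zero_of_le h]
        exact_mod_cast h6
    obtain ⟨acc', ha, hb, hc⟩ := ih (l := l') (acc := (S + (r' + E), S - (r' + E)) :: acc)
      (by rw [List.length_cons]; omega)
      (by simpa only [List.length_cons, pow_succ, mul_assoc] using hl') ⟨⟨hlow, hs0⟩, hacc⟩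
    · refine ⟨acc', by rw [ha, List.length_cons]; omega, hb, fun k => ?_⟩
      rw [← hc k]
      change advanceK D l 0 0 0 (fun l p n r => boundsK D E m l
        ((p - n + (n - p) + (r + E), p - n + (n - p) - (r + E)) :: acc) k) = _
      rw [hk]

theorem exp_remainder_le {D : ℕ} {w : ℂ} {X d K : ℕ} (hd : 0 < d) (hw : ‖w‖ ≤ (X : ℝ) / d)
    (hX : 2 * X ≤ d * (K + 1)) :
    D * ‖Complex.exp w - ∑ i ∈ Finset.range K, w ^ i / i.factorial‖ ≤
      (2 * D * X ^ K / (d ^ K * K.factorial) + 1 : ℕ) := by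
  have hd' : (0 : ℝ) < d := by exact_mod_cast hd
  have h1 : ‖w‖ / K.succ ≤ 1 / 2 := by
    rw [div_le_iff₀ (by positivity)]
    refine hw.trans ?_
    rw [div_le_iff₀ hd']
    have : (2 * X : ℝ) ≤ d * (K + 1) := by exact_mod_cast hX
    push_cast
    linarith
  have h2 := Complex.exp_bound' h1
  refine le_nat_div_add_one (by positivity) ?_
  calc _ ≤ (D : ℝ) * (‖w‖ ^ K / K.factorial * 2) := by gcongr
    _ ≤ (D : ℝ) * (((X : ℝ) / d) ^ K / K.factorial * 2) := by gcongr
    _ = _ := by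
      push_cast
      rw [div_pow]
      field_simp

theorem vline_quarter_sq (σ i : ℕ) : vline σ (i / 4 : ℝ) ^ 2 =
    ((16 * (σ * σ) - i * i : ℝ) + (8 * (σ * i) : ℝ) * Complex.I) / 16 := by
  rw [vline]
  push_cast
  linear_combination (i ^ 2 / 16 : ℂ) * Complex.I_sq

/-- The value of a node at the beginning. -/
noncomputable def nodeValue (κ σ n : ℕ) (μ : ℝ) (i : ℕ) : ℂ :=
  Complex.exp (vline σ (i / 4 : ℝ) ^ 2 + κ) * (2 * Complex.log (vline σ (i / 4 : ℝ)) * μ) ^ n *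
    (((if i = 0 then 2 else 4) * σ : ℝ) + (i : ℂ) * Complex.I)

/-- The factor of a node. -/
noncomputable def nodeFactor (σ : ℕ) (μ : ℝ) (i : ℕ) : ℂ :=
  2 * Complex.log (vline σ (i / 4 : ℝ)) * μ

theorem nodeFactor_re_nonneg {σ : ℕ} (hσ : 1 ≤ σ) {μ : ℝ} (hμ : 0 ≤ μ) (i : ℕ) :
    0 ≤ (nodeFactor σ μ i).re ∧ 0 ≤ (nodeFactor σ μ i).im := by
  have hσ1 : (1 : ℝ) ≤ σ := by exact_mod_cast hσ
  have hσ0 : (0 : ℝ) < σ := by linarith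
  rw [nodeFactor, two_log_vline hσ0]
  have h1 : 0 ≤ Real.log ((σ : ℝ) ^ 2 + (i / 4 : ℝ) ^ 2) := by
    apply Real.log_nonneg
    have : (0 : ℝ) ≤ (i / 4 : ℝ) ^ 2 := by positivity
    nlinarith
  have h2 : 0 ≤ Real.arctan ((i / 4 : ℝ) / σ) := Real.arctan_nonneg.2 (by positivity)
  generalize Real.log ((σ : ℝ) ^ 2 + (i / 4 : ℝ) ^ 2) = L at h1 ⊢
  generalize Real.arctan ((i / 4 : ℝ) / σ) = A at h2 ⊢
  rw [Complex.re_mul_ofReal, Complex.im_mul_ofReal]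
  constructor
  · refine mul_nonneg ?_ hμ
    simpa using h1
  · refine mul_nonneg ?_ hμ
    simpa using h2

theorem norm_sub_truncated_le {a b c d : ℕ} {z : ℂ} (h1 : 0 ≤ z.re) (h2 : 0 ≤ z.im) :
    ‖z - (⟨(a - b : ℕ), (c - d : ℕ)⟩ : ℂ)‖ ≤ ‖z - (⟨(a : ℝ) - b, (c : ℝ) - d⟩ : ℂ)‖ := by
  have key : ∀ (u : ℝ) (p n : ℕ), 0 ≤ u → |u - (p - n : ℕ)| ≤ |u - ((p : ℝ) - n)| := by
    intro u p n hu
    rcases le_total n p with h | h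
    · rw [Nat.cast_sub h]
    · have : (p : ℝ) ≤ n := by exact_mod_cast h
      rw [Nat.sub_eq_zero_of_le h, Nat.cast_zero, sub_zero, abs_of_nonneg hu,
        abs_of_nonneg (by linarith)]
      linarith
  rw [← sq_le_sq₀ (norm_nonneg _) (norm_nonneg _), Complex.sq_norm, Complex.sq_norm,
    Complex.normSq_apply, Complex.normSq_apply, ← pow_two, ← pow_two, ← pow_two, ← pow_two]
  simp only [Complex.sub_re, Complex.sub_im]
  exact add_le_add (sq_le_sq.2 (key _ _ _ h1)) (sq_le_sq.2 (key _ _ _ h2))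

theorem norm_le_factor_bound {D : ℕ} (hD : 0 < D) {x y e : ℕ} {Λ : ℂ}
    (h : ‖(D : ℂ) * Λ - (⟨x, y⟩ : ℂ)‖ ≤ e) :
    D * ‖Λ‖ ≤ (((x * x + y * y) / D + D) / 2 + 2 + e : ℕ) := by
  have hD' : (0 : ℝ) < D := by exact_mod_cast hD
  have h1 := norm_sub_norm_le ((D : ℂ) * Λ) ⟨x, y⟩
  rw [norm_mul, Complex.norm_natCast] at h1
  set L := ‖(⟨x, y⟩ : ℂ)‖ with hL
  have hL2 : L ^ 2 = (x * x + y * y : ℕ) := by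
    rw [hL, Complex.sq_norm, Complex.normSq_apply]; push_cast; rfl
  have h2 := nat_div_le_add_one hD (x * x + y * y)
  have h3 := nat_div_le_add_one (D := 2) (by norm_num) ((x * x + y * y) / D + D)
  rw [← hL2, div_le_iff₀ hD'] at h2
  push_cast at h3 ⊢
  have h4 : 2 * L ≤ ((x * x + y * y) / D : ℕ) + 1 + D := by nlinarith [sq_nonneg (L - D)]
  linarith

theorem hornerVal_exp (w : ℂ) (K : ℕ) :
    hornerVal (fun _ => 1) (fun m => w / (m + 1 : ℕ)) K 0 =
      ∑ i ∈ Finset.range K, w ^ i / i.factorial := by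
  have h : ∀ i : ℕ, ∏ j ∈ Finset.range i, w / (j + 1 : ℕ) = w ^ i / i.factorial := by
    intro i
    rw [Finset.prod_div_distrib, Finset.prod_const, Finset.card_range,
      ← Finset.prod_range_add_one_eq_factorial]
    push_cast
    rfl
  rw [hornerVal_eq, mul_zero, add_zero]
  exact Finset.sum_congr rfl fun i _ => by rw [h]; simp

theorem expK_spec {D : ℕ} (hD : 0 < D) {κ σ n K i : ℕ} (hn : 0 < n)
    (hK : 2 * (16 * (σ * σ + κ) + i * i + 8 * (σ * i)) ≤ 1024 * n * (K + 1)) :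
    ∃ B, Near D B (Complex.exp ((vline σ (i / 4 : ℝ) ^ 2 + κ) / (64 * n))) ∧ ∀ k : Ball → R,
      hornerK D (fun _ => D) (fun m => ratK D (16 * (σ * σ + κ)) (i * i) (8 * (σ * i))
        (1024 * n * (m + 1))) K zero (fun t => addK t zero (2 * D * (16 * (σ * σ + κ) + i * i +
          8 * (σ * i)) ^ K / ((1024 * n) ^ K * K.factorial) + 1) k) = k B := by
  set w : ℂ := (vline σ (i / 4 : ℝ) ^ 2 + κ) / (64 * n) with hw
  have hnc : (n : ℂ) ≠ 0 := by exact_mod_cast hn.ne'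
  have hd : 0 < 1024 * n := by omega
  have hwd : w = (((16 * (σ * σ + κ) : ℕ) - (i * i : ℕ) : ℝ) + (8 * (σ * i) : ℕ) * Complex.I) /
      (1024 * n : ℕ) := by
    rw [hw, vline_quarter_sq]
    push_cast
    field_simp
    ring
  have hwn : ‖w‖ ≤ ((16 * (σ * σ + κ) + i * i + 8 * (σ * i) : ℕ) : ℝ) / (1024 * n : ℕ) := by
    rw [hwd, norm_div, Complex.norm_natCast]
    gcongr
    refine (norm_add_le _ _).trans ?_
    rw [Complex.norm_real, norm_mul, Complex.norm_I, mul_one, Complex.norm_natCast,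
      Real.norm_eq_abs]
    have := abs_sub ((16 * (σ * σ + κ) : ℕ) : ℝ) (i * i : ℕ)
    rw [Nat.abs_cast, Nat.abs_cast] at this
    push_cast at this ⊢
    linarith
  have hrem := exp_remainder_le (D := D) hd hwn hK
  obtain ⟨t, ht, htk⟩ := hornerK_spec (R := R) hD (c := fun _ => D) (C := fun _ => 1)
    (y := fun m => ratK D (16 * (σ * σ + κ)) (i * i) (8 * (σ * i)) (1024 * n * (m + 1)))
    (Y := fun m => w / (m + 1 : ℕ)) (fun _ => by simp) (fun m => by
      obtain ⟨B, hB, hBk⟩ := ratK_spec (R := R) (D := D) (p := 16 * (σ * σ + κ)) (n := i * i)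
        (q := 8 * (σ * i)) (m := 1024 * n * (m + 1)) (by positivity)
      refine ⟨B, ?_, hBk⟩
      rw [hwd, div_div, ← Nat.cast_mul]
      exact hB) K (near_zero D)
  rw [hornerVal_exp] at ht
  obtain ⟨B, hB, hBk⟩ := addK_spec (R := R) ht (near_zero D) hrem
  refine ⟨B, ?_, fun k => by rw [htk, hBk]⟩
  convert hB using 1
  ring

theorem nodes_spec {D : ℕ} (hD : 0 < D) {κ σ n K₀ K₁ K j₀ j₁ : ℕ} (hσ : 1 ≤ σ) (hn : 0 < n)
    (hn' : n < 2 ^ 14)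
    (hK : 2 * (16 * (σ * σ + κ) + j₁ * j₁ + 8 * (σ * j₁)) ≤ 1024 * n * (K + 1)) {g : Ball} {μ : ℝ}
    (hμ : 0 ≤ μ) (hg : Near D g μ) :
    ∃ js : List ℕ, js.Nodup ∧ js.toFinset = Finset.Ico j₀ j₁ ∧
      List.Forall₂ (fun v j => Node.Valid D v (nodeValue κ σ n μ j) (nodeFactor σ μ j))
        (nodes D κ σ n K₀ K₁ K j₀ j₁ g) js := by
  have h := lineWalkK_spec hD K₀ K₁ hσ (f := nodeStepK D κ σ n K j₀ j₁ g)
    (Inv := fun i S => i ≤ j₁ → ∃ js : List ℕ, js.Nodup ∧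
      (∀ j, j ∈ js ↔ j < i ∧ inWindow j₀ j₁ j = true) ∧
      List.Forall₂ (fun v j => Node.Valid D v (nodeValue κ σ n μ j) (nodeFactor σ μ j)) S js)
    (fun i x S hx hS => ?_) j₁ (s := []) (fun _ => ⟨[], by simp⟩)
  · obtain ⟨js, h1, h2, h3⟩ := h le_rfl
    refine ⟨js, h1, ?_, h3⟩
    ext j
    rw [List.mem_toFinset, h2, inWindow_iff, Finset.mem_Ico]
    tauto
  rcases hact : inWindow j₀ j₁ i with _ | _
  · refine ⟨S, fun hi => ?_, fun k => by rw [nodeStepK, hact]; rfl⟩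
    obtain ⟨js, h1, h2, h3⟩ := hS (by omega)
    refine ⟨js, h1, fun j => ?_, h3⟩
    rw [h2]
    constructor
    · exact fun h => ⟨by omega, h.2⟩
    · intro h
      refine ⟨?_, h.2⟩
      rcases Nat.lt_succ_iff_lt_or_eq.1 h.1 with h' | rfl
      · exact h'
      · rw [hact] at h
        exact absurd h.2 (by decide)
  · have hij : i < j₁ := (inWindow_iff.1 hact).2
    have hKi : 2 * (16 * (σ * σ + κ) + i * i + 8 * (σ * i)) ≤ 1024 * n * (K + 1) := by
      refine le_trans ?_ hK
      gcongr
    obtain ⟨l, hl, hlk⟩ := mulK_spec (R := List Node) hD hx hg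
    obtain ⟨t, ht, htk⟩ := expK_spec (R := List Node) hD (κ := κ) (σ := σ) hn hKi
    obtain ⟨t1, ht1, ht1k⟩ := powK_spec (R := List Node) hD ht 7 64
    obtain ⟨t2, ht2, ht2k⟩ := mulK_spec (R := List Node) hD ht1 hl
    obtain ⟨t3, ht3, ht3k⟩ := powK_spec (R := List Node) hD ht2 14 n
    have hcst : Near D ⟨cond (Nat.beq i 0) (2 * σ) (4 * σ) * D, 0, i * D, 0, 0⟩
        (((if i = 0 then 2 else 4) * σ : ℝ) + (i : ℂ) * Complex.I) := by
      have : center ⟨cond (Nat.beq i 0) (2 * σ) (4 * σ) * D, 0, i * D, 0, 0⟩ =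
          D * ((((if i = 0 then 2 else 4) * σ : ℝ) : ℂ) + (i : ℂ) * Complex.I) := by
        apply Complex.ext
        · rcases i with _ | i
          · simp [center, mul_comm]
          · have : (i + 1).beq 0 = false := rfl
            simp [center, mul_comm, this]
        · rcases i with _ | i <;> simp [center, mul_comm]
      rw [Near, this, sub_self, norm_zero]
      simp
    obtain ⟨t4, ht4, ht4k⟩ := mulK_spec (R := List Node) hD ht3 hcst
    have hval : ((Complex.exp ((vline σ (i / 4 : ℝ) ^ 2 + κ) / (64 * n))) ^ (64 % 2 ^ 7) *
        (2 * Complex.log (vline σ (i / 4 : ℝ)) * μ)) ^ (n % 2 ^ 14) *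
        (((if i = 0 then 2 else 4) * σ : ℝ) + (i : ℂ) * Complex.I) = nodeValue κ σ n μ i := by
      have hnc : (n : ℂ) ≠ 0 := by exact_mod_cast hn.ne'
      rw [Nat.mod_eq_of_lt hn', Nat.mod_eq_of_lt (by norm_num), ← Complex.exp_nat_mul, mul_pow,
        ← Complex.exp_nat_mul, nodeValue]
      congr 3
      push_cast
      field_simp
    rw [hval] at ht4
    obtain ⟨hre, him⟩ := nodeFactor_re_nonneg hσ hμ i
    have hD0 : (0 : ℝ) ≤ D := by positivity
    obtain ⟨a, b, c, d, e⟩ := l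
    obtain ⟨a', b', c', d', r'⟩ := t4
    have hfac : ‖(D : ℂ) * nodeFactor σ μ i - (⟨(a - b : ℕ), (c - d : ℕ)⟩ : ℂ)‖ ≤ e := by
      refine (norm_sub_truncated_le ?_ ?_).trans hl
      · rw [← Complex.ofReal_natCast, Complex.re_ofReal_mul]; positivity
      · rw [← Complex.ofReal_natCast, Complex.im_ofReal_mul]; positivity
    refine ⟨⟨a', b', c', d', r', a - b, c - d, e,
      (((a - b) * (a - b) + (c - d) * (c - d)) / D + D) / 2 + 2 + e⟩ :: S, fun hi => ?_,
      fun k => ?_⟩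
    · obtain ⟨js, h1, h2, h3⟩ := hS (by omega)
      refine ⟨i :: js, List.nodup_cons.2 ⟨fun h => lt_irrefl i ((h2 i).1 h).1, h1⟩, fun j => ?_,
        List.Forall₂.cons ⟨ht4, hfac, norm_le_factor_bound hD hfac⟩ h3⟩
      rw [List.mem_cons, h2, Nat.lt_succ_iff_lt_or_eq]
      constructor
      · rintro (rfl | h)
        · exact ⟨Or.inr rfl, hact⟩
        · exact ⟨Or.inl h.1, h.2⟩
      · rintro ⟨h | h, h'⟩
        · exact Or.inr ⟨h, h'⟩
        · exact Or.inl h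
    · rw [nodeStepK, hact, cond_true, hlk, htk, ht1k, ht2k, ht3k, ht4k]
      rfl

end Nodes

section Verification

open Ball

/-- The scaling factor for the coefficient with index `n`. -/
noncomputable def coeffScale (κ : ℕ) (μ : ℝ) (n : ℕ) : ℝ :=
  Real.exp κ * μ ^ n * (8 * Real.pi * n.factorial)

/-- The series of the moduli of the coefficients from `n`, divided by the monomial. -/
noncomputable def absTail (n : ℕ) (R : ℝ) : ℝ := ∑' k, ‖rgammaCoeff (n + k)‖ * R ^ k

theorem coeffScale_pos (κ : ℕ) {μ : ℝ} (hμ : 0 < μ) (n : ℕ) : 0 < coeffScale κ μ n := by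
  have := Real.pi_pos
  unfold coeffScale
  positivity

theorem summable_absTail {c : ℕ} (hc : c ≤ 20) {R : ℝ} (hR : 0 ≤ R) (hRc : R ≤ c) {n : ℕ}
    (hn : n ≤ 10200) : Summable fun k => ‖rgammaCoeff (n + k)‖ * R ^ k := by
  refine Summable.of_nonneg_of_le (fun k => by positivity) (fun k => ?_)
    (tsum_norm_rgammaCoeff_le (σ := 1) le_rfl hc hn).1
  gcongr

theorem absTail_succ {c : ℕ} (hc : c ≤ 20) {R : ℝ} (hR : 0 ≤ R) (hRc : R ≤ c) {n : ℕ}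
    (hn : n ≤ 10200) : absTail n R = ‖rgammaCoeff n‖ + R * absTail (n + 1) R := by
  rw [absTail, (summable_absTail hc hR hRc hn).tsum_eq_zero_add, absTail, ← tsum_mul_left]
  congr 1
  · simp
  · refine tsum_congr fun k => ?_
    rw [add_assoc n 1 k, add_comm 1 k, pow_succ]
    ring

theorem scaled_absTail_succ (κ : ℕ) {μ : ℝ} (hμ : 0 < μ) {c : ℕ} (hc : c ≤ 20) {R : ℝ} (hR : 0 ≤ R)
    (hRc : R ≤ c) {n : ℕ} (hn : n ≤ 10200) : coeffScale κ μ n * absTail n R =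
      coeffScale κ μ n * ‖rgammaCoeff n‖ +
        R / (μ * (n + 1)) * (coeffScale κ μ (n + 1) * absTail (n + 1) R) := by
  have h1 : (0 : ℝ) < n.factorial := by exact_mod_cast n.factorial_pos
  rw [absTail_succ hc hR hRc hn, coeffScale, coeffScale, Nat.factorial_succ]
  push_cast
  field_simp
  ring

/-- The conditions that imply the error estimate for the partial sum with the terms before
`a_n`. -/
def Certified (n : ℕ) (R : ℝ) : Prop :=
  (20 ≤ R ∨ (2 : ℝ)⁻¹ ^ 8 ≤ 8 * ‖rgammaCoeff n‖ * R ^ n) ∧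
    absTail n R ≤ 8 * R * ‖rgammaCoeff n‖ ∧ absTail n (1 / 2) ≤ 4 * ‖rgammaCoeff n‖

/-- The error estimate for the partial sum with `N` terms. -/
def ErrorEstimate (N : ℕ) : Prop :=
  ∀ z : ℂ, ‖z‖ ≤ 20 → rgammaErrorBound N z < (2 : ℝ)⁻¹ ^ 8 →
    ‖1 / Complex.Gamma (1 + z) - ∑ n ∈ Finset.range N, rgammaShiftCoeff n * z ^ n‖
      ≤ rgammaErrorBound N z

theorem Certified.errorEstimate {N : ℕ} {R : ℝ} {c : ℕ} (hc : c ≤ 20) (hR : 1 / 2 ≤ R) (hRc : R ≤ c)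
    (hN : N + 1 ≤ 10200) (h : Certified (N + 1) R) : ErrorEstimate N := by
  intro z hz hbd
  obtain ⟨h1, h2, h3⟩ := h
  have e : ∀ k, rgammaShiftCoeff (N + k) = rgammaCoeff (N + 1 + k) := fun k => by
    rw [rgammaShiftCoeff, add_right_comm]
  have hs := summable_absTail hc (by linarith) hRc hN
  refine error_bound_of_tsum_le hR ?_ (by simpa only [e] using hs) ?_ ?_ hz hbd
  · refine h1.imp_right fun h => h.trans_eq ?_
    rw [rgammaShiftCoeff, pow_succ]
    ring
  · simp only [e]
    exact h2
  · simp only [e]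
    exact h3

theorem le_run_step {κ : ℕ} {D g p q n u t c : ℕ} (hg : 0 < g) (hq : 0 < q)
    (hc : c ≤ 20) {R : ℝ} (hR0 : 0 ≤ R) (hRc : R ≤ c) (hn : n ≤ 10200) (hR : R = (p : ℝ) / q)
    (hu : D * (coeffScale κ (g / 65536) n * ‖rgammaCoeff n‖) ≤ u)
    (ht : D * (coeffScale κ (g / 65536) (n + 1) * absTail (n + 1) R) ≤ t) :
    D * (coeffScale κ (g / 65536) n * absTail n R) ≤
      (u + t * (p * 65536) / (q * g * (n + 1)) + 1 : ℕ) := by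
  have hg' : (0 : ℝ) < g := by exact_mod_cast hg
  have hq' : (0 : ℝ) < q := by exact_mod_cast hq
  rw [scaled_absTail_succ κ (by positivity) hc hR0 hRc hn, mul_add, add_assoc, Nat.cast_add]
  refine add_le_add hu (le_nat_div_add_one (by positivity) ?_)
  calc _ = R / (g / 65536 * (n + 1)) *
        (D * (coeffScale κ (g / 65536) (n + 1) * absTail (n + 1) R)) := by ring
    _ ≤ R / (g / 65536 * (n + 1)) * t := by gcongr
    _ = _ := by
      rw [hR]
      push_cast
      field_simp

theorem threshold_of_nat_le {κ D g p q n w : ℕ} (hD : 0 < D) (hg : 0 < g) (hq : 0 < q)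
    (hw : (w : ℝ) ≤ D * (coeffScale κ (g / 65536) n * ‖rgammaCoeff n‖))
    (h : 22 * n.factorial * 27183 ^ κ * g ^ n * q ^ n * D ≤
      7 * 256 * w * p ^ n * 65536 ^ n * 10000 ^ κ) :
    (2 : ℝ)⁻¹ ^ 8 ≤ 8 * ‖rgammaCoeff n‖ * ((p : ℝ) / q) ^ n := by
  have hg' : (0 : ℝ) < g := by exact_mod_cast hg
  have hq' : (0 : ℝ) < q := by exact_mod_cast hq
  have hD' : (0 : ℝ) < D := by exact_mod_cast hD
  have hf : (0 : ℝ) < n.factorial := by exact_mod_cast n.factorial_pos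
  have h' : (22 * n.factorial * 27183 ^ κ * g ^ n * q ^ n * D : ℝ) ≤
      7 * 256 * w * p ^ n * 65536 ^ n * 10000 ^ κ := by exact_mod_cast h
  have hexp : Real.exp κ ≤ (27183 : ℝ) ^ κ / 10000 ^ κ := by
    rw [← div_pow, ← mul_one (κ : ℝ), Real.exp_nat_mul]
    gcongr
    linarith [Real.exp_one_lt_d9]
  have hpi : Real.pi ≤ 22 / 7 := by linarith [Real.pi_lt_d4]
  have hpp := Real.pi_pos
  have hscale : coeffScale κ (g / 65536) n ≤
      (27183 : ℝ) ^ κ / 10000 ^ κ * (g / 65536) ^ n * (8 * (22 / 7) * n.factorial) := by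
    unfold coeffScale
    gcongr
  have h1 : (w : ℝ) ≤ D * ((27183 : ℝ) ^ κ / 10000 ^ κ * (g / 65536) ^ n *
      (8 * (22 / 7) * n.factorial) * ‖rgammaCoeff n‖) := hw.trans (by gcongr)
  set a := ‖rgammaCoeff n‖
  have h2 : (22 * n.factorial * 27183 ^ κ * g ^ n * q ^ n * D : ℝ) ≤
      22 * n.factorial * 27183 ^ κ * g ^ n * q ^ n * D * (256 * (8 * a * ((p : ℝ) / q) ^ n)) := by
    refine h'.trans ?_
    calc _ ≤ 7 * 256 * (D * ((27183 : ℝ) ^ κ / 10000 ^ κ * (g / 65536) ^ n *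
          (8 * (22 / 7) * n.factorial) * a)) * p ^ n * 65536 ^ n * 10000 ^ κ := by gcongr
      _ = _ := by
        rw [div_pow, div_pow]
        field_simp
  have h3 : (0 : ℝ) < 22 * n.factorial * 27183 ^ κ * g ^ n * q ^ n * D := by positivity
  have h4 := le_of_mul_le_mul_left (by simpa using h2 : (22 * n.factorial * 27183 ^ κ * g ^ n *
    q ^ n * D : ℝ) * 1 ≤ _) h3
  norm_num
  linarith

theorem runCheck_spec {κ D g lo hi p q c n₁ : ℕ} (hD : 0 < D) (hg : 0 < g) (hq : 0 < q)
    (hc : c ≤ 20) (hpc : p ≤ c * q) (hc1 : 1 ≤ c) (hn₁ : 1 ≤ n₁) (hlo : n₁ ≤ lo)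
    (l : List (ℕ × ℕ)) {n t t' : ℕ} (hn : n + 1 = n₁ + l.length) (hn' : n ≤ 10200)
    (hl : DescBounds D n₁ (fun n => coeffScale κ (g / 65536) n * ‖rgammaCoeff n‖) l)
    (ht : D * (coeffScale κ (g / 65536) (n + 1) * absTail (n + 1) ((p : ℝ) / q)) ≤ t)
    (ht' : D * (coeffScale κ (g / 65536) (n + 1) * absTail (n + 1) (1 / 2)) ≤ t')
    (h : runCheck D κ g lo hi p q l n t t' = true) {i : ℕ} (hlo' : lo ≤ i) (hhi : i < hi)
    (hi' : i ≤ n) (hex : exceptional i = false) : Certified i ((p : ℝ) / q) := by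
  have hg' : (0 : ℝ) < g := by exact_mod_cast hg
  have hq' : (0 : ℝ) < q := by exact_mod_cast hq
  have hD' : (0 : ℝ) < D := by exact_mod_cast hD
  have hR0 : 0 ≤ (p : ℝ) / q := by positivity
  have hRc : (p : ℝ) / q ≤ c := by rw [div_le_iff₀ hq']; exact_mod_cast hpc
  have hc1' : (1 : ℝ) ≤ c := by exact_mod_cast hc1
  induction l generalizing n t t' with
  | nil =>
    rw [List.length_nil] at hn
    omega
  | cons v l ih =>
    obtain ⟨u, w⟩ := v
    rw [List.length_cons] at hn
    have hnl : n = n₁ + l.length := by omega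
    obtain ⟨⟨hw, hu⟩, hl⟩ := hl
    rw [← hnl] at hw hu
    dsimp only at hw hu
    have ht1 := le_run_step hg hq hc hR0 hRc hn' rfl hu ht
    have ht1' := le_run_step (p := 1) (q := 2) hg (by norm_num) hc (by norm_num) (by linarith) hn'
      (by norm_num) hu ht'
    rw [one_mul] at ht1'
    set T := u + t * (p * 65536) / (q * g * (n + 1)) + 1 with hT
    set T' := u + t' * 65536 / (2 * g * (n + 1)) + 1 with hT'
    have hrun : runCheck D κ g lo hi p q ((u, w) :: l) n t t' =
      cond (Nat.blt n lo) true
        (cond (Nat.ble hi n || (exceptional n || (Nat.ble (T * q) (8 * p * w) &&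
          (Nat.ble T' (4 * w) && (Nat.ble (20 * q) p ||
            Nat.ble (22 * n.factorial * 27183 ^ κ * g ^ n * q ^ n * D)
              (7 * 256 * w * p ^ n * 65536 ^ n * 10000 ^ κ))))))
        (runCheck D κ g lo hi p q l (n - 1) T T') false) := by
      rw [hT, hT']; rfl
    rw [hrun] at h
    have hblt : Nat.blt n lo = false := by
      refine Bool.eq_false_iff.2 fun hb => ?_
      rw [Nat.blt, Nat.ble_eq] at hb
      omega
    rw [hblt, cond_false, Bool.cond_false_right, Bool.and_eq_true] at h
    obtain ⟨hchk, hrest⟩ := h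
    rcases eq_or_lt_of_le hi' with rfl | hlt
    · have hb : Nat.ble hi i = false :=
        Bool.eq_false_iff.2 fun hb => by rw [Nat.ble_eq] at hb; omega
      rw [hb, hex, Bool.false_or, Bool.false_or, Bool.and_eq_true, Bool.and_eq_true, Nat.ble_eq,
        Nat.ble_eq, Bool.or_eq_true, Nat.ble_eq, Nat.ble_eq] at hchk
      obtain ⟨c1, c2, c3⟩ := hchk
      have hsc := coeffScale_pos κ (by positivity : (0 : ℝ) < g / 65536) i
      have c1' : (T : ℝ) * q ≤ 8 * p * w := by exact_mod_cast c1
      have c2' : (T' : ℝ) ≤ 4 * w := by exact_mod_cast c2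
      have hDs : 0 < D * coeffScale κ (g / 65536) i := by positivity
      refine ⟨c3.imp (fun h => ?_) (threshold_of_nat_le hD hg hq hw), ?_, ?_⟩
      · rw [le_div_iff₀ hq']
        exact_mod_cast h
      · refine le_of_mul_le_mul_left ?_ hDs
        have : (T : ℝ) ≤ 8 * (p / q) * w := by
          rw [← mul_div_assoc, div_mul_eq_mul_div, le_div_iff₀ hq']
          exact c1'
        calc _ = D * (coeffScale κ (g / 65536) i * absTail i ((p : ℝ) / q)) := by ring
          _ ≤ 8 * (p / q) * w := ht1.trans this
          _ ≤ 8 * (p / q) * (D * (coeffScale κ (g / 65536) i * ‖rgammaCoeff i‖)) := by gcongr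
          _ = _ := by ring
      · refine le_of_mul_le_mul_left ?_ hDs
        calc _ = D * (coeffScale κ (g / 65536) i * absTail i (1 / 2)) := by ring
          _ ≤ 4 * w := ht1'.trans c2'
          _ ≤ 4 * (D * (coeffScale κ (g / 65536) i * ‖rgammaCoeff i‖)) := by gcongr
          _ = _ := by ring
    · have hn1 : n - 1 + 1 = n := by omega
      exact ih (n := n - 1) (by omega) (by omega) hl (by rw [hn1]; exact ht1)
        (by rw [hn1]; exact ht1') hrest (by omega)

theorem absTail_mono {c : ℕ} (hc : c ≤ 20) {R : ℝ} (hR : 0 ≤ R) (hRc : R ≤ c) {n : ℕ}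
    (hn : n ≤ 10200) : absTail n R ≤ absTail n c := by
  refine (summable_absTail hc hR hRc hn).tsum_le_tsum (fun k => ?_)
    (summable_absTail hc (by positivity) le_rfl hn)
  gcongr

theorem runsCheck_spec {κ D g c n₁ lo hi : ℕ} (hD : 0 < D) (hg : 0 < g) (hc : c ≤ 20) (hc1 : 1 ≤ c)
    (hn₁ : 1 ≤ n₁) (hlo : n₁ ≤ lo) {l : List (ℕ × ℕ)} {n t : ℕ} (hn : n + 1 = n₁ + l.length)
    (hn' : n ≤ 10199) (hhi : hi ≤ n + 1)
    (hl : DescBounds D n₁ (fun n => coeffScale κ (g / 65536) n * ‖rgammaCoeff n‖) l)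
    (ht : D * (coeffScale κ (g / 65536) (n + 1) * absTail (n + 1) c) ≤ t) (runs : List (ℕ × ℕ × ℕ))
    (h : runsCheck D κ g c l n t lo hi runs = true) {i : ℕ} (hlo' : lo ≤ i) (hi' : i < hi)
    (hex : exceptional i = false) : ErrorEstimate (i - 1) := by
  induction runs generalizing lo with
  | nil =>
    have h1 : Nat.ble hi lo = true := h
    rw [Nat.ble_eq] at h1
    omega
  | cons v runs ih =>
    obtain ⟨hi₀, p, q⟩ := v
    have h1 : cond (runCheck D κ g lo hi₀ p q l n t t && (Nat.ble lo hi₀ && (Nat.ble 1 q &&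
      (Nat.ble q (2 * p) && Nat.ble p (c * q))))) (runsCheck D κ g c l n t hi₀ hi runs) false =
        true := h
    rw [Bool.cond_false_right, Bool.and_eq_true, Bool.and_eq_true, Bool.and_eq_true,
      Bool.and_eq_true, Bool.and_eq_true, Nat.ble_eq, Nat.ble_eq, Nat.ble_eq, Nat.ble_eq] at h1
    obtain ⟨⟨hr, hlh, hq, hp, hpc⟩, hrest⟩ := h1
    rcases lt_or_ge i hi₀ with hi₁ | hi₁
    · have hq' : (0 : ℝ) < q := by exact_mod_cast hq
      have hg' : (0 : ℝ) < g := by exact_mod_cast hg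
      have hRc : (p : ℝ) / q ≤ c := by rw [div_le_iff₀ hq']; exact_mod_cast hpc
      have hc1' : (1 : ℝ) ≤ c := by exact_mod_cast hc1
      have hsc := (coeffScale_pos κ (by positivity : (0 : ℝ) < g / 65536) (n + 1)).le
      have hmono : ∀ R : ℝ, 0 ≤ R → R ≤ c →
          D * (coeffScale κ (g / 65536) (n + 1) * absTail (n + 1) R) ≤ t := fun R h0 h1 => by
        refine le_trans ?_ ht
        have := absTail_mono hc h0 h1 (n := n + 1) (by omega)
        gcongr
      have hcert := runCheck_spec hD hg hq hc hpc hc1 hn₁ hlo l hn (by omega) hl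
        (hmono _ (by positivity) hRc) (hmono _ (by norm_num) (by linarith)) hr hlo' hi₁ (by omega)
        hex
      obtain ⟨N, rfl⟩ : ∃ N, i = N + 1 := ⟨i - 1, by omega⟩
      refine hcert.errorEstimate hc ?_ hRc (by omega)
      rw [div_le_div_iff₀ (by norm_num) hq']
      have : (q : ℝ) ≤ 2 * p := by exact_mod_cast hp
      linarith
    · exact ih (hlo.trans hlh) hrest hi₁

end Verification

section BlockVerification

open Ball

theorem nodeValue_mul_nodeFactor_pow {κ σ n : ℕ} {μ : ℝ} (i k : ℕ) :
    nodeValue κ σ n μ i * nodeFactor σ μ i ^ k = (Real.exp κ * μ ^ (n + k) : ℝ) *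
      ((if i = 0 then 1 / 2 else 1 : ℝ) * (4 * hankelIntegrand 0 (n + k) (vline σ (i / 4 : ℝ)))) := by
  have e : ((((if i = 0 then 2 else 4) * σ : ℝ) : ℂ) + (i : ℂ) * Complex.I) =
      (if i = 0 then 1 / 2 else 1 : ℝ) * (4 * vline σ (i / 4 : ℝ)) := by
    rcases eq_or_ne i 0 with rfl | hi
    · simp [vline]; ring
    · simp [vline, hi]; ring
  rw [nodeValue, nodeFactor, hankelIntegrand, e, Complex.exp_add, Complex.ofReal_zero, zero_mul,
    sub_zero]
  push_cast
  ring

/-- The conditions on the parameters of a block. -/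
structure BlockParams (D D' κ σ a n m hi c g K j₁ : ℕ) : Prop where
  D_pos : 0 < D
  D'_pos : 0 < D'
  one_le_a : 1 ≤ a
  a_lt : a + 1 ≤ σ
  one_le_n : 1 ≤ n
  even : 2 * ((n + m) / 2) = n + m
  le_bound : n + m ≤ 10200
  hi_le : hi ≤ n + m
  one_le_c : 1 ≤ c
  c_le : c ≤ 20
  g_pos : 0 < g
  j_le : j₁ ≤ 160
  exp_le : 2 * (16 * (σ * σ + κ) + j₁ * j₁ + 8 * (σ * j₁)) ≤ 1024 * n * (K + 1)

theorem abs_scaled_coeff_sub_le {D κ σ a g n k E A B j₀ j₁ : ℕ} (ha : 1 ≤ a) (haσ : a + 1 ≤ σ)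
    (hj : j₁ ≤ 160) (hnk : n + k ≤ 10200) {js : List ℕ} (hjs : js.Nodup)
    (hjs' : js.toFinset = Finset.Ico j₀ j₁)
    (hA : D * (Real.exp κ * (g / 65536 : ℝ) ^ (n + k) *
      (gridSum (σ + a : ℕ) 1 (n + k) 1 + gridSum (σ - a : ℕ) 1 (n + k) 1)) ≤ A)
    (hB : D * (Real.exp κ * (g / 65536 : ℝ) ^ (n + k) *
      (∑ i ∈ Finset.range 160 \ Finset.Ico j₀ j₁, gridTerm σ 1 (n + k) 0 i +
      2 * gridTerm σ 1 (n + k) 0 160)) ≤ B) (hE : 2 * A / 2 ^ (36 * a) + 1 + B = E) :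
    D * |coeffScale κ (g / 65536) (n + k) * ‖rgammaCoeff (n + k)‖ -
      abs ((js.map fun j => (nodeValue κ σ n (g / 65536) j *
        nodeFactor σ (g / 65536) j ^ k).re).sum)| ≤ E := by
  have hW : Finset.Ico j₀ j₁ ⊆ Finset.range 160 := fun j hj' => by
    rw [Finset.mem_Ico] at hj'
    exact Finset.mem_range.2 (by omega)
  have haσ' : (1 : ℝ) ≤ σ - a := by
    have : ((a + 1 : ℕ) : ℝ) ≤ σ := by exact_mod_cast haσ
    push_cast at this
    linarith
  have h := trapezoid_error ha haσ' hnk hW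
  have e1 : ((σ + a : ℕ) : ℝ) = σ + a := by push_cast; ring
  have e2 : ((σ - a : ℕ) : ℝ) = σ - a := Nat.cast_sub (by omega)
  rw [e1, e2] at hA
  set S := Real.exp κ * (g / 65536 : ℝ) ^ (n + k) with hS
  have hS0 : 0 ≤ S := by positivity
  set G := gridSum (σ + a) 1 (n + k) 1 + gridSum (σ - a) 1 (n + k) 1
  set O := ∑ i ∈ Finset.range 160 \ Finset.Ico j₀ j₁, gridTerm σ 1 (n + k) 0 i +
    2 * gridTerm σ 1 (n + k) 0 160
  set T := ∑ j ∈ Finset.Ico j₀ j₁, (if j = 0 then 1 / 2 else 1) *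
        (4 * (hankelIntegrand 0 (n + k) (vline σ (j / 4))).re) with hT
  have hsum : (js.map fun j => (nodeValue κ σ n (g / 65536) j *
        nodeFactor σ (g / 65536) j ^ k).re).sum = S * T := by
    rw [← List.sum_toFinset _ hjs, hjs', hT, Finset.mul_sum]
    refine Finset.sum_congr rfl fun j _ => ?_
    rw [nodeValue_mul_nodeFactor_pow, Complex.re_ofReal_mul, Complex.re_ofReal_mul]
    congr 2
    simp
  have hD0 : (0 : ℝ) ≤ D := by positivity
  rw [hsum, abs_mul, abs_of_nonneg hS0, coeffScale, ← hS, mul_assoc S, ← mul_sub, abs_mul,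
    abs_of_nonneg hS0]
  have h2 := nat_div_le_add_one (D := 2 ^ (36 * a)) (by positivity) (2 * A)
  calc _ ≤ D * (S * (2 / 2 ^ (36 * a) * G + O)) := by gcongr
    _ = 2 / 2 ^ (36 * a) * (D * (S * G)) + D * (S * O) := by ring
    _ ≤ 2 / 2 ^ (36 * a) * A + B := by gcongr
    _ ≤ E := by
      rw [← hE]
      push_cast at h2 ⊢
      rw [div_mul_eq_mul_div]
      linarith

theorem blockCheck_spec {D D' κ σ a n m hi c g K₀ K₁ K j₀ j₁ : ℕ} {runs : List (ℕ × ℕ × ℕ)}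
    (hp : BlockParams D D' κ σ a n m hi c g K j₁)
    (h : blockCheck D D' κ σ a n m hi c g K₀ K₁ K j₀ j₁ runs = true) {i : ℕ} (hi₁ : n ≤ i)
    (hi₂ : i < hi) (hex : exceptional i = false) : ErrorEstimate (i - 1) := by
  obtain ⟨hD, hD', ha, haσ, hn, heven, hnm, hhi, hc1, hc, hg, hj, hexp⟩ := hp
  have hg' : (0 : ℝ) < g := by exact_mod_cast hg
  have hμ : (0 : ℝ) ≤ g / 65536 := by positivity
  have hrat : ((((g : ℝ) - (0 : ℕ) : ℝ) : ℂ) + (0 : ℕ) * Complex.I) / (65536 : ℕ) =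
      ((g / 65536 : ℝ) : ℂ) := by
    push_cast
    ring
  obtain ⟨G, hG, hGk⟩ := ratK_spec (R := Bool) (D := D) (p := g) (n := 0) (q := 0) (m := 65536)
    (by norm_num)
  obtain ⟨G', hG', hGk'⟩ := ratK_spec (R := Bool) (D := D') (p := g) (n := 0) (q := 0) (m := 65536)
    (by norm_num)
  rw [hrat] at hG hG'
  set h₁ := n / 2
  set h₂ := (n + m) / 2
  set A := gridSumUpper D D' κ (σ + a) 0 h₁ h₂ 1 0 0 G' +
    gridSumUpper D D' κ (σ - a) 0 h₁ h₂ 1 0 0 G' with hA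
  set B := gridSumUpper D D' κ σ 0 h₁ h₂ 0 j₀ j₁ G' with hB
  set T := 2 ^ c * gridSumUpper D D' κ σ c h₂ h₂ 1 0 0 G' with hT
  have hstep : blockCheck D D' κ σ a n m hi c g K₀ K₁ K j₀ j₁ runs =
      boundsK D (2 * A / 2 ^ (36 * a) + 1 + B) m (nodes D κ σ n K₀ K₁ K j₀ j₁ G) []
        fun l => runsCheck D κ g c l (n + m - 1) T n hi runs := by
    simp only [blockCheck, force_eq, hGk, hGk']
    rfl
  rw [hstep] at h
  have hgrid : ∀ σ' : ℕ, 1 ≤ σ' → ∀ k < m, D * (Real.exp κ * (g / 65536 : ℝ) ^ (n + k) *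
      gridSum σ' 1 (n + k) 1) ≤ gridSumUpper D D' κ σ' 0 h₁ h₂ 1 0 0 G' := fun σ' hσ' k hk => by
    have := gridSum_le (D := D) hD' κ hσ' 0 (h₁ := h₁) (h₂ := h₂) (n := n + k) (by omega) (by omega)
      hμ hG'
    rwa [mul_zero, zero_add] at this
  obtain ⟨js, hjs, hjs', hjs''⟩ := nodes_spec hD (κ := κ) (K₀ := K₀) (K₁ := K₁) (K := K) (j₀ := j₀)
    (by omega : 1 ≤ σ) hn (by omega) hexp hμ hG
  obtain ⟨l, hl, hdesc, hlk⟩ := boundsK_spec (R := Bool) hD (n₁ := n) (M := m)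
    (E := 2 * A / 2 ^ (36 * a) + 1 + B) (js := js) (Y := nodeValue κ σ n (g / 65536))
    (Λ := nodeFactor σ (g / 65536))
    (s := fun n => coeffScale κ (g / 65536) n * ‖rgammaCoeff n‖)
    (fun n => mul_nonneg (coeffScale_pos κ (by positivity) n).le (norm_nonneg _))
    (fun k hk => abs_scaled_coeff_sub_le (D := D) (a := a) (A := A) (B := B) ha haσ hj (by omega)
      hjs hjs' (by
        have h1 := hgrid (σ + a) (by omega) k hk
        have h2 := hgrid (σ - a) (by omega) k hk
        rw [hA, Nat.cast_add (gridSumUpper _ _ _ _ _ _ _ _ _ _ _)]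
        linarith)
      (gridSum_omitted_le hD' κ (by omega) hj (by omega) (by omega) hμ hG') rfl) m
    (l := nodes D κ σ n K₀ K₁ K j₀ j₁ G) (acc := []) (by simp) (by simpa using hjs'') trivial
  rw [hlk] at h
  rw [List.length_nil, zero_add] at hl
  refine runsCheck_spec hD hg hc hc1 hn le_rfl (by omega) (by omega) (by omega) hdesc ?_ runs h hi₁
    hi₂ hex
  have e : n + m - 1 + 1 = n + m := by omega
  have htail := (tsum_norm_rgammaCoeff_le (σ := σ) (by exact_mod_cast (by omega : 1 ≤ σ)) hc hnm).2
  have hgr := gridSum_le (D := D) hD' κ (by omega : 1 ≤ σ) c (h₁ := h₂) (h₂ := h₂) (n := n + m)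
    (by omega) (by omega) hμ hG'
  have hD0 : (0 : ℝ) ≤ D := by positivity
  rw [e, coeffScale, hT]
  push_cast
  calc _ = D * (Real.exp κ * (g / 65536 : ℝ) ^ (n + m) *
        (8 * Real.pi * (n + m).factorial * absTail (n + m) c)) := by ring
    _ ≤ D * (Real.exp κ * (g / 65536 : ℝ) ^ (n + m) *
        (2 ^ c * gridSum σ (2 * c + 1) (n + m) 1)) := by
        unfold absTail
        gcongr
    _ = 2 ^ c * (D * (Real.exp κ * (g / 65536 : ℝ) ^ (n + m) *
        gridSum σ (2 * c + 1) (n + m) 1)) := by ring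
    _ ≤ _ := by gcongr

end BlockVerification

section MainTheorem

theorem errorEstimate_of_mem_Ico_1_30 {i : ℕ} (h₁ : 1 ≤ i) (h₂ : i < 30)
    (hex : exceptional i = false) : ErrorEstimate (i - 1) :=
  blockCheck_spec (D := 2 ^ 128) (D' := 2 ^ 40) (κ := 0) (σ := 2) (a := 1) (n := 1) (m := 89)
    (hi := 30) (c := 6) (g := 19523) (K₀ := 42) (K₁ := 16) (K := 38) (j₀ := 0) (j₁ := 29)
    (runs := [(9, 732, 1024), (30, 3563, 1024)])
    (by constructor <;> norm_num) (by decide +kernel) h₁ h₂ hex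

theorem errorEstimate_of_mem_Ico_30_60 {i : ℕ} (h₁ : 30 ≤ i) (h₂ : i < 60)
    (hex : exceptional i = false) : ErrorEstimate (i - 1) :=
  blockCheck_spec (D := 2 ^ 128) (D' := 2 ^ 40) (κ := 0) (σ := 2) (a := 1) (n := 30) (m := 90)
    (hi := 60) (c := 9) (g := 17215) (K₀ := 42) (K₁ := 16) (K := 19) (j₀ := 0) (j₁ := 33)
    (runs := [(46, 5575, 1024), (60, 6761, 1024)])
    (by constructor <;> norm_num) (by decide +kernel) h₁ h₂ hex

theorem errorEstimate_of_mem_Ico_60_100 {i : ℕ} (h₁ : 60 ≤ i) (h₂ : i < 100)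
    (hex : exceptional i = false) : ErrorEstimate (i - 1) :=
  blockCheck_spec (D := 2 ^ 128) (D' := 2 ^ 40) (κ := 20) (σ := 2) (a := 1) (n := 60) (m := 140)
    (hi := 100) (c := 14) (g := 15244) (K₀ := 42) (K₁ := 16) (K := 18) (j₀ := 3) (j₁ := 37)
    (runs := [(100, 10581, 1024)])
    (by constructor <;> norm_num) (by decide +kernel) h₁ h₂ hex

theorem errorEstimate_of_mem_Ico_100_160 {i : ℕ} (h₁ : 100 ≤ i) (h₂ : i < 160)
    (hex : exceptional i = false) : ErrorEstimate (i - 1) :=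
  blockCheck_spec (D := 2 ^ 128) (D' := 2 ^ 40) (κ := 27) (σ := 2) (a := 1) (n := 100) (m := 200)
    (hi := 160) (c := 20) (g := 14477) (K₀ := 42) (K₁ := 16) (K := 17) (j₀ := 7) (j₁ := 42)
    (runs := [(160, 15876, 1024)])
    (by constructor <;> norm_num) (by decide +kernel) h₁ h₂ hex

theorem errorEstimate_of_mem_Ico_160_260 {i : ℕ} (h₁ : 160 ≤ i) (h₂ : i < 260)
    (hex : exceptional i = false) : ErrorEstimate (i - 1) :=
  blockCheck_spec (D := 2 ^ 128) (D' := 2 ^ 40) (κ := 41) (σ := 2) (a := 1) (n := 160) (m := 260)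
    (hi := 260) (c := 20) (g := 13585) (K₀ := 42) (K₁ := 16) (K := 16) (j₀ := 11) (j₁ := 47)
    (runs := [(260, 20, 1)])
    (by constructor <;> norm_num) (by decide +kernel) h₁ h₂ hex

theorem errorEstimate_of_mem_Ico_260_400 {i : ℕ} (h₁ : 260 ≤ i) (h₂ : i < 400)
    (hex : exceptional i = false) : ErrorEstimate (i - 1) :=
  blockCheck_spec (D := 2 ^ 128) (D' := 2 ^ 40) (κ := 57) (σ := 2) (a := 1) (n := 260) (m := 260)
    (hi := 400) (c := 20) (g := 12970) (K₀ := 42) (K₁ := 16) (K := 15) (j₀ := 16) (j₁ := 50)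
    (runs := [(400, 20, 1)])
    (by constructor <;> norm_num) (by decide +kernel) h₁ h₂ hex

theorem errorEstimate_of_mem_Ico_400_800 {i : ℕ} (h₁ : 400 ≤ i) (h₂ : i < 800)
    (hex : exceptional i = false) : ErrorEstimate (i - 1) :=
  blockCheck_spec (D := 2 ^ 128) (D' := 2 ^ 40) (κ := 90) (σ := 3) (a := 2) (n := 400) (m := 500)
    (hi := 800) (c := 20) (g := 12052) (K₀ := 42) (K₁ := 14) (K := 15) (j₀ := 24) (j₁ := 59)
    (runs := [(800, 20, 1)])
    (by constructor <;> norm_num) (by decide +kernel) h₁ h₂ hex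

theorem errorEstimate_of_mem_Ico_800_1400 {i : ℕ} (h₁ : 800 ≤ i) (h₂ : i < 1400)
    (hex : exceptional i = false) : ErrorEstimate (i - 1) :=
  blockCheck_spec (D := 2 ^ 128) (D' := 2 ^ 40) (κ := 158) (σ := 3) (a := 2) (n := 800) (m := 700)
    (hi := 1400) (c := 20) (g := 11125) (K₀ := 42) (K₁ := 14) (K := 15) (j₀ := 36) (j₁ := 71)
    (runs := [(1400, 20, 1)])
    (by constructor <;> norm_num) (by decide +kernel) h₁ h₂ hex

theorem errorEstimate_of_mem_Ico_1400_2100 {i : ℕ} (h₁ : 1400 ≤ i) (h₂ : i < 2100)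
    (hex : exceptional i = false) : ErrorEstimate (i - 1) :=
  blockCheck_spec (D := 2 ^ 144) (D' := 2 ^ 40) (κ := 243) (σ := 4) (a := 2) (n := 1400) (m := 800)
    (hi := 2100) (c := 20) (g := 10492) (K₀ := 47) (K₁ := 15) (K := 16) (j₀ := 48) (j₁ := 83)
    (runs := [(2100, 20, 1)])
    (by constructor <;> norm_num) (by decide +kernel) h₁ h₂ hex

theorem errorEstimate_of_mem_Ico_2100_3000 {i : ℕ} (h₁ : 2100 ≤ i) (h₂ : i < 3000)
    (hex : exceptional i = false) : ErrorEstimate (i - 1) :=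
  blockCheck_spec (D := 2 ^ 128) (D' := 2 ^ 40) (κ := 350) (σ := 4) (a := 2) (n := 2100) (m := 990)
    (hi := 3000) (c := 20) (g := 9975) (K₀ := 42) (K₁ := 13) (K := 14) (j₀ := 61) (j₁ := 94)
    (runs := [(3000, 20, 1)])
    (by constructor <;> norm_num) (by decide +kernel) h₁ h₂ hex

theorem errorEstimate_of_mem_Ico_3000_4000 {i : ℕ} (h₁ : 3000 ≤ i) (h₂ : i < 4000)
    (hex : exceptional i = false) : ErrorEstimate (i - 1) :=
  blockCheck_spec (D := 2 ^ 128) (D' := 2 ^ 40) (κ := 464) (σ := 5) (a := 2) (n := 3000) (m := 1090)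
    (hi := 4000) (c := 20) (g := 9609) (K₀ := 42) (K₁ := 13) (K := 14) (j₀ := 73) (j₁ := 105)
    (runs := [(4000, 20, 1)])
    (by constructor <;> norm_num) (by decide +kernel) h₁ h₂ hex

theorem errorEstimate_of_mem_Ico_4000_5100 {i : ℕ} (h₁ : 4000 ≤ i) (h₂ : i < 5100)
    (hex : exceptional i = false) : ErrorEstimate (i - 1) :=
  blockCheck_spec (D := 2 ^ 128) (D' := 2 ^ 40) (κ := 593) (σ := 5) (a := 2) (n := 4000) (m := 1190)
    (hi := 5100) (c := 20) (g := 9310) (K₀ := 42) (K₁ := 13) (K := 14) (j₀ := 84) (j₁ := 115)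
    (runs := [(5100, 20, 1)])
    (by constructor <;> norm_num) (by decide +kernel) h₁ h₂ hex

theorem errorEstimate_of_mem_Ico_5100_6300 {i : ℕ} (h₁ : 5100 ≤ i) (h₂ : i < 6300)
    (hex : exceptional i = false) : ErrorEstimate (i - 1) :=
  blockCheck_spec (D := 2 ^ 128) (D' := 2 ^ 40) (κ := 729) (σ := 6) (a := 2) (n := 5100) (m := 1290)
    (hi := 6300) (c := 20) (g := 9069) (K₀ := 42) (K₁ := 12) (K := 14) (j₀ := 95) (j₁ := 125)
    (runs := [(6300, 20, 1)])
    (by constructor <;> norm_num) (by decide +kernel) h₁ h₂ hex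

theorem errorEstimate_of_mem_Ico_6300_7500 {i : ℕ} (h₁ : 6300 ≤ i) (h₂ : i < 7500)
    (hex : exceptional i = false) : ErrorEstimate (i - 1) :=
  blockCheck_spec (D := 2 ^ 128) (D' := 2 ^ 40) (κ := 859) (σ := 6) (a := 2) (n := 6300) (m := 1290)
    (hi := 7500) (c := 20) (g := 8884) (K₀ := 42) (K₁ := 12) (K := 14) (j₀ := 106) (j₁ := 134)
    (runs := [(7500, 20, 1)])
    (by constructor <;> norm_num) (by decide +kernel) h₁ h₂ hex

theorem errorEstimate_of_mem_Ico_7500_8700 {i : ℕ} (h₁ : 7500 ≤ i) (h₂ : i < 8700)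
    (hex : exceptional i = false) : ErrorEstimate (i - 1) :=
  blockCheck_spec (D := 2 ^ 128) (D' := 2 ^ 40) (κ := 1011) (σ := 6) (a := 2) (n := 7500) (m := 1290)
    (hi := 8700) (c := 20) (g := 8709) (K₀ := 42) (K₁ := 12) (K := 13) (j₀ := 116) (j₁ := 143)
    (runs := [(8700, 20, 1)])
    (by constructor <;> norm_num) (by decide +kernel) h₁ h₂ hex

theorem errorEstimate_of_mem_Ico_8700_10002 {i : ℕ} (h₁ : 8700 ≤ i) (h₂ : i < 10002)
    (hex : exceptional i = false) : ErrorEstimate (i - 1) :=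
  blockCheck_spec (D := 2 ^ 128) (D' := 2 ^ 40) (κ := 1152) (σ := 7) (a := 2) (n := 8700) (m := 1392)
    (hi := 10002) (c := 20) (g := 8571) (K₀ := 42) (K₁ := 12) (K := 13) (j₀ := 124) (j₁ := 151)
    (runs := [(10002, 20, 1)])
    (by constructor <;> norm_num) (by decide +kernel) h₁ h₂ hex

theorem errorEstimate {N : ℕ} (hN : N ≤ 10000) (hex : N ∉ ({1443, 2005, 9891} : Set ℕ)) :
    ErrorEstimate N := by
  have hex' : exceptional (N + 1) = false := by
    simp only [Set.mem_insert_iff, Set.mem_singleton_iff, not_or] at hex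
    refine Bool.eq_false_iff.2 fun h => ?_
    rw [exceptional, Bool.or_eq_true, Bool.or_eq_true] at h
    rcases h with h | h | h
    all_goals
      have := Nat.eq_of_beq_eq_true h
      omega
  have h1 : 1 ≤ N + 1 := by omega
  have h2 : N + 1 < 10002 := by omega
  generalize hi : N + 1 = i at hex' h1 h2
  obtain rfl : N = i - 1 := by omega
  rcases lt_or_ge i 30 with h | h30
  · exact errorEstimate_of_mem_Ico_1_30 h1 h hex'
  rcases lt_or_ge i 60 with h | h60
  · exact errorEstimate_of_mem_Ico_30_60 h30 h hex'
  rcases lt_or_ge i 100 with h | h100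
  · exact errorEstimate_of_mem_Ico_60_100 h60 h hex'
  rcases lt_or_ge i 160 with h | h160
  · exact errorEstimate_of_mem_Ico_100_160 h100 h hex'
  rcases lt_or_ge i 260 with h | h260
  · exact errorEstimate_of_mem_Ico_160_260 h160 h hex'
  rcases lt_or_ge i 400 with h | h400
  · exact errorEstimate_of_mem_Ico_260_400 h260 h hex'
  rcases lt_or_ge i 800 with h | h800
  · exact errorEstimate_of_mem_Ico_400_800 h400 h hex'
  rcases lt_or_ge i 1400 with h | h1400
  · exact errorEstimate_of_mem_Ico_800_1400 h800 h hex'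
  rcases lt_or_ge i 2100 with h | h2100
  · exact errorEstimate_of_mem_Ico_1400_2100 h1400 h hex'
  rcases lt_or_ge i 3000 with h | h3000
  · exact errorEstimate_of_mem_Ico_2100_3000 h2100 h hex'
  rcases lt_or_ge i 4000 with h | h4000
  · exact errorEstimate_of_mem_Ico_3000_4000 h3000 h hex'
  rcases lt_or_ge i 5100 with h | h5100
  · exact errorEstimate_of_mem_Ico_4000_5100 h4000 h hex'
  rcases lt_or_ge i 6300 with h | h6300
  · exact errorEstimate_of_mem_Ico_5100_6300 h5100 h hex'
  rcases lt_or_ge i 7500 with h | h7500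
  · exact errorEstimate_of_mem_Ico_6300_7500 h6300 h hex'
  rcases lt_or_ge i 8700 with h | h8700
  · exact errorEstimate_of_mem_Ico_7500_8700 h7500 h hex'
  exact errorEstimate_of_mem_Ico_8700_10002 h8700 h2 hex'

theorem mainTheorem7 :
    (∀ (N : ℕ) (z : ℂ), N ≤ 1000 → ‖z‖ ≤ 20 →
      rgammaErrorBound N z < (2 : ℝ)⁻¹ ^ 8 →
      ‖1 / Complex.Gamma (1 + z) - ∑ n ∈ Finset.range N, rgammaShiftCoeff n * z ^ n‖
        ≤ rgammaErrorBound N z) ∧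
    (∀ (N : ℕ) (z : ℂ), N ≤ 10000 → N ∉ ({1443, 2005, 9891} : Set ℕ) → ‖z‖ ≤ 20 →
      rgammaErrorBound N z < (2 : ℝ)⁻¹ ^ 8 →
      ‖1 / Complex.Gamma (1 + z) - ∑ n ∈ Finset.range N, rgammaShiftCoeff n * z ^ n‖
        ≤ rgammaErrorBound N z) := by
  refine ⟨fun N z hN hz hbd => errorEstimate (by omega) ?_ z hz hbd,
    fun N z hN hex hz hbd => errorEstimate hN hex z hz hbd⟩
  simp only [Set.mem_insert_iff, Set.mem_singleton_iff]
  omega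

end MainTheorem
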